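/- Let $d\ge 1$. For a Young diagram $\lambda=(\lambda_1\ge\dots\ge\lambda_d\ge 0)$ with $n$ boxes let $y_\lambda=q_\lambda p_\lambda$ be its Young symmetriser acting on $(\mathbb C^d)^{\otimes n}$, the tensor factors being attached to the boxes of $\lambda$ along the rows from top to bottom: $p_\lambda$ is the sum of all permutations of the factors preserving the rows, $q_\lambda$ the sum, with signs, of all those preserving the columns. Let $\mathcal H_\lambda={\rm Range}(y_\lambda)$ be the corresponding irreducible $SU(d)$-space, with the inner product of $(\mathbb C^d)^{\otimes n}$. For $\mathbf m=(m_{j,k})_{1\le j<k\le d}\in\mathbb N^{d(d-1)/2}$ put $|\mathbf m|=\sum_{j<k} m_{j,k}$, let $f_{\mathbf m}$ be the standard basis vector of $(\mathbb C^d)^{\otimes n}$ given by the tableau of shape $\lambda$ whose $i$-th row is non-decreasing and contains $m_{i,j}$ entries $j$ for each $j>i$, all other entries being $i$, and put $|\mathbf m,\lambda\rangle=y_\lambda f_{\mathbf m}/\|y_\lambda f_{\mathbf m}\|$. For a density matrix $\rho$ on $\mathbb C^d$, the block state $\rho_\lambda$ is the restriction of $\rho^{\otimes n}$ to $\mathcal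 H_\lambda$ divided by its trace. Let $\mathcal F=\bigotimes_{j<k}L^2(\mathbb R)$ be the Fock space of $d(d-1)/2$ harmonic oscillators with number basis $|\mathbf m\rangle$, and let $\|\cdot\|_1$ denote the trace norm. Let $\mu_1>\dots>\mu_d>0$ with $\sum_i\mu_i=1$, and let $\delta>0$ be such that $\mu_i-\mu_{i+1}\ge\delta$ for $1\le i\le d$, where $\mu_{d+1}=0$. Let $$\Phi^{0}=\bigotimes_{j<k}\Phi_{j,k},\qquad \Phi_{j,k}=(1-e^{-\beta_{j,k}})\sum_{m\ge0}e^{-m\beta_{j,k}}|m\rangle\langle m|,\qquad \beta_{j,k}=\ln(\mu_j/\mu_k).$$ For $u\in\mathbb R^{d-1}$ let $\rho^{0,u,n}_\lambda$ be the block state of the diagonal matrix with entries $\mu_i+u_i/\sqrt n$ for $i<d$ and $\mu_d-\sum_{i<d} u_i/\sqrt n$. For $\alpha\in(1/2,1)$ let $\Lambda_{n,\alpha}$ be the set of Young diagrams $\lambda$ with at most $d$ rows and $n$ boxes such that $|\lambda_i-n\mu_i|\le n^\alpha$ for all $1\le i\le d$. Let $0<\eta<2/9$. There is a constant $\tilde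 C=\tilde C(\eta,d)>0$ such that for all $1/2<\alpha<1$ and $0<\gamma<1/2$ there is a constant $C=C(d,\eta,\alpha,\gamma)$ with the following property. For every $\delta>0$ there is $n_0$ such that for all $n\ge n_0$, all $\mu$ as above and all $\lambda\in\Lambda_{n,\alpha}$: (i) there is an isometry $V_\lambda:\mathcal H_\lambda\to\mathcal F$ with $V_\lambda|\mathbf 0,\lambda\rangle=|\mathbf 0\rangle$ and $$\langle\mathbf m|V_\lambda=\frac{1}{\sqrt{1+(\tilde Cn)^{(9\eta-2)/12}/\delta^{1/3}}}\,\langle\mathbf m,\lambda|\qquad\text{whenever } \mathbf m\ne\mathbf 0,\ |\mathbf m|\le n^\eta ;$$ (ii) for every such isometry $V_\lambda$, with $T_\lambda(\rho)=V_\lambda\rho V_\lambda^*$, and for all $u\in\mathbb R^{d-1}$ with $\|u\|_\infty\le n^\gamma$, $$\left\|\Phi^{0}-T_\lambda(\rho^{0,u,n}_\lambda)\right\|_1\le C\left(\frac{n^{-1/2+\gamma+\eta}}{\delta}+\frac{n^{(9\eta-2)/24}}{\delta^{1/6}}\right).$$ -/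

import Mathlib

open scoped ENNReal

noncomputable section

namespace QLAN

/-! ### Tensor space, Young symmetriser, and the irreducible block of a diagram -/

/-- The boxes of the Young diagram with row lengths `lam`: a row, and a column within this row. -/
abbrev Box {d : ℕ} (lam : Fin d → ℕ) : Type := Σ i : Fin d, Fin (lam i)

/-- The Hilbert space `(ℂ^d)^{⊗ n}`, `n = ∑ i, lam i`, in its standard orthonormal basis
`f_a = f_{a(1)} ⊗ ⋯ ⊗ f_{a(n)}`. The `n` tensor factors are labelled by the boxes of the diagram
(read along the rows, from the top row to the bottom row). -/
abbrev TensorSpace {d : ℕ} (lam : Fin d → ℕ) : Type := EuclideanSpace ℂ (Box lam → Fin d)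

/-- The action of a permutation of the tensor factors: `f_a ↦ f_{a ∘ σ⁻¹}`. -/
def permAct {d : ℕ} (lam : Fin d → ℕ) (σ : Equiv.Perm (Box lam)) :
    TensorSpace lam →ₗ[ℂ] TensorSpace lam where
  toFun x := WithLp.toLp 2 (fun a => x (a ∘ σ))
  map_add' x y := by ext a; simp
  map_smul' c x := by ext a; simp

/-- Permutations of the boxes that preserve every row. -/
def rowGroup {d : ℕ} (lam : Fin d → ℕ) : Finset (Equiv.Perm (Box lam)) :=
  Finset.univ.filter (fun σ => ∀ b, (σ b).1 = b.1)

/-- Permutations of the boxes that preserve every column. -/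
def colGroup {d : ℕ} (lam : Fin d → ℕ) : Finset (Equiv.Perm (Box lam)) :=
  Finset.univ.filter (fun τ => ∀ b, ((τ b).2 : ℕ) = (b.2 : ℕ))

/-- The row symmetriser `p_λ`. -/
def rowSym {d : ℕ} (lam : Fin d → ℕ) : TensorSpace lam →ₗ[ℂ] TensorSpace lam :=
  ∑ σ ∈ rowGroup lam, permAct lam σ

/-- The column antisymmetriser `q_λ`. -/
def colAntisym {d : ℕ} (lam : Fin d → ℕ) : TensorSpace lam →ₗ[ℂ] TensorSpace lam :=
  ∑ τ ∈ colGroup lam, ((Equiv.Perm.sign τ : ℤ) : ℂ) • permAct lam τ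

/-- The Young symmetriser `y_λ = q_λ p_λ`. -/
def youngSym {d : ℕ} (lam : Fin d → ℕ) : TensorSpace lam →ₗ[ℂ] TensorSpace lam :=
  colAntisym lam ∘ₗ rowSym lam

/-- The irreducible block `H_λ`, realised as the range of the Young symmetriser, with the inner
product of the tensor space. -/
abbrev Block {d : ℕ} (lam : Fin d → ℕ) : Submodule ℂ (TensorSpace lam) :=
  LinearMap.range (youngSym lam)

/-- The operator `A^{⊗ n}` on the tensor space. -/
def tensorPower {d : ℕ} (lam : Fin d → ℕ) (A : Matrix (Fin d) (Fin d) ℂ) :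
    TensorSpace lam →ₗ[ℂ] TensorSpace lam :=
  Matrix.toEuclideanLin (Matrix.of fun a b : Box lam → Fin d => ∏ k, A (a k) (b k))

theorem tensorPower_apply {d : ℕ} (lam : Fin d → ℕ) (A : Matrix (Fin d) (Fin d) ℂ)
    (x : TensorSpace lam) (a : Box lam → Fin d) :
    tensorPower lam A x a = ∑ b : Box lam → Fin d, (∏ k, A (a k) (b k)) * x b := by
  simp [tensorPower, Matrix.toLpLin_apply, Matrix.mulVec, dotProduct]

theorem tensorPower_permAct {d : ℕ} (lam : Fin d → ℕ) (A : Matrix (Fin d) (Fin d) ℂ)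
    (σ : Equiv.Perm (Box lam)) (x : TensorSpace lam) :
    tensorPower lam A (permAct lam σ x) = permAct lam σ (tensorPower lam A x) := by
  ext a
  change tensorPower lam A (permAct lam σ x) a = tensorPower lam A x (a ∘ σ)
  rw [tensorPower_apply, tensorPower_apply]
  refine Fintype.sum_equiv (σ.symm.arrowCongr (Equiv.refl (Fin d))) _ _ fun b => ?_
  have h1 : (σ.symm.arrowCongr (Equiv.refl (Fin d))) b = b ∘ σ := by
    ext k; simp [Equiv.arrowCongr]
  rw [h1]
  have h2 : ∏ k, A (a k) (b k) = ∏ k, A ((a ∘ σ) k) ((b ∘ σ) k) :=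
    (Equiv.prod_comp σ (fun k => A (a k) (b k))).symm
  rw [h2]
  rfl

theorem tensorPower_youngSym {d : ℕ} (lam : Fin d → ℕ) (A : Matrix (Fin d) (Fin d) ℂ)
    (x : TensorSpace lam) :
    tensorPower lam A (youngSym lam x) = youngSym lam (tensorPower lam A x) := by
  simp [youngSym, colAntisym, rowSym, tensorPower_permAct]

theorem tensorPower_mem_block {d : ℕ} (lam : Fin d → ℕ) (A : Matrix (Fin d) (Fin d) ℂ) :
    ∀ x ∈ Block lam, tensorPower lam A x ∈ Block lam := by
  rintro _ ⟨x, rfl⟩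
  exact ⟨tensorPower lam A x, (tensorPower_youngSym lam A x).symm⟩

/-- The restriction of `A^{⊗ n}` to the block `H_λ`. -/
def blockRestrict {d : ℕ} (lam : Fin d → ℕ) (A : Matrix (Fin d) (Fin d) ℂ) :
    Block lam →ₗ[ℂ] Block lam :=
  (tensorPower lam A).restrict (tensorPower_mem_block lam A)

/-- The block state `ρ_λ` of `ρ^{⊗ n}`: the component of `ρ^{⊗ n}` on `H_λ`, normalised to have
trace one. -/
def blockState {d : ℕ} (lam : Fin d → ℕ) (ρ : Matrix (Fin d) (Fin d) ℂ) :
    Block lam →L[ℂ] Block lam :=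
  LinearMap.toContinuousLinearMap
    ((LinearMap.trace ℂ (Block lam) (blockRestrict lam ρ))⁻¹ • blockRestrict lam ρ)

/-! ### The basis vectors `|m, λ⟩` -/

/-- The pairs `(j, k)` with `j < k`; they label the oscillators. -/
abbrev Pairs (d : ℕ) : Type := {p : Fin d × Fin d // p.1 < p.2}

/-- Occupation numbers `m = (m_{j,k})_{j<k}`. -/
abbrev Occ (d : ℕ) : Type := Pairs d → ℕ

/-- `|m| = ∑_{j<k} m_{j,k}`. -/
def Occ.total {d : ℕ} (m : Occ d) : ℕ := ∑ p, m p

/-- `∑_{k > j} m_{i,k}`, the number of entries larger than `j` in row `i` (for `j ≥ i`). -/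
def rowTail {d : ℕ} (m : Occ d) (i j : Fin d) : ℕ :=
  ∑ p : Pairs d, if p.1.1 = i ∧ j < p.1.2 then m p else 0

theorem rowTail_last {d : ℕ} (m : Occ d) (i j : Fin d) (hj : ∀ k : Fin d, k ≤ j) :
    rowTail m i j = 0 := by
  refine Finset.sum_eq_zero fun p _ => ?_
  rw [if_neg]
  exact fun h => absurd h.2 (not_lt.mpr (hj _))

/-- The possible entries of a box, see `tableau`. -/
def entryCandidates {d : ℕ} (lam : Fin d → ℕ) (m : Occ d) (b : Box lam) : Finset (Fin d) :=
  Finset.univ.filter (fun j => b.1 ≤ j ∧ (b.2 : ℕ) + rowTail m b.1 j < lam b.1)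

theorem entryCandidates_nonempty {d : ℕ} (lam : Fin d → ℕ) (m : Occ d) (b : Box lam) :
    (entryCandidates lam m b).Nonempty := by
  have hd : 0 < d := lt_of_le_of_lt (Nat.zero_le _) b.1.2
  have hlast : ∀ k : Fin d, k ≤ (⟨d - 1, by omega⟩ : Fin d) := fun k => by
    rw [Fin.le_def]; have := k.2; simp only; omega
  refine ⟨⟨d - 1, by omega⟩, ?_⟩
  simp only [entryCandidates, Finset.mem_filter, Finset.mem_univ, true_and]
  refine ⟨hlast _, ?_⟩
  rw [rowTail_last m _ _ hlast]
  exact b.2.2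

/-- The tableau `t_m` of shape `λ`: row `i` is non-decreasing from left to right, contains `m_{i,k}`
entries `k` for every `k > i`, and its other entries are `i`. -/
def tableau {d : ℕ} (lam : Fin d → ℕ) (m : Occ d) : Box lam → Fin d :=
  fun b => (entryCandidates lam m b).min' (entryCandidates_nonempty lam m b)

/-- The vector `y_λ f_m` of `H_λ`. -/
def youngVec {d : ℕ} (lam : Fin d → ℕ) (m : Occ d) : Block lam :=
  ⟨youngSym lam (EuclideanSpace.single (tableau lam m) 1), LinearMap.mem_range_self _ _⟩

/-- The normalised vector `|m, λ⟩ = y_λ f_m / ‖y_λ f_m‖`. -/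
def youngKet {d : ℕ} (lam : Fin d → ℕ) (m : Occ d) : Block lam :=
  ((‖youngVec lam m‖⁻¹ : ℝ) : ℂ) • youngVec lam m

/-! ### Fock space and thermal states -/

/-- The Fock space of `d (d - 1) / 2` oscillators, in its orthonormal number basis. -/
abbrev Fock (d : ℕ) : Type := lp (fun _ : Occ d => ℂ) 2

/-- The number basis vector `|m⟩`. -/
def ket {d : ℕ} (m : Occ d) : Fock d := lp.single 2 m (1 : ℂ)

/-- The weight of `|k⟩⟨k|` in the thermal state of one oscillator at inverse temperature `β`. -/
def thermalWeight (β : ℝ) (k : ℕ) : ℝ := (1 - Real.exp (-β)) * Real.exp (-(k * β))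

/-- The product `⊗_{j<k} Φ_{j,k}` of the thermal states at inverse temperatures
`β_{j,k} = log (μ_j / μ_k)`. -/
def thermalState {d : ℕ} (μ : Fin d → ℝ) : Fock d →L[ℂ] Fock d :=
  ∑' m : Occ d, ((∏ p : Pairs d, thermalWeight (Real.log (μ p.1.1 / μ p.1.2)) (m p) : ℝ) : ℂ) •
    InnerProductSpace.rankOne ℂ (ket m) (ket m)

/-- The trace norm of a bounded operator, with the value `∞` off the trace class: the supremum of
`∑ i, |⟨e_i, A f_i⟩|` over all pairs of finite orthonormal systems of equal length. -/
def traceNorm {F : Type*} [NormedAddCommGroup F] [InnerProductSpace ℂ F] (A : F →L[ℂ] F) : ℝ≥0∞ :=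
  ⨆ (k : ℕ) (e : Fin k → F) (f : Fin k → F) (_ : Orthonormal ℂ e) (_ : Orthonormal ℂ f),
    ∑ i, ‖inner ℂ (e i) (A (f i))‖ₑ

/-! ### The isometries, the local states and the typical diagrams -/

/-- `V` is an isometry from `H_λ` into the Fock space that maps `|0, λ⟩` to `|0⟩` and satisfies
`⟨m| V = (1 + (c n)^{(9η-2)/12} / δ^{1/3})^{-1/2} ⟨m, λ|` for all `m ≠ 0` with `|m| ≤ n^η`. -/
def IsBlockIsometry {d : ℕ} (n : ℕ) (η δ c : ℝ) (lam : Fin d → ℕ)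
    (V : Block lam →ₗᵢ[ℂ] Fock d) : Prop :=
  V (youngKet lam 0) = ket 0 ∧
    ∀ m : Occ d, m ≠ 0 → (m.total : ℝ) ≤ (n : ℝ) ^ η → ∀ v : Block lam,
      inner ℂ (ket m) (V v) =
        ((1 / Real.sqrt (1 + (c * n) ^ ((9 * η - 2) / 12) / δ ^ (1 / 3 : ℝ)) : ℝ) : ℂ) *
          inner ℂ (youngKet lam m) v

/-- The channel `T_λ(ρ) = V ρ V*`. -/
def channel {d : ℕ} {lam : Fin d → ℕ} (V : Block lam →ₗᵢ[ℂ] Fock d)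
    (ρ : Block lam →L[ℂ] Block lam) : Fock d →L[ℂ] Fock d :=
  haveI : CompleteSpace (Block lam) := FiniteDimensional.complete ℂ (Block lam)
  V.toContinuousLinearMap ∘L ρ ∘L
    ContinuousLinearMap.adjoint (𝕜 := ℂ) (E := Block lam) (F := Fock d) V.toContinuousLinearMap

/-- The eigenvalues `μ_i^{u,n}`: `μ_i + u_i / √n` for the first `d - 1` indices, and
`μ_d - (∑ i, u_i) / √n` for the last one. -/
def localEigenvalue {d : ℕ} (n : ℕ) (μ : Fin d → ℝ) (u : Fin (d - 1) → ℝ) (i : Fin d) : ℝ :=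
  if h : i.1 < d - 1 then μ i + u ⟨i.1, h⟩ / Real.sqrt n else μ i - (∑ j, u j) / Real.sqrt n

/-- The one-system state `ρ_{θ/√n}` with `θ = (0, u)`. -/
def localState {d : ℕ} (n : ℕ) (μ : Fin d → ℝ) (u : Fin (d - 1) → ℝ) : Matrix (Fin d) (Fin d) ℂ :=
  Matrix.diagonal (fun i => ((localEigenvalue n μ u i : ℝ) : ℂ))

/-- The typical Young diagrams `Λ_{n,α}`: at most `d` rows, `n` boxes, and `|λ_i - n μ_i| ≤ n^α`. -/
def typicalDiagrams {d : ℕ} (n : ℕ) (α : ℝ) (μ : Fin d → ℝ) : Set (Fin d → ℕ) :=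
  {lam | Antitone lam ∧ ∑ i, lam i = n ∧ ∀ i, |(lam i : ℝ) - n * μ i| ≤ (n : ℝ) ^ α}

end QLAN

end

noncomputable section

namespace QLAN

/-! ### The symmetrisers -/

/-! Quasi-orthogonality. As `q_λ` is self-adjoint and `q_λ²` is a multiple of `q_λ`, the inner
product of `y_λ f_m` and `y_λ f_l` is, up to factors that cancel on normalising, the sum `gram` of
the signs `⟨f_c, q_λ f_c'⟩ ∈ {0, ±1}` over fillings `c`, `c'` with row contents `m`, `l`. A term is
nonzero only if `c'` has distinct entries in each column and `c` is a column rearrangement of it.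
The main terms have `c = c'` simple, with at most one entry per column deviating from the row
number. In every other pair some column is bad, and in a bad column the two fillings have at least
three deviations together (`three_le_colDev`). One more deviation in a simple filling multiplies the
number of such fillings by at least `(N - M) / M`, where `M` is about `n^η` and `N`, about `nδ/2`,
bounds the differences of row lengths from below (`simpleCount_mul_le`). In the normalised Gram
matrix a deviation in a bad column therefore costs `σ = √(M / (N - M))`, and the bad pairs in one
row of the matrix weigh at most `(1 + d^(2d) σ³)^n - 1`, of order `n^((3η-1)/2) δ^(-3/2)`
(`sum_badPairs_le`). For large `n` this is at most `ε/2` with `ε = n^((9η-2)/12) / δ^(1/3)`, so the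
constant `C̃ = 1` works.

Isometry. By Schur's test, and because `|0,λ⟩` is exactly orthogonal to the other vectors,
`|0,λ⟩⟨0,λ| + (1+ε)⁻¹ ∑ |m,λ⟩⟨m,λ| ≤ 1`. The square root of the defect is sent to unused number
states (`exists_isometry_of_contraction`).

Comparison. The `|m,λ⟩` are eigenvectors of the block state of a diagonal matrix. Garnir relations
show that the `y_λ f_m` span the block (`span_youngVec`), so the normalising trace is at most a full
geometric series, and every eigenvalue is at least the corresponding weight of a product of
geometric distributions. No dimension formula or exact list of basis tableaux is needed: the block
state has trace one, so lower bounds whose sum is nearly one determine it up to a small error.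
Bessel's inequality for `V` applied to the square root of the state makes the remainder positive,
and its trace norm is then its trace (`TraceBound.channel_sub`). The rest is the perturbation of the
geometric weights under `μ_i ↦ μ_i + u_i/√n` and a super-polynomially small tail. -/

theorem permAct_apply {d : ℕ} {lam : Fin d → ℕ} (σ : Equiv.Perm (Box lam)) (x : TensorSpace lam)
    (a : Box lam → Fin d) : permAct lam σ x a = x (a ∘ σ) := rfl

theorem permAct_mul {d : ℕ} {lam : Fin d → ℕ} (σ τ : Equiv.Perm (Box lam)) (x : TensorSpace lam) :
    permAct lam (σ * τ) x = permAct lam σ (permAct lam τ x) := rfl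

theorem permAct_single {d : ℕ} {lam : Fin d → ℕ} (σ : Equiv.Perm (Box lam)) (a : Box lam → Fin d) :
    permAct lam σ (EuclideanSpace.single a 1) = EuclideanSpace.single (a ∘ σ.symm) 1 := by
  ext c
  rw [permAct_apply, PiLp.single_apply, PiLp.single_apply]
  congr 1
  simp only [eq_iff_iff]
  constructor
  · rintro rfl; ext b; simp
  · rintro rfl; ext b; simp

theorem mem_rowGroup {d : ℕ} {lam : Fin d → ℕ} {σ : Equiv.Perm (Box lam)} :
    σ ∈ rowGroup lam ↔ ∀ b, (σ b).1 = b.1 := by simp [rowGroup]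

theorem mem_colGroup {d : ℕ} {lam : Fin d → ℕ} {τ : Equiv.Perm (Box lam)} :
    τ ∈ colGroup lam ↔ ∀ b, ((τ b).2 : ℕ) = b.2 := by simp [colGroup]

theorem rowGroup_mul {d : ℕ} {lam : Fin d → ℕ} {σ τ : Equiv.Perm (Box lam)}
    (hσ : σ ∈ rowGroup lam) (hτ : τ ∈ rowGroup lam) : σ * τ ∈ rowGroup lam := by
  rw [mem_rowGroup] at *
  intro b; simp [hσ, hτ]

theorem rowGroup_inv {d : ℕ} {lam : Fin d → ℕ} {σ : Equiv.Perm (Box lam)}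
    (hσ : σ ∈ rowGroup lam) : σ⁻¹ ∈ rowGroup lam := by
  rw [mem_rowGroup] at *
  intro b; have := hσ (σ⁻¹ b); simpa using this.symm

theorem colGroup_mul {d : ℕ} {lam : Fin d → ℕ} {σ τ : Equiv.Perm (Box lam)}
    (hσ : σ ∈ colGroup lam) (hτ : τ ∈ colGroup lam) : σ * τ ∈ colGroup lam := by
  rw [mem_colGroup] at *
  intro b; simp [hσ, hτ]

theorem colGroup_inv {d : ℕ} {lam : Fin d → ℕ} {σ : Equiv.Perm (Box lam)}
    (hσ : σ ∈ colGroup lam) : σ⁻¹ ∈ colGroup lam := by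
  rw [mem_colGroup] at *
  intro b; have := hσ (σ.symm b); rw [Equiv.apply_symm_apply] at this; exact this.symm

theorem colGroup_one {d : ℕ} {lam : Fin d → ℕ} : (1 : Equiv.Perm (Box lam)) ∈ colGroup lam := by
  simp [mem_colGroup]

theorem rowGroup_one {d : ℕ} {lam : Fin d → ℕ} : (1 : Equiv.Perm (Box lam)) ∈ rowGroup lam := by
  simp [mem_rowGroup]

theorem swap_mem_colGroup {d : ℕ} {lam : Fin d → ℕ} {b b' : Box lam} (h : (b.2 : ℕ) = b'.2) :
    Equiv.swap b b' ∈ colGroup lam := by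
  rw [mem_colGroup]
  intro x
  by_cases h1 : x = b
  · subst h1; rw [Equiv.swap_apply_left, h]
  by_cases h2 : x = b'
  · subst h2; rw [Equiv.swap_apply_right, h]
  rw [Equiv.swap_apply_of_ne_of_ne h1 h2]

theorem colAntisym_apply {d : ℕ} {lam : Fin d → ℕ} (x : TensorSpace lam) :
    colAntisym lam x = ∑ τ ∈ colGroup lam, ((Equiv.Perm.sign τ : ℤ) : ℂ) • permAct lam τ x := by
  simp [colAntisym]

theorem rowSym_apply {d : ℕ} {lam : Fin d → ℕ} (x : TensorSpace lam) :
    rowSym lam x = ∑ σ ∈ rowGroup lam, permAct lam σ x := by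
  simp [rowSym]

theorem sign_mul_self {α : Type*} [Fintype α] [DecidableEq α] (τ : Equiv.Perm α) :
    ((Equiv.Perm.sign τ : ℤ) : ℂ) * ((Equiv.Perm.sign τ : ℤ) : ℂ) = 1 := by
  rw [← Int.cast_mul, ← Units.val_mul, Int.units_mul_self]; simp

theorem colAntisym_permAct {d : ℕ} {lam : Fin d → ℕ} {τ : Equiv.Perm (Box lam)}
    (hτ : τ ∈ colGroup lam) (x : TensorSpace lam) :
    colAntisym lam (permAct lam τ x) = ((Equiv.Perm.sign τ : ℤ) : ℂ) • colAntisym lam x := by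
  rw [colAntisym_apply, colAntisym_apply, Finset.smul_sum]
  refine Finset.sum_bij (fun ρ _ => ρ * τ) (fun ρ hρ => colGroup_mul hρ hτ)
    (fun ρ _ ρ' _ h => mul_right_cancel h)
    (fun ρ hρ => ⟨ρ * τ⁻¹, colGroup_mul hρ (colGroup_inv hτ), by simp⟩) (fun ρ _ => ?_)
  rw [← permAct_mul, smul_smul, Equiv.Perm.sign_mul, Units.val_mul, Int.cast_mul,
    mul_comm (((Equiv.Perm.sign ρ : ℤ)) : ℂ), ← mul_assoc, sign_mul_self, one_mul]

theorem rowSym_permAct {d : ℕ} {lam : Fin d → ℕ} {σ : Equiv.Perm (Box lam)}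
    (hσ : σ ∈ rowGroup lam) (x : TensorSpace lam) :
    rowSym lam (permAct lam σ x) = rowSym lam x := by
  rw [rowSym_apply, rowSym_apply]
  exact Finset.sum_bij (fun ρ _ => ρ * σ) (fun ρ hρ => rowGroup_mul hρ hσ)
    (fun ρ _ ρ' _ h => mul_right_cancel h)
    (fun ρ hρ => ⟨ρ * σ⁻¹, rowGroup_mul hρ (rowGroup_inv hσ), by simp⟩) (fun ρ _ => rfl)

theorem colAntisym_colAntisym {d : ℕ} {lam : Fin d → ℕ} (x : TensorSpace lam) :
    colAntisym lam (colAntisym lam x) = ((colGroup lam).card : ℂ) • colAntisym lam x := by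
  conv_lhs => rw [colAntisym_apply x, map_sum]
  rw [Finset.sum_congr rfl (g := fun _ => colAntisym lam x)]
  · rw [Finset.sum_const, Nat.cast_smul_eq_nsmul]
  · intro τ hτ
    rw [map_smul, colAntisym_permAct hτ, smul_smul, sign_mul_self, one_smul]

theorem inner_permAct_left {d : ℕ} {lam : Fin d → ℕ} (σ : Equiv.Perm (Box lam))
    (x y : TensorSpace lam) :
    inner ℂ (permAct lam σ x) y = inner ℂ x (permAct lam σ⁻¹ y) := by
  rw [PiLp.inner_apply, PiLp.inner_apply]
  refine Fintype.sum_equiv (σ.symm.arrowCongr (Equiv.refl (Fin d))) _ _ fun b => ?_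
  have h1 : (σ.symm.arrowCongr (Equiv.refl (Fin d))) b = b ∘ σ := by
    ext k; simp [Equiv.arrowCongr]
  rw [h1, permAct_apply, permAct_apply]
  have h2 : (b ∘ σ) ∘ ⇑σ⁻¹ = b := by ext k; simp
  rw [h2]

theorem inner_colAntisym_left {d : ℕ} {lam : Fin d → ℕ} (x y : TensorSpace lam) :
    inner ℂ (colAntisym lam x) y = inner ℂ x (colAntisym lam y) := by
  rw [colAntisym_apply, colAntisym_apply, sum_inner, inner_sum]
  refine Finset.sum_bij (fun ρ _ => ρ⁻¹) (fun ρ hρ => colGroup_inv hρ)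
    (fun ρ _ ρ' _ h => inv_injective h) (fun ρ hρ => ⟨ρ⁻¹, colGroup_inv hρ, by simp⟩) (fun ρ _ => ?_)
  rw [inner_smul_left, inner_smul_right, inner_permAct_left, Equiv.Perm.sign_inv]
  simp

/-- Self-adjointness and `q² = |C| q` leave a single antisymmetriser between two row-symmetrised
vectors. This turns the Gram matrix into a signed count of fillings. -/
theorem inner_youngSym {d : ℕ} {lam : Fin d → ℕ} (x y : TensorSpace lam) :
    inner ℂ (youngSym lam x) (youngSym lam y) =
      ((colGroup lam).card : ℂ) * inner ℂ (rowSym lam x) (colAntisym lam (rowSym lam y)) := by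
  rw [youngSym, LinearMap.comp_apply, LinearMap.comp_apply, inner_colAntisym_left,
    colAntisym_colAntisym, inner_smul_right]

/-! ### Row contents and the Gram matrix -/

/-- The number of entries `v` in row `i` of a filling. -/
def rowCount {d : ℕ} {lam : Fin d → ℕ} (a : Box lam → Fin d) (i v : Fin d) : ℕ :=
  (Finset.univ.filter fun b => b.1 = i ∧ a b = v).card

/-- Fillings with the same rows up to rearrangement. -/
def SameRows {d : ℕ} {lam : Fin d → ℕ} (a c : Box lam → Fin d) : Prop :=
  ∀ i v, rowCount a i v = rowCount c i v

theorem rowCount_comp {d : ℕ} {lam : Fin d → ℕ} (a : Box lam → Fin d) {σ : Equiv.Perm (Box lam)}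
    (hσ : σ ∈ rowGroup lam) (i v : Fin d) : rowCount (a ∘ σ) i v = rowCount a i v := by
  rw [mem_rowGroup] at hσ
  refine Finset.card_bij (fun b _ => σ b) ?_ (fun _ _ _ _ h => σ.injective h) ?_
  · intro b; simp [hσ]
  · intro b hb
    refine ⟨σ.symm b, ?_, by simp⟩
    have := hσ (σ.symm b)
    simp only [Equiv.apply_symm_apply] at this
    simpa [← this] using hb

theorem SameRows.exists_perm {d : ℕ} {lam : Fin d → ℕ} {a c : Box lam → Fin d}
    (h : SameRows a c) : ∃ σ ∈ rowGroup lam, c ∘ σ = a := by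
  -- The fibres of `b ↦ (row of b, entry of b)` for the two fillings have equal sizes; bijections
  -- between them glue to a permutation that preserves rows.
  have key : ∀ p : Fin d × Fin d,
      Nonempty ({b // (fun b : Box lam => (b.1, a b)) b = p} ≃
        {b // (fun b : Box lam => (b.1, c b)) b = p}) := by
    intro p
    rw [← Fintype.card_eq, Fintype.card_subtype, Fintype.card_subtype]
    have := h p.1 p.2
    simp only [rowCount] at this
    convert this using 4 <;> simp [Prod.ext_iff]
  have e := fun p => (key p).some
  have h2 := fun b => Equiv.ofFiberEquiv_map (fun p => (e p)) b
  refine ⟨Equiv.ofFiberEquiv fun p => e p, ?_, ?_⟩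
  · rw [mem_rowGroup]
    intro b
    exact congrArg Prod.fst (h2 b)
  · ext b
    exact congrArg Fin.val (congrArg Prod.snd (h2 b))

theorem sameRows_iff {d : ℕ} {lam : Fin d → ℕ} {a c : Box lam → Fin d} :
    SameRows a c ↔ ∃ σ ∈ rowGroup lam, c ∘ σ = a := by
  refine ⟨SameRows.exists_perm, ?_⟩
  rintro ⟨σ, hσ, rfl⟩ i v
  exact rowCount_comp c hσ i v

/-- The number of row permutations fixing a filling. -/
def rowStab {d : ℕ} {lam : Fin d → ℕ} (a : Box lam → Fin d) : ℕ :=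
  ((rowGroup lam).filter fun σ : Equiv.Perm (Box lam) => a ∘ σ = a).card

theorem rowStab_pos {d : ℕ} {lam : Fin d → ℕ} (a : Box lam → Fin d) : 0 < rowStab a :=
  Finset.card_pos.mpr ⟨1, by simp [rowGroup_one]⟩

-- Orbit and stabiliser: each filling in the orbit is reached from exactly one coset of the
-- stabiliser.
open Classical in
theorem rowSym_single {d : ℕ} {lam : Fin d → ℕ} (a : Box lam → Fin d) :
    rowSym lam (EuclideanSpace.single a 1) =
      (rowStab a : ℂ) • ∑ c with SameRows a c, EuclideanSpace.single c 1 := by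
  ext c
  rw [rowSym_apply]
  have e1 : (∑ σ ∈ rowGroup lam, permAct lam σ (EuclideanSpace.single a 1)) c =
      (((rowGroup lam).filter fun σ : Equiv.Perm (Box lam) => c ∘ σ = a).card : ℂ) := by
    rw [WithLp.ofLp_sum, Finset.sum_apply, Finset.card_filter, Nat.cast_sum]
    refine Finset.sum_congr rfl fun σ _ => ?_
    rw [permAct_apply, PiLp.single_apply]
    simp
  have e2 : ((rowStab a : ℂ) • ∑ c with SameRows a c, EuclideanSpace.single c (1 : ℂ)) c =
      (rowStab a : ℂ) * if SameRows a c then 1 else 0 := by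
    rw [PiLp.smul_apply, smul_eq_mul, WithLp.ofLp_sum, Finset.sum_apply]
    congr 1
    simp [PiLp.single_apply]
  rw [e1, e2]
  split_ifs with h
  · rw [mul_one]
    obtain ⟨σ, hσ, hc⟩ := h.exists_perm
    congr 1
    refine Finset.card_bij (fun ρ _ => σ⁻¹ * ρ) ?_ ?_ ?_
    · intro ρ hρ
      rw [Finset.mem_filter] at hρ ⊢
      refine ⟨rowGroup_mul (rowGroup_inv hσ) hρ.1, ?_⟩
      conv_lhs => rw [← hc]
      rw [← hρ.2]
      ext b; simp
    · intro ρ _ ρ' _ h'; exact mul_left_cancel h'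
    · intro ρ hρ
      rw [Finset.mem_filter] at hρ
      refine ⟨σ * ρ, ?_, by simp⟩
      rw [Finset.mem_filter]
      refine ⟨rowGroup_mul hσ hρ.1, ?_⟩
      conv_rhs => rw [← hρ.2, ← hc]
      rfl
  · rw [mul_zero, Nat.cast_eq_zero, Finset.card_eq_zero, Finset.filter_eq_empty_iff]
    intro σ hσ hc
    exact h (sameRows_iff.mpr ⟨σ, hσ, hc⟩)

/-- Fillings with distinct entries in every column. -/
def ColInj {d : ℕ} {lam : Fin d → ℕ} (c : Box lam → Fin d) : Prop :=
  ∀ b b' : Box lam, (b.2 : ℕ) = b'.2 → c b = c b' → b = b'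

/-- The matrix element `⟨f_c, q f_c'⟩` of the column antisymmetriser. -/
def colEntry {d : ℕ} {lam : Fin d → ℕ} (c c' : Box lam → Fin d) : ℝ :=
  ∑ τ ∈ colGroup lam, if c ∘ τ = c' then ((Equiv.Perm.sign τ : ℤ) : ℝ) else 0

theorem inner_single_colAntisym {d : ℕ} {lam : Fin d → ℕ} (c c' : Box lam → Fin d) :
    inner ℂ (EuclideanSpace.single c (1 : ℂ)) (colAntisym lam (EuclideanSpace.single c' 1)) =
      (colEntry c c' : ℂ) := by
  rw [EuclideanSpace.inner_single_left, colAntisym_apply, WithLp.ofLp_sum, Finset.sum_apply, colEntry]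
  simp only [map_one, one_mul, Complex.ofReal_sum]
  refine Finset.sum_congr rfl fun τ _ => ?_
  rw [PiLp.smul_apply, permAct_apply, PiLp.single_apply]
  split_ifs <;> simp

/-- A repeated entry in a column gives a column transposition that fixes `f_c'`, so `q f_c'` equals
its own negative. -/
theorem colEntry_eq_zero {d : ℕ} {lam : Fin d → ℕ} (c : Box lam → Fin d) {c' : Box lam → Fin d}
    (h : ¬ ColInj c') : colEntry c c' = 0 := by
  simp only [ColInj, not_forall] at h
  obtain ⟨b, b', h1, h2, h3⟩ := h
  have e : permAct lam (Equiv.swap b b') (EuclideanSpace.single c' 1) =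
      EuclideanSpace.single c' 1 := by
    rw [permAct_single]
    congr 1
    ext x
    simp only [Equiv.symm_swap, Function.comp_apply]
    by_cases hx : x = b
    · subst hx; simp [h2]
    by_cases hx' : x = b'
    · subst hx'; simp [h2]
    rw [Equiv.swap_apply_of_ne_of_ne hx hx']
  have e2 := colAntisym_permAct (swap_mem_colGroup h1) (EuclideanSpace.single c' (1 : ℂ))
  rw [e, Equiv.Perm.sign_swap h3] at e2
  have e3 : colAntisym lam (EuclideanSpace.single c' (1 : ℂ)) = 0 := by
    have e4 : colAntisym lam (EuclideanSpace.single c' (1 : ℂ)) =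
        -colAntisym lam (EuclideanSpace.single c' (1 : ℂ)) := by simpa using e2
    rw [eq_neg_iff_add_eq_zero, ← two_smul ℂ, smul_eq_zero] at e4
    simpa using e4
  have := inner_single_colAntisym c c'
  rw [e3, inner_zero_right] at this
  exact_mod_cast this.symm

/-- Two column permutations carrying `c` to `c'` differ by one that fixes the column-injective `c'`,
hence by the identity; only one term of the sum survives. -/
theorem colEntry_of_colInj {d : ℕ} {lam : Fin d → ℕ} {c c' : Box lam → Fin d} (hc : ColInj c')
    {τ : Equiv.Perm (Box lam)} (hτ : τ ∈ colGroup lam) (h : c ∘ τ = c') :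
    colEntry c c' = ((Equiv.Perm.sign τ : ℤ) : ℝ) := by
  rw [colEntry, Finset.sum_eq_single τ, if_pos h]
  · intro τ' hτ' hne
    rw [if_neg]
    intro h'
    apply hne
    have hcol := mem_colGroup.mp (colGroup_mul (colGroup_inv hτ) hτ')
    have : τ⁻¹ * τ' = 1 := by
      ext1 b
      refine hc _ _ (hcol b) ?_
      rw [Equiv.Perm.one_apply, ← h]
      have := congrFun h' b
      rw [← h] at this
      simpa using this
    rw [inv_mul_eq_one] at this
    exact this.symm
  · intro h'; exact absurd hτ h'

theorem abs_colEntry_le {d : ℕ} {lam : Fin d → ℕ} (c c' : Box lam → Fin d) :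
    |colEntry c c'| ≤ 1 := by
  by_cases hc : ColInj c'
  · by_cases h : ∃ τ ∈ colGroup lam, c ∘ τ = c'
    · obtain ⟨τ, hτ, h⟩ := h
      rw [colEntry_of_colInj hc hτ h]
      rcases Int.units_eq_one_or (Equiv.Perm.sign τ) with h | h <;> simp [h]
    · rw [colEntry, Finset.sum_eq_zero]
      · simp
      · intro τ hτ
        rw [if_neg]
        exact fun h' => h ⟨τ, hτ, h'⟩
  · rw [colEntry_eq_zero c hc]; simp

theorem colEntry_self {d : ℕ} {lam : Fin d → ℕ} {c : Box lam → Fin d} (hc : ColInj c) :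
    colEntry c c = 1 := by
  rw [colEntry_of_colInj hc colGroup_one (by rfl)]; simp

/-- Pairs of fillings that are connected by the column antisymmetriser. -/
def Compatible {d : ℕ} {lam : Fin d → ℕ} (c c' : Box lam → Fin d) : Prop :=
  ColInj c' ∧ ∃ τ ∈ colGroup lam, c ∘ τ = c'

theorem compatible_of_colEntry_ne_zero {d : ℕ} {lam : Fin d → ℕ} {c c' : Box lam → Fin d}
    (h : colEntry c c' ≠ 0) : Compatible c c' := by
  refine ⟨by_contra fun h' => h (colEntry_eq_zero c h'), ?_⟩
  by_contra h'
  push Not at h'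
  exact h (Finset.sum_eq_zero fun τ hτ => if_neg (h' τ hτ))

open Classical in
/-- The reduced Gram matrix of the vectors `y f_a`. -/
def reducedGram {d : ℕ} {lam : Fin d → ℕ} (a a' : Box lam → Fin d) : ℝ :=
  ∑ c with SameRows a c, ∑ c' with SameRows a' c', colEntry c c'

/-- The prefactor is a product of a function of `a` and one of `a'`, so it disappears from
normalised overlaps and `reducedGram` carries all the information. -/
theorem inner_youngSym_single {d : ℕ} {lam : Fin d → ℕ} (a a' : Box lam → Fin d) :
    inner ℂ (youngSym lam (EuclideanSpace.single a 1)) (youngSym lam (EuclideanSpace.single a' 1)) =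
      (((colGroup lam).card * (rowStab a * rowStab a') * reducedGram a a' : ℝ) : ℂ) := by
  classical
  rw [inner_youngSym, rowSym_single, rowSym_single, map_smul, inner_smul_left, inner_smul_right,
    map_sum, sum_inner]
  simp_rw [inner_sum, inner_single_colAntisym]
  simp only [reducedGram]
  push_cast
  simp only [map_natCast]
  ring_nf

/-! ### Straightening -/

theorem youngSym_permAct {d : ℕ} {lam : Fin d → ℕ} {σ : Equiv.Perm (Box lam)}
    (hσ : σ ∈ rowGroup lam) (x : TensorSpace lam) :
    youngSym lam (permAct lam σ x) = youngSym lam x := by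
  rw [youngSym, LinearMap.comp_apply, rowSym_permAct hσ, LinearMap.comp_apply]

theorem SameRows.youngSym_single {d : ℕ} {lam : Fin d → ℕ} {a c : Box lam → Fin d}
    (h : SameRows a c) :
    youngSym lam (EuclideanSpace.single a 1) = youngSym lam (EuclideanSpace.single c 1) := by
  obtain ⟨σ, hσ, rfl⟩ := h.exists_perm
  rw [← youngSym_permAct hσ (EuclideanSpace.single (c ∘ σ) 1), permAct_single]
  congr 2
  ext b; simp

/-- Permutations that only move the boxes of row `i` and the box `b`. -/
def garnirGroup {d : ℕ} {lam : Fin d → ℕ} (i : Fin d) (b : Box lam) :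
    Finset (Equiv.Perm (Box lam)) :=
  Finset.univ.filter fun π => ∀ x, ¬ (x.1 = i ∨ x = b) → π x = x

theorem mem_garnirGroup {d : ℕ} {lam : Fin d → ℕ} {i : Fin d} {b : Box lam}
    {π : Equiv.Perm (Box lam)} :
    π ∈ garnirGroup i b ↔ ∀ x, ¬ (x.1 = i ∨ x = b) → π x = x := by simp [garnirGroup]

theorem garnirGroup_apply {d : ℕ} {lam : Fin d → ℕ} {i : Fin d} {b : Box lam}
    {π : Equiv.Perm (Box lam)} (hπ : π ∈ garnirGroup i b) {x : Box lam} (hx : x.1 = i ∨ x = b) :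
    (π x).1 = i ∨ π x = b := by
  by_contra h
  have h1 := mem_garnirGroup.mp hπ _ h
  rw [π.injective h1] at h
  exact h hx

/-- Row `i` lies above `b` and is at least as long as the row of `b`, so it has a box `b₀` in the
column of `b`. The transposition of `b` and `b₀` is both a Garnir and a column permutation: it fixes
the Garnir sum, while `q` changes sign under it. -/
theorem colAntisym_garnir {d : ℕ} {lam : Fin d → ℕ} (hlam : Antitone lam) {i : Fin d} {b : Box lam}
    (hi : i < b.1) (x : TensorSpace lam) :
    colAntisym lam (∑ π ∈ garnirGroup i b, permAct lam π x) = 0 := by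
  have hlt : (b.2 : ℕ) < lam i := lt_of_lt_of_le b.2.2 (hlam hi.le)
  set b₀ : Box lam := ⟨i, ⟨b.2, hlt⟩⟩ with hb₀
  have hne : b ≠ b₀ := by
    intro h; rw [h] at hi; exact lt_irrefl _ hi
  have hcol : Equiv.swap b b₀ ∈ colGroup lam := swap_mem_colGroup rfl
  have e : permAct lam (Equiv.swap b b₀) (∑ π ∈ garnirGroup i b, permAct lam π x) =
      ∑ π ∈ garnirGroup i b, permAct lam π x := by
    rw [map_sum]
    have hs : ∀ y : Box lam, ¬ (y.1 = i ∨ y = b) → Equiv.swap b b₀ y = y := by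
      intro y hy
      push Not at hy
      refine Equiv.swap_apply_of_ne_of_ne hy.2 ?_
      rintro rfl; exact hy.1 rfl
    refine Finset.sum_bij (fun π _ => Equiv.swap b b₀ * π) ?_
      (fun _ _ _ _ h => mul_left_cancel h) ?_ (fun π _ => rfl)
    · intro π hπ
      rw [mem_garnirGroup] at hπ ⊢
      intro y hy
      rw [Equiv.Perm.mul_apply, hπ y hy, hs y hy]
    · intro π hπ
      refine ⟨Equiv.swap b b₀ * π, ?_, by simp⟩
      rw [mem_garnirGroup] at hπ ⊢
      intro y hy
      rw [Equiv.Perm.mul_apply, hπ y hy, hs y hy]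
  have e2 := colAntisym_permAct hcol (∑ π ∈ garnirGroup i b, permAct lam π x)
  rw [e, Equiv.Perm.sign_swap hne] at e2
  have e4 : colAntisym lam (∑ π ∈ garnirGroup i b, permAct lam π x) =
      -colAntisym lam (∑ π ∈ garnirGroup i b, permAct lam π x) := by simpa using e2
  rw [eq_neg_iff_add_eq_zero, ← two_smul ℂ, smul_eq_zero] at e4
  simpa using e4

/-- Moving a row permutation `σ` past the Garnir sum conjugates the Garnir group of `b` into that of
`σ b`, which is still in a row below `i`. Each term of the row symmetriser thus vanishes after
antisymmetrising. -/
theorem youngSym_garnir {d : ℕ} {lam : Fin d → ℕ} (hlam : Antitone lam) {i : Fin d} {b : Box lam}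
    (hi : i < b.1) (x : TensorSpace lam) :
    ∑ π ∈ garnirGroup i b, youngSym lam (permAct lam π x) = 0 := by
  rw [← map_sum, youngSym, LinearMap.comp_apply, rowSym_apply, map_sum]
  refine Finset.sum_eq_zero fun σ hσ => ?_
  have hσ' := mem_rowGroup.mp hσ
  rw [← colAntisym_garnir hlam (i := i) (b := σ b) (by rwa [hσ']) (permAct lam σ x), map_sum]
  congr 1
  refine Finset.sum_bij (fun π _ => σ * π * σ⁻¹) ?_ ?_ ?_ ?_
  · intro π hπ
    rw [mem_garnirGroup] at hπ ⊢
    intro y hy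
    have h1 : ¬ ((σ.symm y).1 = i ∨ σ.symm y = b) := by
      rintro (h | h)
      · apply hy; left
        rw [← h, ← hσ' (σ.symm y), Equiv.apply_symm_apply]
      · apply hy; right
        rw [← h, Equiv.apply_symm_apply]
    have := hπ _ h1
    change σ (π (σ.symm y)) = y
    rw [this, Equiv.apply_symm_apply]
  · intro π _ π' _ h
    exact mul_left_cancel (mul_right_cancel h)
  · intro π hπ
    refine ⟨σ⁻¹ * π * σ, ?_, by group⟩
    rw [mem_garnirGroup] at hπ ⊢
    intro y hy
    have h1 : ¬ ((σ y).1 = i ∨ σ y = σ b) := by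
      rintro (h | h)
      · apply hy; left; rw [← h, hσ']
      · apply hy; right; exact σ.injective h
    change σ.symm (π (σ y)) = y
    rw [hπ _ h1, Equiv.symm_apply_apply]
  · intro π _
    rw [← permAct_mul, ← permAct_mul, inv_mul_cancel_right]

/-- Fillings whose entries are at least the row number. -/
def Upper {d : ℕ} {lam : Fin d → ℕ} (a : Box lam → Fin d) : Prop := ∀ b, b.1 ≤ a b

/-- The box `x` that `π` sends to `b` has the entry `i`, as does `b` in `a`. Exchanging `b` and `x`
before `π` does not change `a` and makes the permutation row-preserving. -/
theorem sameRows_of_garnir {d : ℕ} {lam : Fin d → ℕ} {i : Fin d} {b : Box lam}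
    {π : Equiv.Perm (Box lam)} (hπ : π ∈ garnirGroup i b) (hi : i < b.1) {a c : Box lam → Fin d}
    (hab : a b = i) (hc : c ∘ π = a) (hcb : c b = i) : SameRows a c := by
  set x := π.symm b with hx
  have hpx : π x = b := by simp [hx]
  have hxA : x.1 = i ∨ x = b := by
    by_contra h
    have := mem_garnirGroup.mp hπ x h
    rw [hpx] at this
    exact h (Or.inr this.symm)
  have hax : a x = i := by rw [← hc, Function.comp_apply, hpx, hcb]
  refine sameRows_iff.mpr ⟨π * Equiv.swap b x, ?_, ?_⟩
  · rw [mem_rowGroup]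
    intro y
    rw [Equiv.Perm.mul_apply]
    by_cases hyb : y = b
    · subst hyb; rw [Equiv.swap_apply_left, hpx]
    by_cases hyx : y = x
    · subst hyx
      rw [Equiv.swap_apply_right]
      rcases hxA with h | h
      · rcases garnirGroup_apply hπ (Or.inr rfl : b.1 = i ∨ b = b) with h' | h'
        · rw [h, h']
        · exact absurd (π.injective (hpx.trans h'.symm)) hyb
      · exact absurd h hyb
    rw [Equiv.swap_apply_of_ne_of_ne hyb hyx]
    by_cases hyi : y.1 = i
    · rcases garnirGroup_apply hπ (Or.inl hyi) with h' | h'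
      · rw [h', hyi]
      · exact absurd (π.injective (h'.trans hpx.symm)) hyx
    · rw [mem_garnirGroup.mp hπ y (by tauto)]
  · ext y
    change (c (π (Equiv.swap b x y)) : ℕ) = a y
    rw [← Function.comp_apply (f := c), hc]
    by_cases hyb : y = b
    · subst hyb; rw [Equiv.swap_apply_left, hax, hab]
    by_cases hyx : y = x
    · subst hyx; rw [Equiv.swap_apply_right, hax, hab]
    rw [Equiv.swap_apply_of_ne_of_ne hyb hyx]

/-- The entries `i` inside row `i` and at `b` must all land in row `i`, because `b` no longer holds
`i`. Hence `π` injects the boxes of `a` with entry equal to row number, together with `b`, into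
those of `c`. -/
theorem card_diag_lt_of_garnir {d : ℕ} {lam : Fin d → ℕ} {i : Fin d} {b : Box lam}
    {π : Equiv.Perm (Box lam)} (hπ : π ∈ garnirGroup i b) (hi : i < b.1) {a c : Box lam → Fin d}
    (hab : a b = i) (hc : c ∘ π = a) (hcb : c b ≠ i) :
    (Finset.univ.filter fun x => a x = x.1).card < (Finset.univ.filter fun x => c x = x.1).card := by
  have hb : b ∉ Finset.univ.filter fun x => a x = x.1 := by
    simp [hab, hi.ne]
  rw [← Nat.add_one_le_iff, ← Finset.card_insert_of_notMem hb]
  refine Finset.card_le_card_of_injOn π ?_ π.injective.injOn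
  have key : ∀ x, (x.1 = i ∨ x = b) → a x = i → c (π x) = (π x).1 := by
    intro x hx hax
    have h1 : c (π x) = i := by rw [← hax, ← hc]; rfl
    rcases garnirGroup_apply hπ hx with h | h
    · rw [h1, h]
    · rw [h] at h1; exact absurd h1 hcb
  intro x hx
  simp only [Finset.coe_insert, Finset.coe_filter, Finset.mem_univ, true_and, Set.mem_insert_iff,
    Set.mem_ofPred_eq] at hx ⊢
  rcases hx with rfl | hx
  · exact key _ (Or.inr rfl) hab
  · by_cases hxi : x.1 = i
    · exact key x (Or.inl hxi) (hx.trans hxi)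
    · have hxb : x ≠ b := by
        rintro rfl; rw [hab] at hx; exact hxi hx.symm
      have h1 := mem_garnirGroup.mp hπ x (by tauto)
      have h2 := congrFun hc x
      rw [Function.comp_apply, h1] at h2
      rw [h1, h2, hx]

/-- Straightening, by induction on a bound `k` for the number of boxes whose entry is not the row
number. At a box `b` with `a b` smaller than its row, the Garnir relation for row `a b` expresses a
positive multiple of `y f_a` through fillings with fewer such boxes. -/
theorem youngSym_single_mem_span {d : ℕ} {lam : Fin d → ℕ} (hlam : Antitone lam) :
    ∀ (k : ℕ) (a : Box lam → Fin d),
      Fintype.card (Box lam) ≤ k + (Finset.univ.filter fun x => a x = x.1).card →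
      youngSym lam (EuclideanSpace.single a 1) ∈ Submodule.span ℂ
        (Set.range fun c : {c : Box lam → Fin d // Upper c} =>
          youngSym lam (EuclideanSpace.single c.1 1)) := by
  intro k
  induction k with
  | zero =>
    intro a ha
    refine Submodule.subset_span ⟨⟨a, fun b => ?_⟩, rfl⟩
    have h := Finset.eq_univ_of_card _
      (le_antisymm (Finset.card_le_univ (Finset.univ.filter fun x => a x = x.1)) (by simpa using ha))
    have := Finset.mem_univ b
    rw [← h] at this
    simp only [Finset.mem_filter, Finset.mem_univ, true_and] at this
    exact this.ge
  | succ k ih =>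
    intro a ha
    by_cases hU : Upper a
    · exact Submodule.subset_span ⟨⟨a, hU⟩, rfl⟩
    simp only [Upper, not_forall, not_le] at hU
    obtain ⟨b, hb⟩ := hU
    have h0 := youngSym_garnir hlam (i := a b) (b := b) hb (EuclideanSpace.single a 1)
    rw [← Finset.sum_filter_add_sum_filter_not _
      (fun π : Equiv.Perm (Box lam) => a (π.symm b) = a b)] at h0
    have hcomp : ∀ π : Equiv.Perm (Box lam), (a ∘ π.symm) ∘ π = a := by
      intro π; ext x; simp
    have h1 : ∑ π ∈ garnirGroup (a b) b with a (π.symm b) = a b,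
        youngSym lam (permAct lam π (EuclideanSpace.single a 1)) =
        (((garnirGroup (a b) b).filter fun π : Equiv.Perm (Box lam) =>
          a (π.symm b) = a b).card : ℂ) • youngSym lam (EuclideanSpace.single a 1) := by
      rw [Nat.cast_smul_eq_nsmul, ← Finset.sum_const]
      refine Finset.sum_congr rfl fun π hπ => ?_
      rw [Finset.mem_filter] at hπ
      rw [permAct_single]
      exact (sameRows_of_garnir hπ.1 hb rfl (hcomp π) hπ.2).youngSym_single.symm
    -- The identity is one of the Garnir permutations that leave the entry at `b` unchanged, so the
    -- coefficient of `y f_a` is nonzero.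
    have hpos : (((garnirGroup (a b) b).filter fun π : Equiv.Perm (Box lam) =>
          a (π.symm b) = a b).card : ℂ) ≠ 0 := by
      rw [Nat.cast_ne_zero, ← Nat.pos_iff_ne_zero, Finset.card_pos]
      refine ⟨1, ?_⟩
      rw [Finset.mem_filter]
      exact ⟨mem_garnirGroup.mpr fun x _ => rfl, rfl⟩
    rw [h1, add_eq_zero_iff_eq_neg] at h0
    rw [← Submodule.smul_mem_iff _ hpos, h0]
    refine Submodule.neg_mem _ (Submodule.sum_mem _ fun π hπ => ?_)
    rw [Finset.mem_filter] at hπ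
    rw [permAct_single]
    refine ih _ ?_
    have := card_diag_lt_of_garnir hπ.1 hb rfl (hcomp π) hπ.2
    omega

theorem span_upper {d : ℕ} {lam : Fin d → ℕ} (hlam : Antitone lam) (x : TensorSpace lam) :
    youngSym lam x ∈ Submodule.span ℂ
        (Set.range fun c : {c : Box lam → Fin d // Upper c} =>
          youngSym lam (EuclideanSpace.single c.1 1)) := by
  have hx : x = ∑ a, x a • EuclideanSpace.single a (1 : ℂ) := by
    ext c
    rw [WithLp.ofLp_sum, Finset.sum_apply]
    simp [PiLp.single_apply]
  rw [hx, map_sum]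
  refine Submodule.sum_mem _ fun a _ => ?_
  rw [map_smul]
  exact Submodule.smul_mem _ _ (youngSym_single_mem_span hlam (Fintype.card (Box lam)) a (by omega))

/-! ### Occupation numbers of fillings -/

/-- The numbers of entries `k` in row `j`, for `j < k`. -/
def occ {d : ℕ} {lam : Fin d → ℕ} (a : Box lam → Fin d) : Occ d := fun p => rowCount a p.1.1 p.1.2

theorem sum_rowCount {d : ℕ} {lam : Fin d → ℕ} (a : Box lam → Fin d) (i : Fin d) :
    ∑ v, rowCount a i v = lam i := by
  have h1 : (Finset.univ.filter fun b : Box lam => b.1 = i).card = lam i := by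
    have : (Finset.univ.filter fun b : Box lam => b.1 = i) =
        Finset.univ.map (Function.Embedding.sigmaMk (β := fun i => Fin (lam i)) i) := by
      ext ⟨i', x⟩
      simp only [Finset.mem_filter, Finset.mem_univ, true_and, Finset.mem_map,
        Function.Embedding.sigmaMk_apply]
      constructor
      · rintro rfl; exact ⟨x, rfl⟩
      · rintro ⟨y, hy⟩; exact (congrArg Sigma.fst hy).symm
    rw [this, Finset.card_map, Finset.card_univ, Fintype.card_fin]
  rw [← h1, Finset.card_eq_sum_card_fiberwise (f := a) (t := Finset.univ) (by simp)]
  refine Finset.sum_congr rfl fun v _ => ?_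
  rw [rowCount, Finset.filter_filter]

theorem Upper.rowCount_eq_zero {d : ℕ} {lam : Fin d → ℕ} {a : Box lam → Fin d} (ha : Upper a)
    {i v : Fin d} (h : v < i) : rowCount a i v = 0 := by
  rw [rowCount, Finset.card_eq_zero, Finset.filter_eq_empty_iff]
  rintro b - ⟨rfl, rfl⟩
  exact absurd (ha b) (not_le.mpr h)

theorem Upper.sameRows {d : ℕ} {lam : Fin d → ℕ} {a c : Box lam → Fin d} (ha : Upper a)
    (hc : Upper c) (h : occ a = occ c) : SameRows a c := by
  have hne : ∀ i v, v ≠ i → rowCount a i v = rowCount c i v := by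
    intro i v hv
    rcases lt_or_gt_of_ne hv with h' | h'
    · rw [ha.rowCount_eq_zero h', hc.rowCount_eq_zero h']
    · exact congrFun h ⟨(i, v), h'⟩
  intro i v
  by_cases hv : v = i
  · subst hv
    have h1 := sum_rowCount a v
    have h2 := sum_rowCount c v
    rw [← Finset.add_sum_erase _ _ (Finset.mem_univ v)] at h1 h2
    have h3 : ∑ w ∈ Finset.univ.erase v, rowCount a v w = ∑ w ∈ Finset.univ.erase v, rowCount c v w :=
      Finset.sum_congr rfl (fun w hw => hne v w (Finset.ne_of_mem_erase hw))
    omega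
  · exact hne i v hv

theorem SameRows.occ_eq {d : ℕ} {lam : Fin d → ℕ} {a c : Box lam → Fin d}
    (h : SameRows a c) : occ a = occ c := funext fun _ => h _ _

theorem SameRows.upper {d : ℕ} {lam : Fin d → ℕ} {a c : Box lam → Fin d}
    (h : SameRows a c) (ha : Upper a) : Upper c := by
  intro b
  by_contra hb
  have h1 := (h b.1 (c b)).symm.trans (ha.rowCount_eq_zero (not_le.mp hb))
  rw [rowCount, Finset.card_eq_zero, Finset.filter_eq_empty_iff] at h1
  exact h1 (Finset.mem_univ b) ⟨rfl, rfl⟩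

/-- The number of entries of row `i` that are prescribed by `m`. -/
def rowTotal {d : ℕ} (m : Occ d) (i : Fin d) : ℕ := ∑ p : Pairs d, if p.1.1 = i then m p else 0

theorem rowTail_le {d : ℕ} (m : Occ d) (i : Fin d) {j j' : Fin d} (h : j ≤ j') :
    rowTail m i j' ≤ rowTail m i j := by
  refine Finset.sum_le_sum fun p _ => ?_
  split_ifs with h1 h2
  · exact le_rfl
  · exact absurd ⟨h1.1, lt_of_le_of_lt h h1.2⟩ h2
  · exact Nat.zero_le _
  · exact le_rfl

/-- The condition on candidates is monotone in `j`, so the minimal candidate is governed by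
thresholds: the entries exceeding `j` fill the last `rowTail m i j` boxes of the row. -/
theorem tableau_le_iff {d : ℕ} (lam : Fin d → ℕ) (m : Occ d) (b : Box lam) (j : Fin d) :
    tableau lam m b ≤ j ↔ b.1 ≤ j ∧ (b.2 : ℕ) + rowTail m b.1 j < lam b.1 := by
  constructor
  · intro h
    have h1 := Finset.min'_mem _ (entryCandidates_nonempty lam m b)
    have h2 := (Finset.mem_filter.mp h1).2
    refine ⟨h2.1.trans h, lt_of_le_of_lt ?_ h2.2⟩
    exact Nat.add_le_add_left (rowTail_le m b.1 h) _
  · intro h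
    exact Finset.min'_le _ _ (by simpa [entryCandidates] using h)

theorem upper_tableau {d : ℕ} (lam : Fin d → ℕ) (m : Occ d) : Upper (tableau lam m) :=
  fun b => ((tableau_le_iff lam m b _).mp le_rfl).1

theorem rowTail_pred {d : ℕ} (m : Occ d) (p : Pairs d) (k : Fin d) (hk : (k : ℕ) + 1 = p.1.2) :
    rowTail m p.1.1 k = rowTail m p.1.1 p.1.2 + m p := by
  have : m p = ∑ q : Pairs d, if q = p then m q else 0 := by simp
  rw [this, rowTail, rowTail, ← Finset.sum_add_distrib]
  refine Finset.sum_congr rfl fun q _ => ?_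
  have hq : q = p ↔ q.1.1 = p.1.1 ∧ (q.1.2 : ℕ) = p.1.2 := by
    rw [Subtype.ext_iff, Prod.ext_iff, Fin.ext_iff (a := q.1.2)]
  have h1 : k < q.1.2 ↔ (p.1.2 : ℕ) ≤ q.1.2 := by rw [Fin.lt_def]; omega
  have h2 : p.1.2 < q.1.2 ↔ (p.1.2 : ℕ) < q.1.2 := Fin.lt_def
  simp only [hq, h1, h2]
  by_cases h : q.1.1 = p.1.1
  · simp only [h, true_and]
    split_ifs <;> omega
  · simp [h]

theorem rowTail_le_rowTotal {d : ℕ} (m : Occ d) (i j : Fin d) : rowTail m i j ≤ rowTotal m i := by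
  refine Finset.sum_le_sum fun p _ => ?_
  split_ifs with h1 h2
  · exact le_rfl
  · exact absurd h1.1 h2
  · exact Nat.zero_le _
  · exact le_rfl

theorem occ_tableau {d : ℕ} (lam : Fin d → ℕ) (m : Occ d) (hm : ∀ i, rowTotal m i ≤ lam i) :
    occ (tableau lam m) = m := by
  funext p
  have hp : (p.1.1 : ℕ) < p.1.2 := p.2
  have hk := p.1.2.2
  -- The predecessor of the value being counted. The entries equal to that value lie in the columns
  -- between the thresholds of the value and of its predecessor; the fitting hypothesis keeps the
  -- truncated subtractions exact.
  set k : Fin d := ⟨p.1.2 - 1, by omega⟩ with hkdef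
  have hk1 : (k : ℕ) + 1 = p.1.2 := by simp only [hkdef]; omega
  have hT := rowTail_pred m p k hk1
  have hle := (rowTail_le_rowTotal m p.1.1 k).trans (hm p.1.1)
  have hiff : ∀ b : Box lam, b.1 = p.1.1 → (tableau lam m b = p.1.2 ↔
      (b.2 : ℕ) + rowTail m p.1.1 p.1.2 < lam p.1.1 ∧
        lam p.1.1 ≤ (b.2 : ℕ) + rowTail m p.1.1 k) := by
    rintro ⟨i, x⟩ (rfl : i = p.1.1)
    have h1 := tableau_le_iff lam m ⟨p.1.1, x⟩ p.1.2
    have h2 := tableau_le_iff lam m ⟨p.1.1, x⟩ k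
    have h3 : p.1.1 ≤ p.1.2 := p.2.le
    have h4 : p.1.1 ≤ k := by rw [Fin.le_def]; omega
    simp only [h3, h4, true_and] at h1 h2
    rw [Fin.le_def] at h1 h2
    rw [Fin.ext_iff]
    dsimp only at h1 h2 ⊢
    omega
  have : (Finset.Ico (lam p.1.1 - rowTail m p.1.1 k) (lam p.1.1 - rowTail m p.1.1 p.1.2)).card
      = m p := by
    rw [Nat.card_Ico]; omega
  rw [← this, occ, rowCount]
  refine Finset.card_bij (fun b _ => (b.2 : ℕ)) ?_ ?_ ?_
  · intro b hb
    rw [Finset.mem_filter] at hb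
    have := (hiff b hb.2.1).mp hb.2.2
    rw [Finset.mem_Ico]; omega
  · rintro ⟨i, x⟩ hb ⟨i', x'⟩ hb' h
    simp only [Finset.mem_filter, Finset.mem_univ, true_and] at hb hb'
    obtain rfl := hb.1
    obtain rfl := hb'.1
    simp only [Fin.val_inj] at h
    rw [h]
  · intro x hx
    rw [Finset.mem_Ico] at hx
    refine ⟨⟨p.1.1, ⟨x, by omega⟩⟩, ?_, rfl⟩
    rw [Finset.mem_filter]
    refine ⟨Finset.mem_univ _, rfl, (hiff _ rfl).mpr ?_⟩
    simp only
    omega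

theorem rowTotal_occ_le {d : ℕ} {lam : Fin d → ℕ} (a : Box lam → Fin d) (i : Fin d) :
    rowTotal (occ a) i ≤ lam i := by
  rw [← sum_rowCount a i, rowTotal, ← Finset.sum_filter]
  have hinj : Set.InjOn (fun p : Pairs d => p.1.2)
      (Finset.univ.filter fun p : Pairs d => p.1.1 = i : Finset (Pairs d)) := by
    intro p hp q hq h
    simp only [Finset.coe_filter, Finset.mem_univ, true_and, Set.mem_ofPred_eq] at hp hq
    exact Subtype.ext (Prod.ext (hp.trans hq.symm) h)
  rw [Finset.sum_congr rfl (g := fun p : Pairs d => rowCount a i p.1.2),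
    ← Finset.sum_image (f := fun v => rowCount a i v) hinj]
  · exact Finset.sum_le_sum_of_subset (Finset.subset_univ _)
  · intro p hp
    rw [Finset.mem_filter] at hp
    rw [occ, hp.2]

/-- Boxes are grouped by row and entry; diagonal groups contribute one and groups below the diagonal
are empty. The general monoid serves both the count `total_occ` and the eigenvalues of diagonal
matrices. -/
theorem prod_rowCount {d : ℕ} {lam : Fin d → ℕ} {a : Box lam → Fin d} (ha : Upper a) {R : Type*}
    [CommMonoid R] (f : Fin d → Fin d → R) (hf : ∀ i, f i i = 1) :
    ∏ b, f b.1 (a b) = ∏ p : Pairs d, f p.1.1 p.1.2 ^ occ a p := by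
  have h1 : ∏ b, f b.1 (a b) = ∏ q : Fin d × Fin d, f q.1 q.2 ^ rowCount a q.1 q.2 := by
    rw [← Finset.prod_fiberwise (g := fun b : Box lam => (b.1, a b))]
    refine Finset.prod_congr rfl fun q _ => ?_
    rw [Finset.prod_congr rfl (g := fun _ => f q.1 q.2), Finset.prod_const, rowCount]
    · congr 3; ext b; simp [Prod.ext_iff]
    · intro b hb
      rw [Finset.mem_filter] at hb
      rw [← hb.2]
  rw [h1, ← Finset.prod_filter_of_ne (p := fun q : Fin d × Fin d => q.1 < q.2)]
  · exact Finset.prod_subtype (p := fun q : Fin d × Fin d => q.1 < q.2) _ (by simp)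
      (fun q => f q.1 q.2 ^ rowCount a q.1 q.2)
  · intro q _ hq
    by_contra h
    rcases (not_lt.mp h).lt_or_eq with h' | h'
    · rw [ha.rowCount_eq_zero h', pow_zero] at hq; exact hq rfl
    · rw [h', hf, one_pow] at hq; exact hq rfl

theorem total_occ {d : ℕ} {lam : Fin d → ℕ} {a : Box lam → Fin d} (ha : Upper a) :
    (occ a).total = (Finset.univ.filter fun b => a b ≠ b.1).card := by
  have := prod_rowCount ha (R := Multiplicative ℕ)
    (fun i v => Multiplicative.ofAdd (if v ≠ i then 1 else 0)) (by simp)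
  rw [Finset.card_filter, Occ.total]
  apply Multiplicative.ofAdd.injective
  rw [ofAdd_sum, ofAdd_sum, this]
  refine Finset.prod_congr rfl fun p _ => ?_
  rw [if_pos p.2.ne', ← ofAdd_nsmul]
  simp

theorem sameRows_tableau_occ {d : ℕ} {lam : Fin d → ℕ} {a : Box lam → Fin d} (ha : Upper a) :
    SameRows a (tableau lam (occ a)) :=
  ha.sameRows (upper_tableau _ _) (occ_tableau _ _ (rowTotal_occ_le a)).symm

/-- Occupation numbers that fit into the diagram. -/
abbrev FitOcc {d : ℕ} (lam : Fin d → ℕ) : Type := {m : Occ d // ∀ i, rowTotal m i ≤ lam i}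

theorem span_youngVec {d : ℕ} {lam : Fin d → ℕ} (hlam : Antitone lam) :
    Submodule.span ℂ (Set.range fun m : FitOcc lam => youngVec lam m.1) = ⊤ := by
  rw [eq_top_iff]
  rintro ⟨_, x, rfl⟩ -
  rw [← Submodule.apply_mem_span_image_iff_mem_span (f := (Block lam).subtype)
    (Submodule.injective_subtype _), ← Set.range_comp]
  refine Submodule.span_mono ?_ (span_upper hlam x)
  rintro _ ⟨c, rfl⟩
  exact ⟨⟨occ c.1, rowTotal_occ_le c.1⟩, (sameRows_tableau_occ c.2).youngSym_single.symm⟩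

/-! ### Diagonal states on the block -/

theorem tensorPower_diagonal_single {d : ℕ} {lam : Fin d → ℕ} (w : Fin d → ℂ)
    (a : Box lam → Fin d) :
    tensorPower lam (Matrix.diagonal w) (EuclideanSpace.single a 1) =
      (∏ b, w (a b)) • EuclideanSpace.single a 1 := by
  ext c
  rw [tensorPower_apply, Finset.sum_eq_single a]
  · rw [PiLp.smul_apply, PiLp.single_apply, PiLp.single_apply, if_pos rfl, mul_one, smul_eq_mul]
    split_ifs with h
    · subst h; simp
    · rw [mul_zero]
      obtain ⟨b, hb⟩ := Function.ne_iff.mp h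
      exact Finset.prod_eq_zero (Finset.mem_univ b) (Matrix.diagonal_apply_ne _ hb)
  · intro b _ hb
    rw [PiLp.single_apply, if_neg hb, mul_zero]
  · simp

theorem blockRestrict_youngVec {d : ℕ} {lam : Fin d → ℕ} {w : Fin d → ℝ} (hw : ∀ i, w i ≠ 0)
    (m : FitOcc lam) :
    blockRestrict lam (Matrix.diagonal fun i => (w i : ℂ)) (youngVec lam m.1) =
      (((∏ b : Box lam, w b.1) * ∏ p : Pairs d, (w p.1.2 / w p.1.1) ^ m.1 p : ℝ) : ℂ) •
        youngVec lam m.1 := by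
  apply Subtype.ext
  change tensorPower lam _ (youngSym lam _) = _ • youngSym lam _
  rw [tensorPower_youngSym, tensorPower_diagonal_single, map_smul]
  congr 1
  have h := prod_rowCount (upper_tableau lam m.1) (fun i v => w v / w i)
    (fun i => div_self (hw i))
  rw [occ_tableau lam m.1 m.2] at h
  rw [← h, ← Finset.prod_mul_distrib, Complex.ofReal_prod]
  refine Finset.prod_congr rfl fun b _ => ?_
  rw [mul_div_cancel₀ _ (hw _)]

theorem sum_prod_geom_le {ι : Type*} [Fintype ι] [DecidableEq ι] {q : ι → ℝ} (h0 : ∀ i, 0 ≤ q i)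
    (h1 : ∀ i, q i < 1) (F : Finset (ι → ℕ)) :
    ∑ m ∈ F, ∏ i, q i ^ m i ≤ ∏ i, (1 - q i)⁻¹ := by
  classical
  set K := F.sup fun m => Finset.univ.sup m with hK
  have hF : F ⊆ Fintype.piFinset fun _ : ι => Finset.range (K + 1) := by
    intro m hm
    rw [Fintype.mem_piFinset]
    intro i
    rw [Finset.mem_range, Nat.lt_succ_iff]
    exact (Finset.le_sup (f := m) (Finset.mem_univ i)).trans
      (Finset.le_sup (f := fun m : ι → ℕ => Finset.univ.sup m) hm)
  refine (Finset.sum_le_sum_of_subset_of_nonneg hF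
    fun m _ _ => Finset.prod_nonneg fun i _ => pow_nonneg (h0 i) _).trans ?_
  rw [← Finset.prod_univ_sum (fun _ => Finset.range (K + 1)) (fun i k => q i ^ k)]
  refine Finset.prod_le_prod (fun i _ => Finset.sum_nonneg fun k _ => pow_nonneg (h0 i) k)
    fun i _ => ?_
  rw [← tsum_geometric_of_lt_one (h0 i) (h1 i)]
  exact (summable_geometric_of_lt_one (h0 i) (h1 i)).sum_le_tsum _ fun k _ => pow_nonneg (h0 i) k

/-- Any linearly independent subfamily that still spans will do; which occupation numbers occur in
it never matters. -/
theorem exists_youngVec_basis {d : ℕ} {lam : Fin d → ℕ} (hlam : Antitone lam) :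
    ∃ (κ : Type) (_ : Fintype κ) (idx : κ ↪ Occ d) (b : Module.Basis κ ℂ (Block lam)),
      (∀ k i, rowTotal (idx k) i ≤ lam i) ∧ ∀ k, b k = youngVec lam (idx k) := by
  obtain ⟨κ, a, ha, hspan, hli⟩ := exists_linearIndependent' ℂ fun m : FitOcc lam => youngVec lam m.1
  rw [span_youngVec hlam] at hspan
  let b := Module.Basis.mk hli hspan.ge
  exact ⟨κ, FiniteDimensional.fintypeBasisIndex b,
    ⟨fun k => (a k).1, fun k k' h => ha (Subtype.ext h)⟩, b, fun k => (a k).2, fun k => by simp [b]; rfl⟩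

/-- In a basis of eigenvectors `y f_m` with distinct `m`, the trace is a partial sum of a product of
geometric series. The upper bound on `S` is what bounds the normalised eigenvalues from below; the
nonzero vector only ensures that the sum is not empty. -/
theorem trace_blockRestrict {d : ℕ} {lam : Fin d → ℕ} (hlam : Antitone lam) {w : Fin d → ℝ}
    (hw : ∀ i, 0 < w i) (hw' : ∀ i j, i < j → w j < w i) {m₀ : Occ d} (hm₀ : youngVec lam m₀ ≠ 0) :
    ∃ S : ℝ, 0 < S ∧ S ≤ ∏ p : Pairs d, (1 - w p.1.2 / w p.1.1)⁻¹ ∧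
      LinearMap.trace ℂ (Block lam) (blockRestrict lam (Matrix.diagonal fun i => (w i : ℂ))) =
        (((∏ b : Box lam, w b.1) * S : ℝ) : ℂ) := by
  classical
  obtain ⟨κ, _, idx, b, hF, hb⟩ := exists_youngVec_basis hlam
  have hq : ∀ p : Pairs d, 0 < w p.1.2 / w p.1.1 := fun p => div_pos (hw _) (hw _)
  refine ⟨∑ k, ∏ p : Pairs d, (w p.1.2 / w p.1.1) ^ idx k p, ?_, ?_, ?_⟩
  · refine Finset.sum_pos (fun m _ => Finset.prod_pos fun p _ => pow_pos (hq p) _) ?_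
    by_contra h
    rw [Finset.univ_nonempty_iff, not_nonempty_iff] at h
    have : Subsingleton (Block lam) := b.repr.toEquiv.subsingleton
    exact hm₀ (Subsingleton.elim _ _)
  · rw [← Finset.sum_map Finset.univ idx (fun m => ∏ p : Pairs d, (w p.1.2 / w p.1.1) ^ m p)]
    exact sum_prod_geom_le (fun p => (hq p).le)
      (fun p => (div_lt_one (hw _)).mpr (hw' _ _ p.2)) _
  · rw [LinearMap.trace_eq_matrix_trace ℂ b, Matrix.trace, Finset.mul_sum, Complex.ofReal_sum]
    refine Finset.sum_congr rfl fun k _ => ?_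
    rw [Matrix.diag_apply, LinearMap.toMatrix_apply, hb,
      blockRestrict_youngVec (fun i => (hw i).ne') ⟨idx k, hF k⟩]
    simp only
    rw [← hb, map_smul, Module.Basis.repr_self]
    simp

/-! ### Fillings with at most one deviation per column -/

/-- Column-injective fillings whose columns have at most one entry different from the row number. -/
def Simple {d : ℕ} {lam : Fin d → ℕ} (a : Box lam → Fin d) : Prop :=
  Upper a ∧ ColInj a ∧
    ∀ b b' : Box lam, (b.2 : ℕ) = b'.2 → a b ≠ b.1 → a b' ≠ b'.1 → b = b'

open Classical in
/-- The simple fillings with given occupation numbers. -/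
def simpleFillings {d : ℕ} (lam : Fin d → ℕ) (m : Occ d) : Finset (Box lam → Fin d) :=
  Finset.univ.filter fun a => Simple a ∧ occ a = m

/-- The number of simple fillings with given occupation numbers. -/
def simpleCount {d : ℕ} (lam : Fin d → ℕ) (m : Occ d) : ℕ := (simpleFillings lam m).card

theorem mem_simpleFillings {d : ℕ} {lam : Fin d → ℕ} {m : Occ d} {a : Box lam → Fin d} :
    a ∈ simpleFillings lam m ↔ Simple a ∧ occ a = m := by simp [simpleFillings]

/-- The boxes of row `p.1` outside the columns of row `p.2`, in columns without deviations. -/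
def freeBoxes {d : ℕ} {lam : Fin d → ℕ} (p : Pairs d) (a : Box lam → Fin d) : Finset (Box lam) :=
  Finset.univ.filter fun x =>
    x.1 = p.1.1 ∧ lam p.1.2 ≤ x.2 ∧ ∀ b : Box lam, (b.2 : ℕ) = x.2 → a b = b.1

/-- Each deviation spoils at most one of the columns that reach the upper row but not the lower one.
-/
theorem card_freeBoxes {d : ℕ} {lam : Fin d → ℕ} (p : Pairs d) {a : Box lam → Fin d}
    (ha : Upper a) : lam p.1.1 - lam p.1.2 - (occ a).total ≤ (freeBoxes p a).card := by
  classical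
  rw [total_occ ha, ← Nat.card_Ico (lam p.1.2) (lam p.1.1)]
  refine (Nat.sub_le_sub_left (Finset.card_image_le (f := fun b : Box lam => (b.2 : ℕ))) _).trans ?_
  refine (Finset.le_card_sdiff _ _).trans ?_
  refine Finset.card_le_card_of_surjOn (fun b => (b.2 : ℕ)) ?_
  intro x hx
  simp only [Finset.coe_sdiff, Finset.coe_Ico, Finset.coe_image, Finset.coe_filter,
    Finset.mem_univ, true_and, Set.mem_sdiff, Set.mem_Ico, Set.mem_image, Set.mem_ofPred_eq,
    not_exists, not_and] at hx
  refine ⟨⟨p.1.1, ⟨x, hx.1.2⟩⟩, ?_, rfl⟩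
  simp only [freeBoxes, Finset.coe_filter, Finset.mem_univ, true_and, Set.mem_ofPred_eq]
  refine ⟨hx.1.1, fun b hb => ?_⟩
  by_contra h
  exact hx.2 b h hb

/-- The column of a free box stops above row `p.1.2` and holds only row numbers, so the new entry
repeats nothing and is the only deviation there. -/
theorem simple_update {d : ℕ} {lam : Fin d → ℕ} {p : Pairs d} {a : Box lam → Fin d}
    (ha : Simple a) {x : Box lam} (hx : x ∈ freeBoxes p a) :
    Simple (Function.update a x p.1.2) := by
  simp only [freeBoxes, Finset.mem_filter, Finset.mem_univ, true_and] at hx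
  obtain ⟨h1, h2, h3⟩ := hx
  have key : ∀ b : Box lam, (b.2 : ℕ) = x.2 → b.1 ≠ p.1.2 := by
    rintro ⟨i, y⟩ hb (rfl : i = _)
    have := y.2
    simp only at hb
    omega
  refine ⟨?_, ?_, ?_⟩
  · intro b
    by_cases hb : b = x
    · subst hb; rw [Function.update_self, h1]; exact p.2.le
    · rw [Function.update_of_ne hb]; exact ha.1 b
  · intro b b' hbb h
    by_cases hb : b = x
    · subst hb
      by_contra hne
      rw [Function.update_self, Function.update_of_ne (Ne.symm hne), h3 b' hbb.symm] at h
      exact key b' hbb.symm h.symm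
    by_cases hb' : b' = x
    · subst hb'
      rw [Function.update_self, Function.update_of_ne hb, h3 b hbb] at h
      exact absurd h (key b hbb)
    rw [Function.update_of_ne hb, Function.update_of_ne hb'] at h
    exact ha.2.1 b b' hbb h
  · intro b b' hbb h h'
    by_cases hb : b = x
    · subst hb
      by_contra hne
      rw [Function.update_of_ne (Ne.symm hne)] at h'
      exact h' (h3 b' hbb.symm)
    by_cases hb' : b' = x
    · subst hb'
      rw [Function.update_of_ne hb] at h
      exact absurd (h3 b hbb) h
    rw [Function.update_of_ne hb] at h
    rw [Function.update_of_ne hb'] at h'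
    exact ha.2.2 b b' hbb h h'

theorem occ_update {d : ℕ} {lam : Fin d → ℕ} {p : Pairs d} {a : Box lam → Fin d}
    {x : Box lam} (hx : x ∈ freeBoxes p a) :
    occ (Function.update a x p.1.2) = occ a + Pi.single p 1 := by
  classical
  simp only [freeBoxes, Finset.mem_filter, Finset.mem_univ, true_and] at hx
  obtain ⟨h1, h2, h3⟩ := hx
  have hax : a x = p.1.1 := (h3 x rfl).trans h1
  funext q
  rw [Pi.add_apply, occ, occ, rowCount, rowCount]
  by_cases hq : q = p
  · subst hq
    rw [Pi.single_eq_same, ← Finset.card_insert_of_notMem (a := x)]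
    · congr 1
      ext b
      simp only [Finset.mem_filter, Finset.mem_univ, true_and, Finset.mem_insert]
      by_cases hb : b = x
      · subst hb; simp [h1]
      · simp [hb]
    · simp only [Finset.mem_filter, Finset.mem_univ, true_and, hax, not_and]
      exact fun _ => q.2.ne
  · rw [Pi.single_eq_of_ne hq, add_zero]
    congr 1
    ext b
    simp only [Finset.mem_filter, Finset.mem_univ, true_and]
    by_cases hb : b = x
    · subst hb
      rw [Function.update_self, h1, hax]
      constructor
      · rintro ⟨h, h'⟩
        exact absurd (Subtype.ext (Prod.ext h.symm h'.symm)) hq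
      · rintro ⟨h, h'⟩
        exact absurd (h.symm.trans h') q.2.ne
    · rw [Function.update_of_ne hb]

/-- Double counting: writing `k` into a free box of row `j` injects pairs (simple filling of content
`m`, free box) into pairs (simple filling of content `m + e_p`, box of row `j` holding `k`). -/
theorem simpleCount_mul_le {d : ℕ} (lam : Fin d → ℕ) (m : Occ d) (p : Pairs d) :
    simpleCount lam m * (lam p.1.1 - lam p.1.2 - m.total) ≤
      simpleCount lam (m + Pi.single p 1) * (m p + 1) := by
  classical
  have e1 : simpleCount lam m * (lam p.1.1 - lam p.1.2 - m.total) ≤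
      ((simpleFillings lam m).sigma fun a => freeBoxes p a).card := by
    rw [Finset.card_sigma, simpleCount, ← smul_eq_mul]
    refine Finset.card_nsmul_le_sum _ _ _ fun a ha => ?_
    rw [mem_simpleFillings] at ha
    rw [← ha.2]
    exact card_freeBoxes p ha.1.1
  have e2 : ((simpleFillings lam (m + Pi.single p 1)).sigma fun a =>
      Finset.univ.filter fun b : Box lam => b.1 = p.1.1 ∧ a b = p.1.2).card =
      simpleCount lam (m + Pi.single p 1) * (m p + 1) := by
    rw [Finset.card_sigma, simpleCount, ← smul_eq_mul, ← Finset.sum_const]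
    refine Finset.sum_congr rfl fun a ha => ?_
    rw [mem_simpleFillings] at ha
    have := congrFun ha.2 p
    simpa [occ, rowCount] using this
  rw [← e2]
  refine e1.trans (Finset.card_le_card_of_injOn
    (fun z => ⟨Function.update z.1 z.2 p.1.2, z.2⟩) ?_ ?_)
  · rintro ⟨a, x⟩ hz
    simp only [Finset.coe_sigma, Set.mem_sigma_iff, Finset.mem_coe] at hz ⊢
    obtain ⟨ha, hx⟩ := hz
    rw [mem_simpleFillings] at ha ⊢
    refine ⟨⟨simple_update ha.1 hx, by rw [occ_update hx, ha.2]⟩, ?_⟩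
    simp only [freeBoxes, Finset.mem_filter, Finset.mem_univ, true_and] at hx
    simp [hx.1]
  · rintro ⟨a, x⟩ hz ⟨a', x'⟩ hz' h
    simp only [Sigma.mk.injEq, heq_eq_eq] at h
    obtain ⟨h, rfl⟩ := h
    simp only [Finset.coe_sigma, Set.mem_sigma_iff, Finset.mem_coe, freeBoxes, Finset.mem_filter,
      Finset.mem_univ, true_and] at hz hz'
    have : a = a' := by
      ext1 b
      by_cases hb : b = x
      · subst hb
        rw [hz.2.2.2 b rfl, hz'.2.2.2 b rfl]
      · have := congrFun h b
        rwa [Function.update_of_ne hb, Function.update_of_ne hb] at this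
    rw [this]

theorem Occ.total_add {d : ℕ} (m t : Occ d) : Occ.total (m + t) = m.total + t.total := by
  simp [Occ.total, Finset.sum_add_distrib]

theorem Occ.total_single {d : ℕ} (p : Pairs d) : Occ.total (Pi.single p 1 : Occ d) = 1 := by
  simp [Occ.total]

theorem Occ.le_total {d : ℕ} (m : Occ d) (p : Pairs d) : m p ≤ m.total :=
  Finset.single_le_sum (f := m) (fun _ _ => Nat.zero_le _) (Finset.mem_univ p)

theorem simpleCount_le_pow {d : ℕ} {lam : Fin d → ℕ} {M N : ℕ} (hMN : M < N)
    (hN : ∀ p : Pairs d, N + lam p.1.2 ≤ lam p.1.1) :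
    ∀ (k : ℕ) (m t : Occ d), t.total = k → (m + t).total ≤ M →
      (simpleCount lam m : ℝ) ≤ ((M : ℝ) / (N - M)) ^ k * simpleCount lam (m + t) := by
  intro k
  have hpos : (0 : ℝ) < N - M := by
    have : (M : ℝ) < N := by exact_mod_cast hMN
    linarith
  induction k with
  | zero =>
    intro m t ht _
    have : t = 0 := by
      funext p
      have := t.le_total p
      simp only [Pi.zero_apply]; omega
    simp [this]
  | succ k ih =>
    intro m t ht hM
    obtain ⟨p, hp⟩ : ∃ p, t p ≠ 0 := by
      by_contra! h
      rw [Occ.total, Finset.sum_eq_zero (fun p _ => h p)] at ht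
      omega
    obtain ⟨t', rfl⟩ : ∃ t' : Occ d, t = Pi.single p 1 + t' := by
      refine ⟨fun q => t q - (Pi.single p 1 : Occ d) q, ?_⟩
      funext q
      rw [Pi.add_apply]
      by_cases hq : q = p
      · subst hq; rw [Pi.single_eq_same]; omega
      · rw [Pi.single_eq_of_ne hq]; omega
    have h1 := ih (m + Pi.single p 1) t' (by
      rw [Occ.total_add, Occ.total_single] at ht; omega) (by rwa [add_assoc])
    have h2 := simpleCount_mul_le lam m p
    have hNp := hN p
    rw [Occ.total_add, Occ.total_add, Occ.total_single] at hM
    have hmp := m.le_total p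
    -- Since `m + e_p` still has total at most `M`, the factor `m p + 1` is at most `M`, and the
    -- factor on the left is at least `N - M`.
    have h3 : simpleCount lam m * (N - M) ≤ simpleCount lam (m + Pi.single p 1) * M :=
      (Nat.mul_le_mul_left _ (by omega)).trans (h2.trans (Nat.mul_le_mul_left _ (by omega)))
    have h4 : (simpleCount lam m : ℝ) * (N - M) ≤ simpleCount lam (m + Pi.single p 1) * M := by
      rw [← Nat.cast_sub hMN.le]; exact_mod_cast h3
    calc (simpleCount lam m : ℝ) ≤ (M : ℝ) / (N - M) * simpleCount lam (m + Pi.single p 1) := by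
          rw [div_mul_eq_mul_div, le_div_iff₀ hpos]; linarith
      _ ≤ (M : ℝ) / (N - M) * (((M : ℝ) / (N - M)) ^ k *
            simpleCount lam (m + Pi.single p 1 + t')) := by
          gcongr
      _ = _ := by rw [pow_succ', add_assoc]; ring

theorem simple_diagonal {d : ℕ} (lam : Fin d → ℕ) : Simple (fun b : Box lam => b.1) := by
  refine ⟨fun b => le_rfl, ?_, fun b b' _ h => absurd rfl h⟩
  rintro ⟨i, x⟩ ⟨i', x'⟩ h (rfl : i = i')
  simp only [Fin.val_inj] at h
  rw [h]

theorem occ_diagonal {d : ℕ} (lam : Fin d → ℕ) : occ (fun b : Box lam => b.1) = 0 := by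
  funext p
  rw [occ, rowCount, Pi.zero_apply, Finset.card_eq_zero, Finset.filter_eq_empty_iff]
  rintro b - ⟨h, h'⟩
  exact p.2.ne (h.symm.trans h')

/-- The count dominates a multiple of the count for empty occupation, where the filling by row
numbers is available. -/
theorem simpleCount_pos {d : ℕ} {lam : Fin d → ℕ} {M N : ℕ} (hMN : M < N)
    (hN : ∀ p : Pairs d, N + lam p.1.2 ≤ lam p.1.1) {m : Occ d} (hm : m.total ≤ M) :
    0 < simpleCount lam m := by
  have h := simpleCount_le_pow hMN hN _ 0 m rfl (by rwa [zero_add])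
  rw [zero_add] at h
  have h0 : 1 ≤ simpleCount lam 0 :=
    Finset.card_pos.mpr ⟨_, mem_simpleFillings.mpr ⟨simple_diagonal lam, occ_diagonal lam⟩⟩
  rcases Nat.eq_zero_or_pos (simpleCount lam m) with h1 | h1
  · rw [h1] at h
    have : (1 : ℝ) ≤ simpleCount lam 0 := by exact_mod_cast h0
    simp at h
    linarith
  · exact h1

/-! ### Skeletons of compatible pairs -/

/-- The number of entries of column `j` that differ from the row number. -/
def colDev {d : ℕ} {lam : Fin d → ℕ} (c : Box lam → Fin d) (j : ℕ) : ℕ :=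
  (Finset.univ.filter fun b => (b.2 : ℕ) = j ∧ c b ≠ b.1).card

/-- Columns where the two fillings differ or have several deviations. -/
def BadCol {d : ℕ} {lam : Fin d → ℕ} (c c' : Box lam → Fin d) (j : ℕ) : Prop :=
  (∃ b : Box lam, (b.2 : ℕ) = j ∧ c b ≠ c' b) ∨
    ∃ b b' : Box lam, (b.2 : ℕ) = j ∧ (b'.2 : ℕ) = j ∧ b ≠ b' ∧ c b ≠ b.1 ∧ c b' ≠ b'.1

/-- Rearranged columns have equal entry sums, so a pointwise inequality between them is an equality.
-/
theorem col_eq_of_le {d : ℕ} {lam : Fin d → ℕ} {c c' : Box lam → Fin d}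
    {τ : Equiv.Perm (Box lam)} (hτ : τ ∈ colGroup lam) (h : c ∘ τ = c') {j : ℕ}
    (hle : ∀ b : Box lam, (b.2 : ℕ) = j → c b ≤ c' b) (b : Box lam) (hb : (b.2 : ℕ) = j) :
    c b = c' b := by
  rw [mem_colGroup] at hτ
  have hs : ∑ b ∈ Finset.univ.filter (fun b : Box lam => (b.2 : ℕ) = j), (c b : ℕ) =
      ∑ b ∈ Finset.univ.filter (fun b : Box lam => (b.2 : ℕ) = j), (c' b : ℕ) := by
    symm
    refine Finset.sum_bij (fun b _ => τ b) ?_ (fun _ _ _ _ h => τ.injective h) ?_ ?_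
    · intro b hb; simpa [hτ] using hb
    · intro b hb
      refine ⟨τ.symm b, ?_, by simp⟩
      have := hτ (τ.symm b)
      rw [Equiv.apply_symm_apply] at this
      simpa [← this] using hb
    · intro b _; rw [← h]; rfl
  have := (Finset.sum_eq_sum_iff_of_le (fun b hb => by
    rw [Finset.mem_filter] at hb
    exact hle b hb.2)).mp hs b (by simpa using hb)
  exact Fin.ext this

theorem col_eq_of_ge {d : ℕ} {lam : Fin d → ℕ} {c c' : Box lam → Fin d}
    {τ : Equiv.Perm (Box lam)} (hτ : τ ∈ colGroup lam) (h : c ∘ τ = c') {j : ℕ}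
    (hle : ∀ b : Box lam, (b.2 : ℕ) = j → c' b ≤ c b) (b : Box lam) (hb : (b.2 : ℕ) = j) :
    c b = c' b := by
  refine (col_eq_of_le (colGroup_inv hτ) (c := c') (c' := c) ?_ hle b hb).symm
  rw [← h]; ext x; simp

/-- If the columns differ, neither is free of deviations: the column of row numbers is pointwise
minimal among upper ones, so `col_eq_of_le` would identify the two. Nor can each have exactly one
deviation, as the two cases below show. If the columns agree, being bad means two deviations in
each, four in all. -/
theorem three_le_colDev {d : ℕ} {lam : Fin d → ℕ} {c c' : Box lam → Fin d} (hc : Upper c)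
    (hc' : Upper c') {τ : Equiv.Perm (Box lam)} (hτ : τ ∈ colGroup lam) (h : c ∘ τ = c') {j : ℕ}
    (hbad : BadCol c c' j) : 3 ≤ colDev c j + colDev c' j := by
  by_cases hdiff : ∃ b : Box lam, (b.2 : ℕ) = j ∧ c b ≠ c' b
  · by_contra hlt
    obtain ⟨b₁, hb₁, hne⟩ := hdiff
    have h1 : colDev c j ≠ 0 := by
      intro h0
      rw [colDev, Finset.card_eq_zero, Finset.filter_eq_empty_iff] at h0
      refine hne (col_eq_of_le hτ h (fun b hb => ?_) b₁ hb₁)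
      have := h0 (Finset.mem_univ b)
      simp only [hb, true_and, not_not] at this
      rw [this]; exact hc' b
    have h2 : colDev c' j ≠ 0 := by
      intro h0
      rw [colDev, Finset.card_eq_zero, Finset.filter_eq_empty_iff] at h0
      refine hne (col_eq_of_ge hτ h (fun b hb => ?_) b₁ hb₁)
      have := h0 (Finset.mem_univ b)
      simp only [hb, true_and, not_not] at this
      rw [this]; exact hc b
    have h3 : colDev c j = 1 := by omega
    have h4 : colDev c' j = 1 := by omega
    obtain ⟨x, hx⟩ := Finset.card_eq_one.mp h3
    obtain ⟨x', hx'⟩ := Finset.card_eq_one.mp h4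
    have hxm : ∀ b : Box lam, ((b.2 : ℕ) = j ∧ c b ≠ b.1) ↔ b = x := by
      intro b
      simpa using Finset.ext_iff.mp hx b
    have hxm' : ∀ b : Box lam, ((b.2 : ℕ) = j ∧ c' b ≠ b.1) ↔ b = x' := by
      intro b
      simpa using Finset.ext_iff.mp hx' b
    -- If the deviations sat in different boxes, `c'` would hold the row number of `x` at `x`. In
    -- `c` this value would have to sit at `τ x`, which forces `τ x = x`, although `c` deviates
    -- there.
    have hxx : x = x' := by
      by_contra hxx
      obtain ⟨hxj, hcx⟩ := (hxm x).mpr rfl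
      have h5 : c' x = x.1 := by
        by_contra h'
        exact hxx ((hxm' x).mp ⟨hxj, h'⟩)
      have h6 : c (τ x) = x.1 := by rw [← h5, ← h]; rfl
      have h7 : ((τ x).2 : ℕ) = x.2 := mem_colGroup.mp hτ x
      have h8 : c (τ x) = (τ x).1 := by
        by_contra h'
        have := (hxm (τ x)).mp ⟨h7.trans hxj, h'⟩
        rw [this] at h6
        exact hcx h6
      have h9 : τ x = x := by
        have h10 := h8.symm.trans h6
        generalize τ x = y at h7 h10
        obtain ⟨i, y⟩ := y
        obtain ⟨i', z⟩ := x
        simp only at h7 h10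
        subst h10
        rw [Fin.val_inj] at h7
        rw [h7]
      rw [h9] at h6
      exact hcx h6
    subst hxx
    have hother : ∀ b : Box lam, (b.2 : ℕ) = j → b ≠ x → c b = c' b := by
      intro b hb hbx
      have e1 : c b = b.1 := by
        by_contra h'
        exact hbx ((hxm b).mp ⟨hb, h'⟩)
      have e2 : c' b = b.1 := by
        by_contra h'
        exact hbx ((hxm' b).mp ⟨hb, h'⟩)
      rw [e1, e2]
    apply hne
    -- With a single common deviating box the two columns are pointwise comparable.
    rcases le_total (c x) (c' x) with hle | hle
    · refine col_eq_of_le hτ h (fun b hb => ?_) b₁ hb₁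
      by_cases hbx : b = x
      · rw [hbx]; exact hle
      · exact (hother b hb hbx).le
    · refine col_eq_of_ge hτ h (fun b hb => ?_) b₁ hb₁
      by_cases hbx : b = x
      · rw [hbx]; exact hle
      · exact (hother b hb hbx).ge
  · obtain ⟨b, b', hb, hb', hne, h1, h2⟩ := hbad.resolve_left hdiff
    push Not at hdiff
    have h3 : 1 < colDev c j := Finset.one_lt_card.mpr ⟨b, by simp [hb, h1], b', by simp [hb', h2], hne⟩
    have h4 : 1 < colDev c' j := Finset.one_lt_card.mpr ⟨b, by simp [hb, h1, ← hdiff b hb], b',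
      by simp [hb', h2, ← hdiff b' hb'], hne⟩
    omega

/-- Pairs of fillings all of whose nontrivial columns have at least three deviations. -/
def Skeleton {d : ℕ} {lam : Fin d → ℕ} (s s' : Box lam → Fin d) : Prop :=
  Upper s ∧ Upper s' ∧ ∀ j : ℕ, (∀ b : Box lam, (b.2 : ℕ) = j → s b = b.1 ∧ s' b = b.1) ∨
    3 ≤ colDev s j + colDev s' j

open Classical in
/-- The filling `e` on the bad columns, row numbers elsewhere. -/
def badPart {d : ℕ} {lam : Fin d → ℕ} (c c' e : Box lam → Fin d) : Box lam → Fin d :=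
  fun b => if BadCol c c' b.2 then e b else b.1

open Classical in
/-- The filling `c` on the good columns, row numbers elsewhere. -/
def goodPart {d : ℕ} {lam : Fin d → ℕ} (c c' : Box lam → Fin d) : Box lam → Fin d :=
  fun b => if BadCol c c' b.2 then b.1 else c b

theorem goodPart_eq {d : ℕ} {lam : Fin d → ℕ} {c c' : Box lam → Fin d} {b : Box lam}
    (h : ¬ BadCol c c' b.2) : c' b = c b := by
  by_contra h'
  exact h (Or.inl ⟨b, rfl, Ne.symm h'⟩)

theorem upper_badPart {d : ℕ} {lam : Fin d → ℕ} {c c' e : Box lam → Fin d} (he : Upper e) :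
    Upper (badPart c c' e) := by
  intro b
  rw [badPart]
  split_ifs
  · exact he b
  · exact le_rfl

/-- Every deviation of `e` belongs to exactly one of the parts, and row numbers do not count as
occupation. -/
theorem occ_goodPart_add {d : ℕ} {lam : Fin d → ℕ} {c c' e : Box lam → Fin d}
    (he : ∀ b, ¬ BadCol c c' b.2 → e b = c b) :
    occ (goodPart c c') + occ (badPart c c' e) = occ e := by
  classical
  funext p
  rw [Pi.add_apply, occ, occ, occ, rowCount, rowCount, rowCount, ← Finset.card_union_of_disjoint]
  · congr 1
    ext b
    simp only [Finset.mem_union, Finset.mem_filter, Finset.mem_univ, true_and]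
    rw [goodPart, badPart]
    by_cases hb : BadCol c c' b.2
    · simp only [hb, if_true]
      constructor
      · rintro (⟨h, h'⟩ | h)
        · exact absurd (h.symm.trans h') p.2.ne
        · exact h
      · exact Or.inr
    · simp only [hb, if_false, he b hb]
      constructor
      · rintro (h | ⟨h, h'⟩)
        · exact h
        · exact absurd (h.symm.trans h') p.2.ne
      · exact Or.inl
  · rw [Finset.disjoint_filter]
    rintro b - ⟨h1, h2⟩ ⟨-, h3⟩
    rw [goodPart] at h2
    rw [badPart] at h3
    split_ifs at h2 h3
    · exact p.2.ne (h1.symm.trans h2)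
    · exact p.2.ne (h1.symm.trans h3)

theorem simple_goodPart {d : ℕ} {lam : Fin d → ℕ} {c c' : Box lam → Fin d} (hc : Upper c)
    (hc' : ColInj c') : Simple (goodPart c c') := by
  refine ⟨?_, ?_, ?_⟩
  · intro b
    rw [goodPart]
    split_ifs
    · exact le_rfl
    · exact hc b
  · intro b b' hbb h
    by_cases hb : BadCol c c' b.2
    · have hb' : BadCol c c' b'.2 := hbb ▸ hb
      rw [goodPart, goodPart, if_pos hb, if_pos hb'] at h
      exact (simple_diagonal lam).2.1 b b' hbb h
    · have hb' : ¬ BadCol c c' b'.2 := hbb ▸ hb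
      rw [goodPart, goodPart, if_neg hb, if_neg hb', ← goodPart_eq hb, ← goodPart_eq hb'] at h
      exact hc' b b' hbb h
  · intro b b' hbb h h'
    by_cases hb : BadCol c c' b.2
    · rw [goodPart, if_pos hb] at h
      exact absurd rfl h
    · have hb' : ¬ BadCol c c' b'.2 := hbb ▸ hb
      rw [goodPart, if_neg hb] at h
      rw [goodPart, if_neg hb'] at h'
      by_contra hne
      exact hb (Or.inr ⟨b, b', rfl, hbb.symm, hne, h, h'⟩)

theorem colDev_badPart {d : ℕ} {lam : Fin d → ℕ} {c c' e : Box lam → Fin d} {j : ℕ}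
    (h : BadCol c c' j) : colDev (badPart c c' e) j = colDev e j := by
  rw [colDev, colDev]
  congr 1
  ext b
  simp only [Finset.mem_filter, Finset.mem_univ, true_and]
  refine and_congr_right fun hb => ?_
  subst hb
  rw [badPart, if_pos h]

theorem skeleton_badPart {d : ℕ} {lam : Fin d → ℕ} {c c' : Box lam → Fin d} (hc : Upper c)
    (hc' : Upper c') (h : Compatible c c') : Skeleton (badPart c c' c) (badPart c c' c') := by
  refine ⟨upper_badPart hc, upper_badPart hc', fun j => ?_⟩
  obtain ⟨-, τ, hτ, h⟩ := h
  by_cases hj : BadCol c c' j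
  · right
    rw [colDev_badPart hj, colDev_badPart hj]
    exact three_le_colDev hc hc' hτ h hj
  · left
    rintro b rfl
    rw [badPart, badPart, if_neg hj, if_neg hj]
    exact ⟨rfl, rfl⟩

theorem badPart_ne_diagonal {d : ℕ} {lam : Fin d → ℕ} {c c' : Box lam → Fin d} (hc : Upper c)
    (hc' : Upper c') (h : Compatible c c') (hne : ¬ (c = c' ∧ Simple c)) :
    ¬ (badPart c c' c = (fun b => b.1) ∧ badPart c c' c' = fun b => b.1) := by
  rintro ⟨h1, h2⟩
  have hgood : ∀ j, ¬ BadCol c c' j := by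
    intro j hj
    obtain ⟨-, τ, hτ, h⟩ := h
    have := three_le_colDev hc hc' hτ h hj
    rw [← colDev_badPart hj, ← colDev_badPart (e := c') hj, h1, h2] at this
    simp [colDev] at this
  have hcc : c' = c := by
    funext b
    exact goodPart_eq (hgood b.2)
  have hg : goodPart c c' = c := by
    funext b
    rw [goodPart, if_neg (hgood b.2)]
  exact hne ⟨hcc.symm, hg ▸ simple_goodPart hc h.1⟩

/-- The set of bad columns need not be remembered: a filling is its bad part wherever that deviates
from the row number, and the good part elsewhere. -/
theorem parts_injective {d : ℕ} {lam : Fin d → ℕ} {c c' e e' : Box lam → Fin d}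
    (h1 : goodPart c c' = goodPart e e') (h2 : badPart c c' c = badPart e e' e)
    (h3 : badPart c c' c' = badPart e e' e') : c = e ∧ c' = e' := by
  have key : ∀ c c' : Box lam → Fin d, ∀ f : Box lam → Fin d,
      (∀ b, ¬ BadCol c c' b.2 → f b = c b) → ∀ b,
      f b = if badPart c c' f b = b.1 then goodPart c c' b else badPart c c' f b := by
    intro c c' f hf b
    rw [goodPart, badPart]
    by_cases hb : BadCol c c' b.2
    · simp only [hb, if_true]
      split_ifs with h
      · exact h
      · rfl
    · simp only [hb, if_false, if_true]
      exact hf b hb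
  constructor
  · funext b
    rw [key c c' c (fun _ _ => rfl) b, key e e' e (fun _ _ => rfl) b, h1, h2]
  · funext b
    rw [key c c' c' (fun _ h => goodPart_eq h) b, key e e' e' (fun _ h => goodPart_eq h) b, h1, h3]

/-! ### Counting bad pairs -/

theorem sum_colDev {d : ℕ} {lam : Fin d → ℕ} {L : ℕ} (hL : ∀ i, lam i ≤ L) (s : Box lam → Fin d) :
    ∑ j : Fin L, colDev s j = (Finset.univ.filter fun b => s b ≠ b.1).card := by
  rw [Finset.card_eq_sum_card_fiberwise (f := fun b : Box lam =>
    (⟨b.2, lt_of_lt_of_le b.2.2 (hL b.1)⟩ : Fin L)) (t := Finset.univ) (by simp)]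
  refine Finset.sum_congr rfl fun j _ => ?_
  rw [colDev, Finset.filter_filter]
  congr 1
  ext b
  simp only [Finset.mem_filter, Finset.mem_univ, true_and, Fin.ext_iff]
  exact and_comm

/-- The columns of a filling, completed by the row numbers. -/
def columns {d : ℕ} {lam : Fin d → ℕ} (L : ℕ) (s : Box lam → Fin d) : Fin L → Fin d → Fin d :=
  fun j i => if h : (j : ℕ) < lam i then s ⟨i, ⟨j, h⟩⟩ else i

theorem columns_injective {d : ℕ} {lam : Fin d → ℕ} {L : ℕ} (hL : ∀ i, lam i ≤ L) :
    Function.Injective (columns (lam := lam) L) := by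
  intro s s' h
  funext ⟨i, x⟩
  have := congrFun (congrFun h ⟨x, lt_of_lt_of_le x.2 (hL i)⟩) i
  simpa [columns] using this

-- Columns are independent. Each pair of columns is trivial, with weight one, or one of fewer than
-- `(d^d)²` others, with at least three deviations and so weight at most `σ³`. Expanding the `L`-th
-- power of the sum over column pairs covers all skeletons.
open Classical in
theorem sum_skeleton_le {d : ℕ} {lam : Fin d → ℕ} {L : ℕ} (hL : ∀ i, lam i ≤ L) {σ : ℝ}
    (h0 : 0 ≤ σ) (h1 : σ ≤ 1) :
    ∑ z : (Box lam → Fin d) × (Box lam → Fin d) with Skeleton z.1 z.2,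
      σ ^ ((Finset.univ.filter fun b => z.1 b ≠ b.1).card +
        (Finset.univ.filter fun b => z.2 b ≠ b.1).card) ≤
      (1 + ((d ^ d) ^ 2 : ℕ) * σ ^ 3) ^ L := by
  -- The pair `(id, id)` is the trivial column pair; completing short columns by row numbers makes
  -- it available for every column.
  obtain ⟨W, hW⟩ : ∃ W : (Fin d → Fin d) × (Fin d → Fin d) → ℝ,
      ∀ u, W u = if u = (id, id) then 1 else σ ^ 3 := ⟨_, fun _ => rfl⟩
  have hW0 : ∀ u, 0 ≤ W u := fun u => by simp only [hW]; split_ifs <;> positivity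
  have hWσ : ∀ u, σ ^ 3 ≤ W u := fun u => by
    simp only [hW]; split_ifs
    · exact pow_le_one₀ h0 h1
    · exact le_rfl
  have hWsum : ∑ u, W u ≤ 1 + ((d ^ d) ^ 2 : ℕ) * σ ^ 3 := by
    calc ∑ u, W u ≤ ∑ u : (Fin d → Fin d) × (Fin d → Fin d),
          ((if u = (id, id) then 1 else 0) + σ ^ 3) := by
          refine Finset.sum_le_sum fun u _ => ?_
          simp only [hW]
          have := pow_nonneg h0 3
          split_ifs <;> linarith
      _ = _ := by
          rw [Finset.sum_add_distrib]
          simp [Finset.card_univ, sq]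
  obtain ⟨e, he⟩ : ∃ e : (Box lam → Fin d) × (Box lam → Fin d) →
      Fin L → (Fin d → Fin d) × (Fin d → Fin d),
      ∀ z j, e z j = (columns L z.1 j, columns L z.2 j) := ⟨_, fun _ _ => rfl⟩
  have hinj : Function.Injective e := by
    intro z z' h
    refine Prod.ext (columns_injective hL ?_) (columns_injective hL ?_)
    · funext j; simpa [he] using congrArg Prod.fst (congrFun h j)
    · funext j; simpa [he] using congrArg Prod.snd (congrFun h j)
  calc _ ≤ ∑ z : (Box lam → Fin d) × (Box lam → Fin d) with Skeleton z.1 z.2,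
        ∏ j, W (e z j) := by
        refine Finset.sum_le_sum fun z hz => ?_
        rw [Finset.mem_filter] at hz
        rw [← sum_colDev hL, ← sum_colDev hL, ← Finset.sum_add_distrib,
          ← Finset.prod_pow_eq_pow_sum]
        refine Finset.prod_le_prod (fun j _ => pow_nonneg h0 _) fun j _ => ?_
        rcases hz.2.2.2 j with h | h
        · have : e z j = (id, id) := by
            simp only [he, Prod.mk.injEq]
            constructor
            · funext i
              rw [columns]
              split_ifs with hi
              · exact (h ⟨i, ⟨j, hi⟩⟩ rfl).1
              · rfl
            · funext i
              rw [columns]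
              split_ifs with hi
              · exact (h ⟨i, ⟨j, hi⟩⟩ rfl).2
              · rfl
          rw [this]
          simp only [hW, if_true]
          exact pow_le_one₀ h0 h1
        · exact (pow_le_pow_of_le_one h0 h1 h).trans (hWσ _)
    _ = ∑ F ∈ (Finset.univ.filter fun z : (Box lam → Fin d) × (Box lam → Fin d) =>
          Skeleton z.1 z.2).image e, ∏ j : Fin L, W (F j) := by
        rw [Finset.sum_image hinj.injOn]
    _ ≤ ∑ F : Fin L → (Fin d → Fin d) × (Fin d → Fin d), ∏ j, W (F j) :=
        Finset.sum_le_sum_of_subset_of_nonneg (Finset.subset_univ _)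
          fun F _ _ => Finset.prod_nonneg fun j _ => hW0 _
    _ = (∑ u, W u) ^ L := (Fintype.sum_pow W L).symm
    _ ≤ _ := by
        have : 0 ≤ ∑ u, W u := Finset.sum_nonneg fun u _ => hW0 u
        gcongr

open Classical in
/-- The compatible pairs that do not consist of twice the same simple filling. -/
def badPairs {d : ℕ} (lam : Fin d → ℕ) (M : ℕ) (m : Occ d) :
    Finset ((Box lam → Fin d) × (Box lam → Fin d)) :=
  Finset.univ.filter fun z => Upper z.1 ∧ Upper z.2 ∧ Compatible z.1 z.2 ∧ occ z.1 = m ∧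
    ¬ (z.1 = z.2 ∧ Simple z.1) ∧ (occ z.2).total ≤ M

/-- The bound on the weight of all bad pairs. -/
def badWeight (d L : ℕ) (σ : ℝ) : ℝ := (1 + ((d ^ d) ^ 2 : ℕ) * σ ^ 3) ^ L - 1

/-- The geometric mean of `simpleCount_le_pow` for `t` and for `t'`: each deviation of either
filling costs one factor `√(M / (N - M))`. -/
theorem simpleCount_ratio {d : ℕ} {lam : Fin d → ℕ} {M N : ℕ} (hMN : M < N)
    (hN : ∀ p : Pairs d, N + lam p.1.2 ≤ lam p.1.1) {k t t' : Occ d} (h : (k + t).total ≤ M)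
    (h' : (k + t').total ≤ M) :
    (simpleCount lam k : ℝ) *
      (1 / √((simpleCount lam (k + t) : ℝ) * simpleCount lam (k + t'))) ≤
      √((M : ℝ) / (N - M)) ^ (t.total + t'.total) := by
  have hpos : (0 : ℝ) < N - M := by
    have : (M : ℝ) < N := by exact_mod_cast hMN
    linarith
  have hs : (0 : ℝ) ≤ (M : ℝ) / (N - M) := by positivity
  have r1 : (0 : ℝ) < simpleCount lam (k + t) := by exact_mod_cast simpleCount_pos hMN hN h
  have r2 : (0 : ℝ) < simpleCount lam (k + t') := by exact_mod_cast simpleCount_pos hMN hN h'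
  have i1 := simpleCount_le_pow hMN hN _ k t rfl h
  have i2 := simpleCount_le_pow hMN hN _ k t' rfl h'
  rw [mul_one_div, div_le_iff₀ (Real.sqrt_pos.mpr (mul_pos r1 r2))]
  refine le_of_sq_le_sq ?_ (by positivity) 
  rw [mul_pow, Real.sq_sqrt (mul_pos r1 r2).le, ← pow_mul, mul_comm _ 2, pow_mul, Real.sq_sqrt hs,
    pow_add, sq]
  calc _ ≤ (((M : ℝ) / (N - M)) ^ t.total * simpleCount lam (k + t)) *
        (((M : ℝ) / (N - M)) ^ t'.total * simpleCount lam (k + t')) := by gcongr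
    _ = _ := by ring

/-- A bad pair is a nontrivial skeleton together with a simple filling on the good columns. For a
given skeleton the content `k` of the simple part is forced by `m`, so at most `simpleCount lam k`
pairs arise, and `simpleCount_ratio` bounds their weight by `σ` to the number of deviations of the
skeleton. -/
theorem sum_badPairs_le {d : ℕ} {lam : Fin d → ℕ} {M N L : ℕ} (hMN : M < N) (hMN' : 2 * M ≤ N)
    (hN : ∀ p : Pairs d, N + lam p.1.2 ≤ lam p.1.1) (hL : ∀ i, lam i ≤ L) {m : Occ d}
    (hm : m.total ≤ M) :
    ∑ z ∈ badPairs lam M m, 1 / √((simpleCount lam m : ℝ) * simpleCount lam (occ z.2)) ≤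
      badWeight d L √((M : ℝ) / (N - M)) := by
  classical
  have hpos : (0 : ℝ) < N - M := by
    have : (M : ℝ) < N := by exact_mod_cast hMN
    linarith
  set σ := √((M : ℝ) / (N - M)) with hσ
  have h0 : 0 ≤ σ := Real.sqrt_nonneg _
  have h1 : σ ≤ 1 := by
    rw [hσ, Real.sqrt_le_one, div_le_one hpos]
    have : (2 * M : ℝ) ≤ N := by exact_mod_cast hMN'
    linarith
  set f : (Box lam → Fin d) × (Box lam → Fin d) →
      ((Box lam → Fin d) × (Box lam → Fin d)) × (Box lam → Fin d) :=
    fun z => ((badPart z.1 z.2 z.1, badPart z.1 z.2 z.2), goodPart z.1 z.2) with hf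
  set diag : Box lam → Fin d := fun b => b.1 with hdiag
  set Sk := (Finset.univ.filter fun z : (Box lam → Fin d) × (Box lam → Fin d) =>
    Skeleton z.1 z.2).erase (diag, diag) with hSk
  -- The weight of the pair with given skeleton and good part, extended by zero so that the sum may
  -- run over all combinations.
  set h : ((Box lam → Fin d) × (Box lam → Fin d)) × (Box lam → Fin d) → ℝ := fun y =>
    if Simple y.2 ∧ occ y.2 + occ y.1.1 = m ∧ (occ y.2 + occ y.1.2).total ≤ M then
      1 / √((simpleCount lam m : ℝ) * simpleCount lam (occ y.2 + occ y.1.2)) else 0 with hh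
  have hh0 : ∀ y, 0 ≤ h y := fun y => by simp only [hh]; split_ifs <;> positivity
  have hinj : Set.InjOn f (badPairs lam M m) := by
    intro z _ z' _ hz
    simp only [hf, Prod.mk.injEq] at hz
    have := parts_injective hz.2 hz.1.1 hz.1.2
    exact Prod.ext this.1 this.2
  calc _ = ∑ z ∈ badPairs lam M m, h (f z) := by
        refine Finset.sum_congr rfl fun z hz => ?_
        simp only [badPairs, Finset.mem_filter, Finset.mem_univ, true_and] at hz
        obtain ⟨h1, h2, h3, h4, h5, h6⟩ := hz
        have e1 := occ_goodPart_add (c := z.1) (c' := z.2) (e := z.1) (fun _ _ => rfl)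
        have e2 := occ_goodPart_add (c := z.1) (c' := z.2) (e := z.2) (fun _ h => goodPart_eq h)
        simp only [hh, hf, e1, e2]
        rw [if_pos ⟨simple_goodPart h1 h3.1, h4, h6⟩]
    _ = ∑ y ∈ (badPairs lam M m).image f, h y := by rw [Finset.sum_image hinj]
    _ ≤ ∑ y ∈ Sk ×ˢ Finset.univ, h y := by
        refine Finset.sum_le_sum_of_subset_of_nonneg ?_ fun y _ _ => hh0 y
        intro y hy
        obtain ⟨z, hz, rfl⟩ := Finset.mem_image.mp hy
        simp only [badPairs, Finset.mem_filter, Finset.mem_univ, true_and] at hz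
        obtain ⟨h1, h2, h3, h4, h5, h6⟩ := hz
        simp only [hf, hSk, Finset.mem_product, Finset.mem_univ, and_true, Finset.mem_erase,
          Finset.mem_filter, true_and, ne_eq, Prod.mk.injEq]
        exact ⟨badPart_ne_diagonal h1 h2 h3 h5, skeleton_badPart h1 h2 h3⟩
    _ = ∑ s ∈ Sk, ∑ a, h (s, a) := Finset.sum_product _ _ _
    _ ≤ ∑ s ∈ Sk, σ ^ ((Finset.univ.filter fun b => s.1 b ≠ b.1).card +
          (Finset.univ.filter fun b => s.2 b ≠ b.1).card) := by
        refine Finset.sum_le_sum fun s hs => ?_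
        rw [hSk, Finset.mem_erase, Finset.mem_filter] at hs
        rw [← total_occ hs.2.2.1, ← total_occ hs.2.2.2.1]
        by_cases hex : ∃ k, k + occ s.1 = m ∧ (k + occ s.2).total ≤ M
        · obtain ⟨k, rfl, hk⟩ := hex
          calc ∑ a, h (s, a) ≤ ∑ a ∈ simpleFillings lam k,
                1 / √((simpleCount lam (k + occ s.1) : ℝ) * simpleCount lam (k + occ s.2)) := by
                rw [simpleFillings, Finset.sum_filter]
                refine Finset.sum_le_sum fun a _ => ?_
                simp only [hh]
                split_ifs with h3 h4 h4
                · rw [h4.2]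
                · exact absurd ⟨h3.1, add_right_cancel h3.2.1⟩ h4
                · positivity
                · exact le_rfl
            _ = _ := by rw [Finset.sum_const, nsmul_eq_mul]; rfl
            _ ≤ _ := simpleCount_ratio hMN hN hm hk
        · rw [Finset.sum_eq_zero]
          · positivity
          · intro a _
            simp only [hh]
            rw [if_neg]
            rintro ⟨_, h3, h4⟩
            exact hex ⟨_, h3, h4⟩
    _ ≤ _ := by
        -- The trivial skeleton contributes exactly one; removing it gives the `- 1` in `badWeight`.
        have hmem : (diag, diag) ∈ (Finset.univ.filter
            fun z : (Box lam → Fin d) × (Box lam → Fin d) => Skeleton z.1 z.2) := by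
          rw [Finset.mem_filter]
          exact ⟨Finset.mem_univ _, fun b => le_rfl, fun b => le_rfl,
            fun j => Or.inl fun b _ => ⟨rfl, rfl⟩⟩
        have := sum_skeleton_le (lam := lam) hL h0 h1
        rw [← Finset.add_sum_erase _ _ hmem] at this
        simp only [hdiag, ne_eq, not_true_eq_false, Finset.filter_false, Finset.card_empty,
          add_zero, pow_zero] at this
        rw [badWeight]
        simp only [hSk, hdiag, ne_eq]
        linarith

/-! ### Quasi-orthogonality -/

open Classical in
/-- The fillings with entries at least the row number and given occupation numbers. -/
def fillings {d : ℕ} (lam : Fin d → ℕ) (m : Occ d) : Finset (Box lam → Fin d) :=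
  Finset.univ.filter fun c => Upper c ∧ occ c = m

theorem mem_fillings {d : ℕ} {lam : Fin d → ℕ} {m : Occ d} {c : Box lam → Fin d} :
    c ∈ fillings lam m ↔ Upper c ∧ occ c = m := by simp [fillings]

/-- The Gram matrix of the vectors `y f_m`, up to normalisation. -/
def gram {d : ℕ} (lam : Fin d → ℕ) (m l : Occ d) : ℝ :=
  ∑ c ∈ fillings lam m, ∑ c' ∈ fillings lam l, colEntry c c'

theorem reducedGram_tableau {d : ℕ} {lam : Fin d → ℕ} {m l : Occ d}
    (hm : ∀ i, rowTotal m i ≤ lam i) (hl : ∀ i, rowTotal l i ≤ lam i) :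
    reducedGram (tableau lam m) (tableau lam l) = gram lam m l := by
  classical
  have key : ∀ m : Occ d, (∀ i, rowTotal m i ≤ lam i) →
      (Finset.univ.filter fun c => SameRows (tableau lam m) c) = fillings lam m := by
    intro m hm
    ext c
    rw [mem_fillings, Finset.mem_filter]
    constructor
    · rintro ⟨-, h⟩
      exact ⟨h.upper (upper_tableau lam m), h.occ_eq ▸ occ_tableau lam m hm⟩
    · rintro ⟨h, h'⟩
      exact ⟨Finset.mem_univ _, (upper_tableau lam m).sameRows h ((occ_tableau lam m hm).trans h'.symm)⟩
  rw [reducedGram, gram, ← key m hm, ← key l hl]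

open Classical in
/-- The number of bad pairs with given occupation numbers. -/
def badCount {d : ℕ} (lam : Fin d → ℕ) (M : ℕ) (m l : Occ d) : ℕ :=
  ((badPairs lam M m).filter fun z => occ z.2 = l).card

theorem sum_badCount_le {d : ℕ} {lam : Fin d → ℕ} {M N L : ℕ} (hMN : M < N) (hMN' : 2 * M ≤ N)
    (hN : ∀ p : Pairs d, N + lam p.1.2 ≤ lam p.1.1) (hL : ∀ i, lam i ≤ L) {m : Occ d}
    (hm : m.total ≤ M) (F : Finset (Occ d)) :
    ∑ l ∈ F, badCount lam M m l * (1 / √((simpleCount lam m : ℝ) * simpleCount lam l)) ≤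
      badWeight d L √((M : ℝ) / (N - M)) := by
  classical
  refine le_trans ?_ (sum_badPairs_le hMN hMN' hN hL hm)
  refine le_trans (le_of_eq ?_) (Finset.sum_fiberwise_le_sum_of_sum_fiber_nonneg (t := F)
    (g := fun z : (Box lam → Fin d) × (Box lam → Fin d) => occ z.2)
    fun l _ => Finset.sum_nonneg fun z _ => by positivity)
  refine Finset.sum_congr rfl fun l _ => ?_
  rw [badCount, ← nsmul_eq_mul, ← Finset.sum_const]
  refine Finset.sum_congr (by congr) fun z hz => ?_
  rw [(Finset.mem_filter.mp hz).2]

/-- For different contents the two fillings cannot coincide, so each nonzero term comes from a bad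
pair and has modulus at most one. -/
theorem abs_gram_le {d : ℕ} {lam : Fin d → ℕ} {M : ℕ} {m l : Occ d} (hl : l.total ≤ M)
    (hml : m ≠ l) : |gram lam m l| ≤ badCount lam M m l := by
  classical
  rw [gram, ← Finset.sum_product']
  refine (Finset.abs_sum_le_sum_abs _ _).trans ?_
  calc _ ≤ ∑ z ∈ fillings lam m ×ˢ fillings lam l, if z ∈ badPairs lam M m then (1 : ℝ) else 0 := by
        refine Finset.sum_le_sum fun z hz => ?_
        rw [Finset.mem_product, mem_fillings, mem_fillings] at hz
        split_ifs with h
        · exact abs_colEntry_le _ _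
        · refine (abs_eq_zero.mpr ?_).le
          by_contra hne
          refine h (Finset.mem_filter.mpr ⟨Finset.mem_univ _, hz.1.1, hz.2.1,
            compatible_of_colEntry_ne_zero hne, hz.1.2, fun h' => hml ?_, by rwa [hz.2.2]⟩)
          rw [← hz.1.2, ← hz.2.2, h'.1]
    _ = (((fillings lam m ×ˢ fillings lam l).filter fun z => z ∈ badPairs lam M m).card : ℝ) := by
        rw [Finset.sum_boole]
    _ ≤ _ := by
        rw [badCount]
        refine Nat.cast_le.mpr (Finset.card_le_card fun z hz => ?_)
        rw [Finset.mem_filter, Finset.mem_product, mem_fillings, mem_fillings] at hz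
        exact Finset.mem_filter.mpr ⟨hz.2, hz.1.2.2⟩

/-- Each simple filling paired with itself contributes one; the remaining nonzero terms come from
bad pairs and are at least `-1`. -/
theorem le_gram_self {d : ℕ} {lam : Fin d → ℕ} {M : ℕ} {m : Occ d} (hm : m.total ≤ M) :
    (simpleCount lam m : ℝ) - badCount lam M m m ≤ gram lam m m := by
  classical
  have hsub : ((simpleFillings lam m).image fun a => (a, a)) ⊆ fillings lam m ×ˢ fillings lam m := by
    intro z hz
    obtain ⟨a, ha, rfl⟩ := Finset.mem_image.mp hz
    rw [mem_simpleFillings] at ha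
    rw [Finset.mem_product, mem_fillings]
    exact ⟨⟨ha.1.1, ha.2⟩, ⟨ha.1.1, ha.2⟩⟩
  have h1 : (simpleCount lam m : ℝ) =
      ∑ z ∈ fillings lam m ×ˢ fillings lam m, if z.1 = z.2 ∧ Simple z.1 then (1 : ℝ) else 0 := by
    rw [Finset.sum_boole, simpleCount, ← Finset.card_image_of_injective (simpleFillings lam m)
      (f := fun a => (a, a)) (fun a b h => congrArg Prod.fst h)]
    congr 2
    ext z
    rw [Finset.mem_filter]
    constructor
    · intro hz
      refine ⟨hsub hz, ?_⟩
      obtain ⟨a, ha, rfl⟩ := Finset.mem_image.mp hz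
      exact ⟨rfl, (mem_simpleFillings.mp ha).1⟩
    · rintro ⟨h, h', h''⟩
      rw [Finset.mem_product, mem_fillings, mem_fillings] at h
      exact Finset.mem_image.mpr ⟨z.1, mem_simpleFillings.mpr ⟨h'', h.1.2⟩, Prod.ext rfl h'⟩
  have h2 : (badCount lam M m m : ℝ) ≥ ∑ z ∈ fillings lam m ×ˢ fillings lam m,
      if z ∈ badPairs lam M m then (1 : ℝ) else 0 := by
    rw [Finset.sum_boole, badCount]
    refine Nat.cast_le.mpr (Finset.card_le_card fun z hz => ?_)
    rw [Finset.mem_filter, Finset.mem_product, mem_fillings, mem_fillings] at hz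
    exact Finset.mem_filter.mpr ⟨hz.2, hz.1.2.2⟩
  have h3 : ∑ z ∈ fillings lam m ×ˢ fillings lam m,
      ((if z.1 = z.2 ∧ Simple z.1 then (1 : ℝ) else 0) -
        if z ∈ badPairs lam M m then (1 : ℝ) else 0) ≤ gram lam m m := by
    rw [gram, ← Finset.sum_product']
    refine Finset.sum_le_sum fun z hz => ?_
    rw [Finset.mem_product, mem_fillings, mem_fillings] at hz
    have hab := abs_le.mp (abs_colEntry_le z.1 z.2)
    by_cases hs : z.1 = z.2 ∧ Simple z.1
    · rw [if_pos hs, ← hs.1, colEntry_self hs.2.2.1]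
      split_ifs <;> norm_num
    · rw [if_neg hs]
      split_ifs with h
      · linarith [hab.1]
      · have : colEntry z.1 z.2 = 0 := by
          by_contra hne
          exact h (Finset.mem_filter.mpr ⟨Finset.mem_univ _, hz.1.1, hz.2.1,
            compatible_of_colEntry_ne_zero hne, hz.1.2, hs, by rwa [hz.2.2]⟩)
        rw [this]; norm_num
  rw [Finset.sum_sub_distrib, ← h1] at h3
  linarith

/-- Content zero leaves only the filling by row numbers. It is pointwise minimal among upper
fillings, so it has no other upper column rearrangement. This exact orthogonality allows `V` to fix
the vacuum without a correction factor. -/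
theorem gram_zero {d : ℕ} {lam : Fin d → ℕ} {l : Occ d} (hl : l ≠ 0) : gram lam 0 l = 0 := by
  refine Finset.sum_eq_zero fun c hc => Finset.sum_eq_zero fun c' hc' => ?_
  rw [mem_fillings] at hc hc'
  by_contra h
  obtain ⟨-, τ, hτ, h⟩ := compatible_of_colEntry_ne_zero h
  have htriv : ∀ b, c b = b.1 := by
    have := total_occ hc.1
    rw [hc.2] at this
    intro b
    by_contra hb
    have h1 : (Finset.univ.filter fun b => c b ≠ b.1).card = 0 := by
      rw [← this]; simp [Occ.total]
    rw [Finset.card_eq_zero, Finset.filter_eq_empty_iff] at h1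
    exact h1 (Finset.mem_univ b) hb
  have : c = c' := funext fun b =>
    col_eq_of_le hτ h (j := b.2) (fun b _ => by rw [htriv]; exact hc'.1 b) b rfl
  exact hl (by rw [← hc'.2, ← this, hc.2])

/-! ### Norms and overlaps of the vectors `|m, λ⟩` -/

attribute [local instance 2000] InnerProductSpace.toInner

theorem rowTotal_le_total {d : ℕ} (m : Occ d) (i : Fin d) : rowTotal m i ≤ m.total := by
  refine Finset.sum_le_sum fun p _ => ?_
  split_ifs
  · exact le_rfl
  · exact Nat.zero_le _

theorem rowTotal_le_of_total_le {d : ℕ} {lam : Fin d → ℕ} {M N : ℕ} (hMN : M < N)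
    (hN : ∀ p : Pairs d, N + lam p.1.2 ≤ lam p.1.1) {m : Occ d} (hm : m.total ≤ M) (i : Fin d) :
    rowTotal m i ≤ lam i := by
  by_cases h : ∃ p : Pairs d, p.1.1 = i
  · obtain ⟨p, rfl⟩ := h
    have := hN p
    have := rowTotal_le_total m p.1.1
    omega
  · push Not at h
    rw [rowTotal, Finset.sum_eq_zero fun p _ => if_neg (h p)]
    exact Nat.zero_le _

theorem inner_youngVec {d : ℕ} {lam : Fin d → ℕ} {m l : Occ d}
    (hm : ∀ i, rowTotal m i ≤ lam i) (hl : ∀ i, rowTotal l i ≤ lam i) :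
    inner ℂ (youngVec lam m) (youngVec lam l) =
      (((colGroup lam).card * (rowStab (tableau lam m) * rowStab (tableau lam l)) *
        gram lam m l : ℝ) : ℂ) := by
  rw [Submodule.coe_inner, ← reducedGram_tableau hm hl]
  exact inner_youngSym_single _ _

theorem card_colGroup_pos {d : ℕ} (lam : Fin d → ℕ) : 0 < (colGroup lam).card :=
  Finset.card_pos.mpr ⟨1, colGroup_one⟩

theorem norm_youngVec {d : ℕ} {lam : Fin d → ℕ} {m : Occ d} (hm : ∀ i, rowTotal m i ≤ lam i) :
    ‖youngVec lam m‖ =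
      √((colGroup lam).card) * rowStab (tableau lam m) * √(gram lam m m) := by
  have h := inner_youngVec hm hm
  rw [inner_self_eq_norm_sq_to_K] at h
  have h' : ‖youngVec lam m‖ ^ 2 = (colGroup lam).card *
      (rowStab (tableau lam m) * rowStab (tableau lam m)) * gram lam m m :=
    Complex.ofReal_injective ((Complex.ofReal_pow _ _).trans h)
  rw [← Real.sqrt_sq (norm_nonneg _), h', Real.sqrt_mul (by positivity),
    Real.sqrt_mul (by positivity), Real.sqrt_mul_self (by positivity)]

theorem youngVec_ne_zero {d : ℕ} {lam : Fin d → ℕ} {m : Occ d} (hm : ∀ i, rowTotal m i ≤ lam i)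
    (h : 0 < gram lam m m) : youngVec lam m ≠ 0 := by
  rw [← norm_pos_iff, norm_youngVec hm]
  have h1 : (0 : ℝ) < (colGroup lam).card := by exact_mod_cast card_colGroup_pos lam
  have h2 : (0 : ℝ) < rowStab (tableau lam m) := by exact_mod_cast rowStab_pos _
  positivity

theorem norm_youngKet {d : ℕ} {lam : Fin d → ℕ} {m : Occ d} (h : youngVec lam m ≠ 0) :
    ‖youngKet lam m‖ = 1 := by
  rw [youngKet, norm_smul, Complex.norm_real, norm_inv, norm_norm,
    inv_mul_cancel₀ (norm_ne_zero_iff.mpr h)]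

theorem norm_inner_normalize {E : Type*} [NormedAddCommGroup E] [InnerProductSpace ℂ E] (x y : E) :
    ‖inner ℂ (((‖x‖⁻¹ : ℝ) : ℂ) • x) (((‖y‖⁻¹ : ℝ) : ℂ) • y)‖ = ‖x‖⁻¹ * (‖y‖⁻¹ * ‖inner ℂ x y‖) := by
  rw [inner_smul_left, inner_smul_right, norm_mul, norm_mul, RCLike.norm_conj, Complex.norm_real,
    Complex.norm_real, norm_inv, norm_inv, norm_norm, norm_norm]

theorem normalize_aux {K s t : ℝ} (hK : 0 < K) (hs : 0 < s) (ht : 0 < t) (g a b : ℝ) :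
    (√K * s * √a)⁻¹ * ((√K * t * √b)⁻¹ * |K * (s * t) * g|) = |g| / (√a * √b) := by
  rw [abs_mul, abs_of_pos (by positivity : 0 < K * (s * t))]
  have hA : 0 < √K := Real.sqrt_pos.mpr hK
  rw [← Real.mul_self_sqrt hK.le, Real.sqrt_mul_self hA.le, mul_inv, mul_inv, mul_inv, mul_inv,
    div_eq_mul_inv, mul_inv]
  field_simp

theorem norm_inner_youngKet {d : ℕ} {lam : Fin d → ℕ} {m l : Occ d}
    (hm : ∀ i, rowTotal m i ≤ lam i) (hl : ∀ i, rowTotal l i ≤ lam i) :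
    ‖inner ℂ (youngKet lam m) (youngKet lam l)‖ =
      |gram lam m l| / (√(gram lam m m) * √(gram lam l l)) := by
  have h1 : (0 : ℝ) < (colGroup lam).card := by exact_mod_cast card_colGroup_pos lam
  have h2 : (0 : ℝ) < rowStab (tableau lam m) := by exact_mod_cast rowStab_pos _
  have h3 : (0 : ℝ) < rowStab (tableau lam l) := by exact_mod_cast rowStab_pos _
  refine (norm_inner_normalize (youngVec lam m) (youngVec lam l)).trans ?_
  rw [inner_youngVec hm hl, Complex.norm_real, norm_youngVec hm, norm_youngVec hl, Real.norm_eq_abs]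
  exact normalize_aux h1 h2 h3 _ _ _

theorem inner_youngKet_zero {d : ℕ} {lam : Fin d → ℕ} {l : Occ d} (hl0 : l ≠ 0)
    (hl : ∀ i, rowTotal l i ≤ lam i) : inner ℂ (youngKet lam 0) (youngKet lam l) = 0 := by
  rw [← norm_eq_zero, norm_inner_youngKet (fun i => by simp [rowTotal]) hl, gram_zero hl0]
  simp

theorem le_gram_self_of_badWeight {d : ℕ} {lam : Fin d → ℕ} {M N L : ℕ} (hMN : M < N)
    (hMN' : 2 * M ≤ N) (hN : ∀ p : Pairs d, N + lam p.1.2 ≤ lam p.1.1) (hL : ∀ i, lam i ≤ L)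
    {m : Occ d} (hm : m.total ≤ M) :
    (1 - badWeight d L √((M : ℝ) / (N - M))) * simpleCount lam m ≤ gram lam m m := by
  have r1 : (0 : ℝ) < simpleCount lam m := by exact_mod_cast simpleCount_pos hMN hN hm
  have h := sum_badCount_le hMN hMN' hN hL hm {m}
  rw [Finset.sum_singleton, Real.sqrt_mul_self r1.le, mul_one_div, div_le_iff₀ r1] at h
  have := le_gram_self (lam := lam) hm
  linarith

theorem gram_self_pos {d : ℕ} {lam : Fin d → ℕ} {M N L : ℕ} (hMN : M < N)
    (hMN' : 2 * M ≤ N) (hN : ∀ p : Pairs d, N + lam p.1.2 ≤ lam p.1.1) (hL : ∀ i, lam i ≤ L)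
    (hθ : badWeight d L √((M : ℝ) / (N - M)) < 1) {m : Occ d} (hm : m.total ≤ M) :
    0 < gram lam m m := by
  have r1 : (0 : ℝ) < simpleCount lam m := by exact_mod_cast simpleCount_pos hMN hN hm
  exact lt_of_lt_of_le (mul_pos (by linarith) r1) (le_gram_self_of_badWeight hMN hMN' hN hL hm)

/-- Off-diagonal entries are bounded by bad counts, and each squared norm is at least `(1 - θ)`
times its simple count, so normalising costs one factor `(1 - θ)⁻¹`. -/
theorem sum_norm_inner_youngKet_le {d : ℕ} {lam : Fin d → ℕ} {M N L : ℕ} (hMN : M < N)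
    (hMN' : 2 * M ≤ N) (hN : ∀ p : Pairs d, N + lam p.1.2 ≤ lam p.1.1) (hL : ∀ i, lam i ≤ L)
    (hθ : badWeight d L √((M : ℝ) / (N - M)) < 1) {m : Occ d} (hm : m.total ≤ M)
    {F : Finset (Occ d)} (hF : ∀ l ∈ F, l.total ≤ M) (hmF : m ∉ F) :
    ∑ l ∈ F, ‖inner ℂ (youngKet lam m) (youngKet lam l)‖ ≤
      badWeight d L √((M : ℝ) / (N - M)) / (1 - badWeight d L √((M : ℝ) / (N - M))) := by
  set θ := badWeight d L √((M : ℝ) / (N - M)) with hθdef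
  have hθ1 : 0 < 1 - θ := by linarith
  rw [le_div_iff₀ hθ1, Finset.sum_mul]
  refine le_trans (Finset.sum_le_sum fun l hl => ?_) (sum_badCount_le hMN hMN' hN hL hm F)
  have r1 : (0 : ℝ) < simpleCount lam m := by exact_mod_cast simpleCount_pos hMN hN hm
  have r2 : (0 : ℝ) < simpleCount lam l := by exact_mod_cast simpleCount_pos hMN hN (hF l hl)
  have g1 := le_gram_self_of_badWeight hMN hMN' hN hL hm
  have g2 := le_gram_self_of_badWeight hMN hMN' hN hL (hF l hl)
  rw [← hθdef] at g1 g2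
  rw [norm_inner_youngKet (rowTotal_le_of_total_le hMN hN hm)
    (rowTotal_le_of_total_le hMN hN (hF l hl))]
  have hab := abs_gram_le (lam := lam) (M := M) (hF l hl) (m := m) (by rintro rfl; exact hmF hl)
  have hs : (1 - θ) * √((simpleCount lam m : ℝ) * simpleCount lam l) ≤
      √(gram lam m m) * √(gram lam l l) := by
    rw [← Real.sqrt_mul (le_trans (by positivity) g1)]
    refine Real.le_sqrt_of_sq_le ?_
    rw [mul_pow, Real.sq_sqrt (by positivity)]
    calc _ = ((1 - θ) * simpleCount lam m) * ((1 - θ) * simpleCount lam l) := by ring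
      _ ≤ _ := by gcongr; exact le_trans (by positivity) g1
  have hs0 : 0 < (1 - θ) * √((simpleCount lam m : ℝ) * simpleCount lam l) := by positivity
  calc |gram lam m l| / (√(gram lam m m) * √(gram lam l l)) * (1 - θ)
      ≤ badCount lam M m l / ((1 - θ) * √((simpleCount lam m : ℝ) * simpleCount lam l)) *
          (1 - θ) := by gcongr
    _ = _ := by field_simp

/-! ### Almost orthogonal families -/

/-- Schur's test: `|c_m c_l| ≤ (|c_m|² + |c_l|²) / 2` and the symmetry of the Gram matrix reduce the
quadratic form to row sums. -/
theorem norm_sq_sum_le_of_gram {ι E : Type*} [NormedAddCommGroup E] [InnerProductSpace ℂ E]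
    {F : Finset ι} {v : ι → E} {B : ℝ} (h : ∀ m ∈ F, ∑ l ∈ F, ‖inner ℂ (v m) (v l)‖ ≤ B)
    (c : ι → ℂ) : ‖∑ m ∈ F, c m • v m‖ ^ 2 ≤ B * ∑ m ∈ F, ‖c m‖ ^ 2 := by
  have h1 : ‖∑ m ∈ F, c m • v m‖ ^ 2 ≤
      ∑ m ∈ F, ∑ l ∈ F, ‖c m‖ * ‖c l‖ * ‖inner ℂ (v m) (v l)‖ := by
    rw [← @inner_self_eq_norm_sq ℂ]
    refine (RCLike.re_le_norm _).trans ?_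
    rw [sum_inner]
    refine (norm_sum_le _ _).trans (Finset.sum_le_sum fun m _ => ?_)
    rw [inner_sum]
    refine (norm_sum_le _ _).trans (Finset.sum_le_sum fun l _ => ?_)
    rw [inner_smul_left, inner_smul_right, norm_mul, norm_mul, RCLike.norm_conj, mul_assoc]
  have h2 : ∑ m ∈ F, ∑ l ∈ F, ‖c m‖ * ‖c l‖ * ‖inner ℂ (v m) (v l)‖ ≤
      ∑ m ∈ F, ∑ l ∈ F, (‖c m‖ ^ 2 / 2 * ‖inner ℂ (v m) (v l)‖ +
        ‖c l‖ ^ 2 / 2 * ‖inner ℂ (v m) (v l)‖) := by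
    refine Finset.sum_le_sum fun m _ => Finset.sum_le_sum fun l _ => ?_
    rw [← add_mul]
    gcongr
    nlinarith [sq_nonneg (‖c m‖ - ‖c l‖)]
  have h3 : ∑ m ∈ F, ∑ l ∈ F, ‖c l‖ ^ 2 / 2 * ‖inner ℂ (v m) (v l)‖ =
      ∑ m ∈ F, ∑ l ∈ F, ‖c m‖ ^ 2 / 2 * ‖inner ℂ (v m) (v l)‖ := by
    rw [Finset.sum_comm]
    refine Finset.sum_congr rfl fun m _ => Finset.sum_congr rfl fun l _ => ?_
    rw [norm_inner_symm]
  simp_rw [Finset.sum_add_distrib] at h2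
  rw [h3] at h2
  have h4 : ∑ m ∈ F, ∑ l ∈ F, ‖c m‖ ^ 2 / 2 * ‖inner ℂ (v m) (v l)‖ ≤
      ∑ m ∈ F, ‖c m‖ ^ 2 / 2 * B := by
    refine Finset.sum_le_sum fun m hm => ?_
    rw [← Finset.mul_sum]
    have := h m hm
    gcongr
  have h5 : ∑ m ∈ F, ‖c m‖ ^ 2 / 2 * B = B * (∑ m ∈ F, ‖c m‖ ^ 2) / 2 := by
    rw [← Finset.sum_mul, ← Finset.sum_div]; ring
  linarith

/-- The dual of the previous bound: with `c m = ⟨v m, x⟩`, Cauchy–Schwarz gives `Q² ≤ B Q ‖x‖²`. -/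
theorem sum_norm_sq_inner_le_of_gram {ι E : Type*} [NormedAddCommGroup E] [InnerProductSpace ℂ E]
    {F : Finset ι} {v : ι → E} {B : ℝ} (hB : 0 ≤ B)
    (h : ∀ m ∈ F, ∑ l ∈ F, ‖inner ℂ (v m) (v l)‖ ≤ B) (x : E) : ∑ m ∈ F, ‖inner ℂ (v m) x‖ ^ 2 ≤ B * ‖x‖ ^ 2 := by
  set Q := ∑ m ∈ F, ‖inner ℂ (v m) x‖ ^ 2 with hQ
  have hQ0 : 0 ≤ Q := Finset.sum_nonneg fun m _ => by positivity
  have h1 := norm_sq_sum_le_of_gram h fun m => inner ℂ (v m) x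
  have h2 : Q ≤ ‖∑ m ∈ F, (inner ℂ (v m) x : ℂ) • v m‖ * ‖x‖ := by
    refine le_trans (le_of_eq ?_) (norm_inner_le_norm (𝕜 := ℂ) _ _)
    rw [sum_inner]
    have : ∑ m ∈ F, inner ℂ ((inner ℂ (v m) x : ℂ) • v m) x = ((Q : ℝ) : ℂ) := by
      rw [hQ, Complex.ofReal_sum]
      refine Finset.sum_congr rfl fun m _ => ?_
      rw [inner_smul_left, RCLike.conj_mul]
      norm_cast
    rw [this, Complex.norm_real, Real.norm_of_nonneg hQ0]
  rw [← hQ] at h1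
  rcases hQ0.eq_or_lt with h0 | h0
  · rw [← h0]
    positivity
  · have h3 : Q ^ 2 ≤ B * Q * ‖x‖ ^ 2 := by
      calc Q ^ 2 ≤ (‖∑ m ∈ F, (inner ℂ (v m) x : ℂ) • v m‖ * ‖x‖) ^ 2 := by gcongr
        _ = ‖∑ m ∈ F, (inner ℂ (v m) x : ℂ) • v m‖ ^ 2 * ‖x‖ ^ 2 := by ring
        _ ≤ _ := by gcongr
    nlinarith

/-- A Bessel inequality for an almost orthogonal family together with a unit vector orthogonal to it. -/
theorem sum_weighted_inner_le {ι E : Type*} [DecidableEq ι] [NormedAddCommGroup E]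
    [InnerProductSpace ℂ E] {F : Finset ι} {v : ι → E} {o : ι} {B : ℝ} (hB : 1 ≤ B)
    (hvo : ‖v o‖ = 1) (hort : ∀ m ∈ F, inner ℂ (v o) (v m) = 0)
    (h : ∀ m ∈ F, ∑ l ∈ F, ‖inner ℂ (v m) (v l)‖ ≤ B) (x : E) :
    ‖inner ℂ (v o) x‖ ^ 2 + ∑ m ∈ F, B⁻¹ * ‖inner ℂ (v m) x‖ ^ 2 ≤ ‖x‖ ^ 2 := by
  set c : ℂ := inner ℂ (v o) x with hc
  -- The component along `v o` is invisible to the other vectors, so the dual Schur bound is needed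
  -- only on its orthogonal complement.
  have hx : x = c • v o + (x - c • v o) := by abel
  have hperp : inner ℂ (c • v o) (x - c • v o) = 0 := by
    rw [inner_sub_right, inner_smul_left, inner_smul_left, inner_smul_right,
      inner_self_eq_norm_sq_to_K, hvo, ← hc]
    simp
  have h1 : ‖x‖ ^ 2 = ‖c‖ ^ 2 + ‖x - c • v o‖ ^ 2 := by
    conv_lhs => rw [hx]
    rw [sq, norm_add_sq_eq_norm_sq_add_norm_sq_of_inner_eq_zero _ _ hperp, norm_smul, hvo]
    ring
  have h2 := sum_norm_sq_inner_le_of_gram (by linarith) h (x - c • v o)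
  have h3 : ∑ m ∈ F, ‖inner ℂ (v m) (x - c • v o)‖ ^ 2 = ∑ m ∈ F, ‖inner ℂ (v m) x‖ ^ 2 := by
    refine Finset.sum_congr rfl fun m hm => ?_
    rw [inner_sub_right, inner_smul_right, inner_eq_zero_symm.mp (hort m hm), mul_zero, sub_zero]
  rw [h3] at h2
  rw [h1, ← Finset.mul_sum]
  have h4 : B⁻¹ * ∑ m ∈ F, ‖inner ℂ (v m) x‖ ^ 2 ≤ ‖x - c • v o‖ ^ 2 := by
    rw [inv_mul_le_iff₀ (by linarith)]
    exact h2
  linarith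

/-! ### Existence of isometries -/

theorem inner_lp_single {ι : Type*} [DecidableEq ι] (m : ι) (f : lp (fun _ : ι => ℂ) 2) :
    inner ℂ (lp.single 2 m (1 : ℂ)) f = f m := by
  have := lp.inner_single_left (𝕜 := ℂ) m (1 : ℂ) f
  refine this.trans ?_
  simp [inner]

theorem orthonormal_lp_single {ι : Type*} [DecidableEq ι] :
    Orthonormal ℂ fun m : ι => (lp.single 2 m (1 : ℂ) : lp (fun _ : ι => ℂ) 2) := by
  rw [orthonormal_iff_ite]
  intro m l
  rw [inner_lp_single, lp.single_apply, Pi.single_apply]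

theorem re_mul_ofReal (b r : ℝ) : RCLike.re ((b : ℂ) * (RCLike.ofReal r : ℂ)) = b * r := by
  rw [RCLike.mul_re]
  simp

/-- A dilation: the defect `T = 1 - ∑ |w m⟩⟨w m|` is positive. With eigenpairs `(β j, g j)` of `T`,
the coordinates `√(β j) ⟨g j, x⟩` placed on basis vectors outside `F` restore the norm; an infinite
index set leaves room for them. -/
theorem exists_isometry_of_contraction {ι E : Type*} [DecidableEq ι] [Infinite ι]
    [NormedAddCommGroup E] [InnerProductSpace ℂ E] [FiniteDimensional ℂ E] (F : Finset ι)
    (w : ι → E) (h : ∀ x, ∑ m ∈ F, ‖inner ℂ (w m) x‖ ^ 2 ≤ ‖x‖ ^ 2) :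
    ∃ V : E →ₗᵢ[ℂ] lp (fun _ : ι => ℂ) 2, ∀ m ∈ F, ∀ x,
      inner ℂ (lp.single 2 m (1 : ℂ)) (V x) = inner ℂ (w m) x := by
  let T : E →ₗ[ℂ] E := LinearMap.id - ∑ m ∈ F, (InnerProductSpace.rankOne ℂ (w m) (w m)).toLinearMap
  have hTapp : ∀ x, T x = x - ∑ m ∈ F, (inner ℂ (w m) x : ℂ) • w m := by
    intro x; simp [T, LinearMap.sum_apply]
  have hTin : ∀ x y, inner ℂ x (T y) = inner ℂ x y - ∑ m ∈ F, inner ℂ (w m) y * inner ℂ x (w m) := by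
    intro x y
    rw [hTapp, inner_sub_right, inner_sum]
    simp_rw [inner_smul_right]
  have hT : T.IsSymmetric := by
    intro x y
    rw [hTin, ← inner_conj_symm, hTin, map_sub, inner_conj_symm, map_sum]
    congr 1
    refine Finset.sum_congr rfl fun m _ => ?_
    rw [map_mul, inner_conj_symm, inner_conj_symm, mul_comm]
  have hTpos : ∀ x, RCLike.re (inner ℂ x (T x)) = ‖x‖ ^ 2 - ∑ m ∈ F, ‖inner ℂ (w m) x‖ ^ 2 := by
    intro x
    rw [hTin, map_sub, map_sum, inner_self_eq_norm_sq]
    congr 1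
    refine Finset.sum_congr rfl fun m _ => ?_
    rw [← inner_conj_symm x, RCLike.mul_conj]
    norm_cast
  set n := Module.finrank ℂ E with hn
  set g := hT.eigenvectorBasis hn.symm with hg
  set β := hT.eigenvalues hn.symm with hβ
  have hgT : ∀ j x, inner ℂ (g j) (T x) = β j * inner ℂ (g j) x := by
    intro j x
    rw [← hT, hg, hT.apply_eigenvectorBasis, inner_smul_left]
    simp [hβ]
  have hβ0 : ∀ j, 0 ≤ β j := by
    intro j
    have h1 := hTpos (g j)
    rw [hgT, inner_self_eq_norm_sq_to_K, g.norm_eq_one] at h1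
    have h2 := h (g j)
    rw [g.norm_eq_one] at h2
    have h3 : RCLike.re (((β j : ℝ) : ℂ) * ((1 : ℝ) : ℂ) ^ 2) = β j := by simp
    have h4 := h3.symm.trans h1
    linarith
  have hsum : ∀ x, ∑ j, β j * ‖inner ℂ (g j) x‖ ^ 2 =
      ‖x‖ ^ 2 - ∑ m ∈ F, ‖inner ℂ (w m) x‖ ^ 2 := by
    intro x
    rw [← hTpos, ← g.sum_inner_mul_inner, map_sum]
    refine Finset.sum_congr rfl fun j _ => ?_
    rw [hgT, ← inner_conj_symm x, mul_left_comm, RCLike.conj_mul]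
    norm_cast
    exact (re_mul_ofReal _ _).symm
  have : Infinite {m : ι // m ∉ F} := (Finset.finite_toSet F).infinite_compl.to_subtype
  let φ : ℕ ↪ {m : ι // m ∉ F} := Infinite.natEmbedding _
  let ψ : F ⊕ Fin n → ι := Sum.elim Subtype.val fun j => (φ j).1
  have hψ : Function.Injective ψ := by
    rintro (a | a) (b | b) hab
    · exact congrArg _ (Subtype.ext hab)
    · exact absurd (by rw [show (φ b).1 = a.1 from hab.symm]; exact a.2) (φ b).2
    · exact absurd (by rw [show (φ a).1 = b.1 from hab]; exact b.2) (φ a).2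
    · exact congrArg _ (Fin.ext (φ.injective (Subtype.ext hab)))
  let ℓ : F ⊕ Fin n → E →ₗ[ℂ] ℂ :=
    Sum.elim (fun m => (innerSL ℂ (w m)).toLinearMap)
      fun j => ((√(β j) : ℝ) : ℂ) • (innerSL ℂ (g j)).toLinearMap
  let V₀ : E →ₗ[ℂ] lp (fun _ : ι => ℂ) 2 :=
    ∑ a, (ℓ a).smulRight (lp.single 2 (ψ a) (1 : ℂ))
  have hV₀ : ∀ x, V₀ x = ∑ a, ℓ a x • lp.single 2 (ψ a) (1 : ℂ) := by
    intro x; simp [V₀, LinearMap.sum_apply]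
  have hon : Orthonormal ℂ fun a => (lp.single 2 (ψ a) (1 : ℂ) : lp (fun _ : ι => ℂ) 2) :=
    orthonormal_lp_single.comp ψ hψ
  have hnorm : ∀ x, ‖V₀ x‖ = ‖x‖ := by
    intro x
    rw [← sq_eq_sq₀ (norm_nonneg _) (norm_nonneg _), ← @inner_self_eq_norm_sq ℂ, hV₀,
      hon.inner_sum, map_sum, Fintype.sum_sum_type]
    have e1 : ∑ m : F, RCLike.re (starRingEnd ℂ (ℓ (Sum.inl m) x) * ℓ (Sum.inl m) x) =
        ∑ m ∈ F, ‖inner ℂ (w m) x‖ ^ 2 := by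
      rw [← Finset.sum_coe_sort F]
      refine Finset.sum_congr rfl fun m _ => ?_
      rw [RCLike.conj_mul]
      norm_cast
    have e2 : ∑ j : Fin n, RCLike.re (starRingEnd ℂ (ℓ (Sum.inr j) x) * ℓ (Sum.inr j) x) =
        ∑ j, β j * ‖inner ℂ (g j) x‖ ^ 2 := by
      refine Finset.sum_congr rfl fun j _ => ?_
      have : ℓ (Sum.inr j) x = ((√(β j) : ℝ) : ℂ) * inner ℂ (g j) x := rfl
      rw [RCLike.conj_mul, this, norm_mul, Complex.norm_real, Real.norm_of_nonneg (Real.sqrt_nonneg _)]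
      norm_cast
      rw [mul_pow, Real.sq_sqrt (hβ0 j)]
    rw [e1, e2, hsum]
    ring
  refine ⟨⟨V₀, hnorm⟩, fun m hm x => ?_⟩
  have := hon.inner_right_fintype (fun a => ℓ a x) (Sum.inl ⟨m, hm⟩)
  change inner ℂ (lp.single 2 m (1 : ℂ)) (V₀ x) = _
  rw [hV₀]
  exact this

/-! ### Trace norm bounds -/

/-- A bound on the trace norm, in terms of pairs of orthonormal systems. -/
def TraceBound {F : Type*} [NormedAddCommGroup F] [InnerProductSpace ℂ F] (A : F →L[ℂ] F)
    (t : ℝ) : Prop :=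
  ∀ (k : ℕ) (e f : Fin k → F), Orthonormal ℂ e → Orthonormal ℂ f →
    ∑ i, ‖inner ℂ (e i) (A (f i))‖ ≤ t

section
variable {F : Type*} [NormedAddCommGroup F] [InnerProductSpace ℂ F]

theorem TraceBound.traceNorm_le {A : F →L[ℂ] F} {t : ℝ} (h : TraceBound A t) :
    traceNorm A ≤ ENNReal.ofReal t := by
  refine iSup_le fun k => iSup_le fun e => iSup_le fun f => iSup_le fun he => iSup_le fun hf => ?_
  refine le_trans (le_of_eq ?_) (ENNReal.ofReal_le_ofReal (h k e f he hf))
  rw [ENNReal.ofReal_sum_of_nonneg fun i _ => norm_nonneg _]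
  refine Finset.sum_congr rfl fun i _ => ?_
  exact (ofReal_norm _).symm

theorem TraceBound.mono {A : F →L[ℂ] F} {t t' : ℝ} (h : TraceBound A t) (htt : t ≤ t') :
    TraceBound A t' := fun k e f he hf => (h k e f he hf).trans htt

theorem TraceBound.add {A B : F →L[ℂ] F} {t s : ℝ} (hA : TraceBound A t) (hB : TraceBound B s) :
    TraceBound (A + B) (t + s) := by
  intro k e f he hf
  refine le_trans ?_ (add_le_add (hA k e f he hf) (hB k e f he hf))
  rw [← Finset.sum_add_distrib]
  refine Finset.sum_le_sum fun i _ => ?_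
  rw [add_apply, inner_add_right]
  exact norm_add_le _ _

theorem TraceBound.smul {A : F →L[ℂ] F} {t : ℝ} (hA : TraceBound A t) (c : ℂ) :
    TraceBound (c • A) (‖c‖ * t) := by
  intro k e f he hf
  refine le_trans (le_of_eq ?_) (mul_le_mul_of_nonneg_left (hA k e f he hf) (norm_nonneg c))
  rw [Finset.mul_sum]
  refine Finset.sum_congr rfl fun i _ => ?_
  rw [smul_apply, inner_smul_right, norm_mul]

theorem TraceBound.zero : TraceBound (0 : F →L[ℂ] F) 0 := by
  intro k e f _ _
  simp

theorem TraceBound.sum {ι : Type*} {s : Finset ι} {A : ι → F →L[ℂ] F} {t : ι → ℝ}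
    (h : ∀ i ∈ s, TraceBound (A i) (t i)) : TraceBound (∑ i ∈ s, A i) (∑ i ∈ s, t i) := by
  classical
  induction s using Finset.induction_on with
  | empty => simpa using TraceBound.zero
  | insert a s ha ih =>
    rw [Finset.sum_insert ha, Finset.sum_insert ha]
    exact (h a (Finset.mem_insert_self a s)).add
      (ih fun i hi => h i (Finset.mem_insert_of_mem hi))

/-- Cauchy–Schwarz, followed by Bessel's inequality for both orthonormal systems. -/
theorem TraceBound.rankOne (x y : F) :
    TraceBound (InnerProductSpace.rankOne ℂ x y) (‖x‖ * ‖y‖) := by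
  intro k e f he hf
  have h1 : ∑ i, ‖inner ℂ (e i) (InnerProductSpace.rankOne ℂ x y (f i))‖ =
      ∑ i, ‖inner ℂ (e i) x‖ * ‖inner ℂ (f i) y‖ := by
    refine Finset.sum_congr rfl fun i _ => ?_
    rw [InnerProductSpace.rankOne_apply, inner_smul_right, norm_mul, mul_comm, norm_inner_symm y]
  rw [h1]
  refine (Real.sum_mul_le_sqrt_mul_sqrt _ _ _).trans ?_
  gcongr
  · exact (Real.sqrt_le_left (norm_nonneg _)).mpr (he.sum_inner_products_le x)
  · exact (Real.sqrt_le_left (norm_nonneg _)).mpr (hf.sum_inner_products_le y)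

/-- For fixed finite systems the tested sum is continuous in the operator, so the bound passes to
limits. -/
theorem TraceBound.of_tendsto {ι : Type*} {l : Filter ι} [l.NeBot] {A : ι → F →L[ℂ] F}
    {B : F →L[ℂ] F} {t : ℝ} (h : ∀ᶠ i in l, TraceBound (A i) t)
    (hlim : Filter.Tendsto A l (nhds B)) : TraceBound B t := by
  intro k e f he hf
  have hc : Continuous fun A : F →L[ℂ] F => ∑ i, ‖inner ℂ (e i) (A (f i))‖ := by
    refine continuous_finsetSum _ fun i _ => Continuous.norm ?_
    exact (innerSL ℂ (e i)).continuous.comp (ContinuousLinearMap.apply ℂ F (f i)).continuous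
  exact le_of_tendsto ((hc.tendsto B).comp hlim) (h.mono fun i hi => hi k e f he hf)

theorem TraceBound.rankOne_sub {x y : F} (hx : ‖x‖ = 1) (hy : ‖y‖ = 1) :
    TraceBound (InnerProductSpace.rankOne ℂ x x - InnerProductSpace.rankOne ℂ y y)
      (2 * ‖x - y‖) := by
  have e : InnerProductSpace.rankOne ℂ x x - InnerProductSpace.rankOne ℂ y y =
      InnerProductSpace.rankOne ℂ (x - y) x + InnerProductSpace.rankOne ℂ y (x - y) := by
    ext z
    simp only [sub_apply, add_apply,
      InnerProductSpace.rankOne_apply, inner_sub_left, sub_smul, smul_sub]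
    abel
  rw [e]
  refine ((TraceBound.rankOne _ _).add (TraceBound.rankOne _ _)).mono (le_of_eq ?_)
  rw [hx, hy]; ring

variable {E : Type*} [NormedAddCommGroup E] [InnerProductSpace ℂ E] [FiniteDimensional ℂ E]
  [CompleteSpace E] [CompleteSpace F]

/-- By the spectral theorem the conjugated operator is a combination of rank-one projections onto
the unit vectors `V (g j)`, whose nonnegative coefficients sum to the trace. -/
theorem TraceBound.conj_nonneg (V : E →ₗᵢ[ℂ] F) {Y : E →L[ℂ] E}
    (hY : (Y : E →ₗ[ℂ] E).IsSymmetric) (hpos : ∀ x, 0 ≤ RCLike.re (inner ℂ x (Y x))) :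
    TraceBound (V.toContinuousLinearMap ∘L Y ∘L
      ContinuousLinearMap.adjoint V.toContinuousLinearMap)
      (RCLike.re (LinearMap.trace ℂ E (Y : E →ₗ[ℂ] E))) := by
  set n := Module.finrank ℂ E with hn
  set g := hY.eigenvectorBasis hn.symm with hg
  set β := hY.eigenvalues hn.symm with hβ
  have hgT : ∀ j x, inner ℂ (g j) (Y x) = β j * inner ℂ (g j) x := by
    intro j x
    have := hY (g j) x
    refine this.symm.trans ?_
    rw [hg, hY.apply_eigenvectorBasis, inner_smul_left]
    simp [hβ]
  have hβ0 : ∀ j, 0 ≤ β j := by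
    intro j
    have h1 := hpos (g j)
    rw [hgT, inner_self_eq_norm_sq_to_K, g.norm_eq_one] at h1
    simpa using h1
  have hYsum : Y = ∑ j, ((β j : ℝ) : ℂ) • InnerProductSpace.rankOne ℂ (g j) (g j) := by
    ext x
    rw [sum_apply]
    conv_lhs => rw [← g.sum_repr' (Y x)]
    refine Finset.sum_congr rfl fun j _ => ?_
    rw [hgT, smul_apply, InnerProductSpace.rankOne_apply, smul_smul]
  rw [hY.re_trace_eq_sum_eigenvalues hn.symm]
  have e : V.toContinuousLinearMap ∘L Y ∘L
      ContinuousLinearMap.adjoint V.toContinuousLinearMap =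
      ∑ j, ((β j : ℝ) : ℂ) • InnerProductSpace.rankOne ℂ (V (g j)) (V (g j)) := by
    ext z
    conv_lhs => rw [hYsum]
    simp only [ContinuousLinearMap.comp_apply, sum_apply, map_sum,
      smul_apply, map_smul, InnerProductSpace.rankOne_apply,
      ContinuousLinearMap.adjoint_inner_right]
    rfl
  rw [e]
  refine (TraceBound.sum fun j _ => (TraceBound.rankOne (V (g j)) (V (g j))).smul _).mono ?_
  refine Finset.sum_le_sum fun j _ => ?_
  rw [V.norm_map, g.norm_eq_one, Complex.norm_real, Real.norm_of_nonneg (hβ0 j)]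
  simp [hβ]

/-- A state with a positive square root is close to its part on known approximate eigenvectors. -/
theorem TraceBound.channel_sub {ι : Type*} (V : E →ₗᵢ[ℂ] F) {R : E → E}
    (hR : ∀ x y, inner ℂ (R x) y = inner ℂ x (R y))
    {ρ : E →L[ℂ] E} (hρ : ∀ x, ρ x = R (R x)) (htr : LinearMap.trace ℂ E (ρ : E →ₗ[ℂ] E) = 1)
    {L : Finset ι} {u : ι → F} (hu : Orthonormal ℂ u) {v : ι → E} (hv : ∀ m ∈ L, ‖v m‖ = 1)
    {s κ : ι → ℝ} (hs : ∀ m ∈ L, R (v m) = (s m : ℂ) • v m)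
    (hκ : ∀ m ∈ L, ∀ x, inner ℂ (u m) (V x) = (κ m : ℂ) * inner ℂ (v m) x) :
    ∑ m ∈ L, (κ m * s m) ^ 2 ≤ 1 ∧ TraceBound (V.toContinuousLinearMap ∘L ρ ∘L
        ContinuousLinearMap.adjoint V.toContinuousLinearMap -
        ∑ m ∈ L, (((κ m * s m) ^ 2 : ℝ) : ℂ) • InnerProductSpace.rankOne ℂ (u m) (u m))
      (1 - ∑ m ∈ L, (κ m * s m) ^ 2 + ∑ m ∈ L, (κ m * s m) ^ 2 * (2 * √(2 - 2 * κ m))) := by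
  set a : ι → ℝ := fun m => (κ m * s m) ^ 2 with ha
  set Y : E →L[ℂ] E := ρ - ∑ m ∈ L, ((a m : ℝ) : ℂ) • InnerProductSpace.rankOne ℂ (v m) (v m)
    with hYdef
  have hYapp : ∀ x, Y x = ρ x - ∑ m ∈ L, ((a m : ℝ) : ℂ) • (inner ℂ (v m) x : ℂ) • v m := by
    intro x
    simp [hYdef, sum_apply]
  have hYin : ∀ x y, inner ℂ x (Y y) = inner ℂ (R x) (R y) -
      ∑ m ∈ L, (a m : ℂ) * (inner ℂ (v m) y * inner ℂ x (v m)) := by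
    intro x y
    rw [hYapp, inner_sub_right, inner_sum, hρ, hR]
    simp_rw [inner_smul_right]
  have hY : (Y : E →ₗ[ℂ] E).IsSymmetric := by
    intro x y
    change inner ℂ (Y x) y = inner ℂ x (Y y)
    rw [← inner_conj_symm, hYin, hYin, map_sub, inner_conj_symm, map_sum]
    congr 1
    refine Finset.sum_congr rfl fun m _ => ?_
    rw [map_mul, map_mul, inner_conj_symm, inner_conj_symm, Complex.conj_ofReal,
      mul_comm (inner ℂ x (v m))]
  -- As `ρ = R²`, `⟨x, ρ x⟩ = ‖V (R x)‖²`. Bessel's inequality for the `u m` bounds this below by `∑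
  -- (κ m s m)² |⟨v m, x⟩|²`, although the `v m` are not orthogonal.
  have hpos : ∀ x, 0 ≤ RCLike.re (inner ℂ x (Y x)) := by
    intro x
    rw [hYin, map_sub, inner_self_eq_norm_sq, map_sum, sub_nonneg, ← V.norm_map]
    refine le_trans (Finset.sum_le_sum fun m hm => ?_) (hu.sum_inner_products_le (s := L) (V (R x)))
    have e1 : inner ℂ (u m) (V (R x)) = ((κ m * s m : ℝ) : ℂ) * inner ℂ (v m) x := by
      rw [hκ m hm, ← hR, hs m hm, inner_smul_left]
      simp [mul_assoc]
    rw [e1, norm_mul, mul_pow, Complex.norm_real, Real.norm_eq_abs, sq_abs, ← inner_conj_symm x,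
      RCLike.mul_conj]
    refine le_of_eq ?_
    simp only [ha]
    norm_cast
    exact re_mul_ofReal _ _
  have htrY : RCLike.re (LinearMap.trace ℂ E (Y : E →ₗ[ℂ] E)) = 1 - ∑ m ∈ L, a m := by
    have : (Y : E →ₗ[ℂ] E) = (ρ : E →ₗ[ℂ] E) - ∑ m ∈ L, ((a m : ℝ) : ℂ) •
        (InnerProductSpace.rankOne ℂ (v m) (v m) : E →ₗ[ℂ] E) := by
      ext x
      simpa [LinearMap.sum_apply] using hYapp x
    rw [this, map_sub, htr, map_sum]
    have e2 : ∑ m ∈ L, LinearMap.trace ℂ E (((a m : ℝ) : ℂ) •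
        (InnerProductSpace.rankOne ℂ (v m) (v m) : E →ₗ[ℂ] E)) = ((∑ m ∈ L, a m : ℝ) : ℂ) := by
      rw [Complex.ofReal_sum]
      refine Finset.sum_congr rfl fun m hm => ?_
      rw [map_smul, InnerProductSpace.trace_rankOne, inner_self_eq_norm_sq_to_K, hv m hm]
      simp
    rw [e2]
    simp
  have hκ1 : ∀ m ∈ L, ‖V (v m) - u m‖ = √(2 - 2 * κ m) := by
    intro m hm
    have h1 := @norm_sub_sq ℂ _ _ _ _ (V (v m)) (u m)
    rw [V.norm_map, hv m hm, hu.1 m, inner_re_symm, hκ m hm, inner_self_eq_norm_sq_to_K,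
      hv m hm] at h1
    rw [← Real.sqrt_sq (norm_nonneg (V (v m) - u m)), h1]
    congr 1
    simp
    ring
  have e : V.toContinuousLinearMap ∘L ρ ∘L ContinuousLinearMap.adjoint V.toContinuousLinearMap -
        ∑ m ∈ L, ((a m : ℝ) : ℂ) • InnerProductSpace.rankOne ℂ (u m) (u m) =
      V.toContinuousLinearMap ∘L Y ∘L ContinuousLinearMap.adjoint V.toContinuousLinearMap +
        ∑ m ∈ L, ((a m : ℝ) : ℂ) • (InnerProductSpace.rankOne ℂ (V (v m)) (V (v m)) -
          InnerProductSpace.rankOne ℂ (u m) (u m)) := by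
    ext z
    simp only [ContinuousLinearMap.comp_apply, sum_apply,
      smul_apply, InnerProductSpace.rankOne_apply, hYapp,
      ContinuousLinearMap.adjoint_inner_right, sub_apply,
      add_apply, map_sub, map_sum, map_smul, smul_sub, Finset.sum_sub_distrib,
      LinearIsometry.coe_toContinuousLinearMap]
    abel
  have hconj := TraceBound.conj_nonneg V hY hpos
  refine ⟨?_, ?_⟩
  -- Testing with empty systems shows that the trace bound is nonnegative.
  · have := hconj 0 (fun i => i.elim0) (fun i => i.elim0) ⟨fun i => i.elim0, fun i => i.elim0⟩
      ⟨fun i => i.elim0, fun i => i.elim0⟩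
    rw [htrY, Finset.univ_eq_empty, Finset.sum_empty] at this
    linarith
  rw [e]
  refine (hconj.add (TraceBound.sum fun m hm =>
    (TraceBound.rankOne_sub (by rw [V.norm_map, hv m hm]) (hu.1 m)).smul _)).mono ?_
  rw [htrY]
  refine add_le_add le_rfl (Finset.sum_le_sum fun m hm => ?_)
  rw [hκ1 m hm, Complex.norm_real, Real.norm_of_nonneg (sq_nonneg _)]

end

/-! ### Products of geometric distributions -/

/-- The weight of `m` in the product of the geometric distributions with ratios `q p`. -/
def geomWeight {ι : Type*} [Fintype ι] (q : ι → ℝ) (m : ι → ℕ) : ℝ := ∏ p, (1 - q p) * q p ^ m p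

theorem geomWeight_nonneg {ι : Type*} [Fintype ι] {q : ι → ℝ} (h0 : ∀ p, 0 ≤ q p)
    (h1 : ∀ p, q p < 1) (m : ι → ℕ) : 0 ≤ geomWeight q m :=
  Finset.prod_nonneg fun p _ => mul_nonneg (by linarith [h1 p]) (pow_nonneg (h0 p) _)

theorem sum_geomWeight_le {ι : Type*} [Fintype ι] [DecidableEq ι] {q : ι → ℝ} (h0 : ∀ p, 0 ≤ q p)
    (h1 : ∀ p, q p < 1) (F : Finset (ι → ℕ)) : ∑ m ∈ F, geomWeight q m ≤ 1 := by
  have h := sum_prod_geom_le h0 h1 F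
  have hpos : 0 < ∏ p, (1 - q p) := Finset.prod_pos fun p _ => by linarith [h1 p]
  simp only [geomWeight, Finset.prod_mul_distrib]
  rw [← Finset.mul_sum]
  refine (mul_le_mul_of_nonneg_left h hpos.le).trans (le_of_eq ?_)
  rw [Finset.prod_inv_distrib, mul_inv_cancel₀ hpos.ne']

theorem one_sub_sum_le_prod {ι : Type*} (s : Finset ι) {x : ι → ℝ} (h0 : ∀ i ∈ s, 0 ≤ x i)
    (h1 : ∀ i ∈ s, x i ≤ 1) : 1 - ∑ i ∈ s, x i ≤ ∏ i ∈ s, (1 - x i) := by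
  classical
  induction s using Finset.induction_on with
  | empty => simp
  | insert a s ha ih =>
    rw [Finset.sum_insert ha, Finset.prod_insert ha]
    have i1 := ih (fun i hi => h0 i (Finset.mem_insert_of_mem hi))
      (fun i hi => h1 i (Finset.mem_insert_of_mem hi))
    have i2 := h0 a (Finset.mem_insert_self a s)
    have i3 := h1 a (Finset.mem_insert_self a s)
    have i4 : 0 ≤ ∑ i ∈ s, x i :=
      Finset.sum_nonneg fun i hi => h0 i (Finset.mem_insert_of_mem hi)
    nlinarith

theorem le_sum_geomWeight_box {ι : Type*} [Fintype ι] [DecidableEq ι] {q : ι → ℝ}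
    (h0 : ∀ p, 0 ≤ q p) (h1 : ∀ p, q p < 1) (K : ℕ) :
    1 - ∑ p, q p ^ (K + 1) ≤
      ∑ m ∈ Fintype.piFinset fun _ : ι => Finset.range (K + 1), geomWeight q m := by
  have h : ∑ m ∈ Fintype.piFinset fun _ : ι => Finset.range (K + 1), geomWeight q m =
      ∏ p, (1 - q p ^ (K + 1)) := by
    simp only [geomWeight]
    rw [← Finset.prod_univ_sum (fun _ => Finset.range (K + 1)) (fun p k => (1 - q p) * q p ^ k)]
    refine Finset.prod_congr rfl fun p _ => ?_
    rw [← Finset.mul_sum, mul_neg_geom_sum]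
  rw [h]
  exact one_sub_sum_le_prod _ (fun p _ => pow_nonneg (h0 p) _)
    fun p _ => pow_le_one₀ (h0 p) (h1 p).le

/-- The occupation numbers of total at most `M`. -/
def lowOcc (d M : ℕ) : Finset (Occ d) :=
  (Fintype.piFinset fun _ => Finset.range (M + 1)).filter fun m => Occ.total m ≤ M

theorem mem_lowOcc {d M : ℕ} {m : Occ d} : m ∈ lowOcc d M ↔ m.total ≤ M := by
  simp only [lowOcc, Finset.mem_filter, Fintype.mem_piFinset, Finset.mem_range, Nat.lt_succ_iff,
    and_iff_right_iff_imp]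
  exact fun h p => (m.le_total p).trans h

/-- The total is at most `M` on the cube of side `M / #pairs`, whose mass is a product over the
modes. -/
theorem le_sum_geomWeight_lowOcc {d : ℕ} {q : Pairs d → ℝ} (h0 : ∀ p, 0 ≤ q p)
    (h1 : ∀ p, q p < 1) (M : ℕ) :
    1 - ∑ p, q p ^ (M / Fintype.card (Pairs d) + 1) ≤ ∑ m ∈ lowOcc d M, geomWeight q m := by
  refine (le_sum_geomWeight_box h0 h1 _).trans (Finset.sum_le_sum_of_subset_of_nonneg ?_
    fun m _ _ => geomWeight_nonneg h0 h1 m)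
  intro m hm
  rw [Fintype.mem_piFinset] at hm
  rw [mem_lowOcc]
  calc Occ.total m ≤ ∑ _p : Pairs d, M / Fintype.card (Pairs d) :=
        Finset.sum_le_sum fun p _ => Nat.lt_succ_iff.mp (Finset.mem_range.mp (hm p))
    _ ≤ M := by
        rw [Finset.sum_const, Finset.card_univ, smul_eq_mul]
        exact Nat.mul_div_le _ _

/-- The ratio of the weights is a product of `J` factors in `[1 - t, 1 + t]`: Bernoulli's inequality
bounds it below, and `(1 + t)^J ≤ exp (t J) ≤ 1 + 2 t J` above. -/
theorem abs_geomWeight_sub_le {ι : Type*} [Fintype ι] {q q' : ι → ℝ} {t : ℝ}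
    (h0 : ∀ p, 0 ≤ q p) (h1 : ∀ p, q p < 1) (ht0 : 0 ≤ t)
    {ρ σ : ι → ℝ} (hρ : ∀ p, 1 - q' p = ρ p * (1 - q p)) (hσ : ∀ p, q' p = σ p * q p)
    (hρt : ∀ p, |ρ p - 1| ≤ t) (hσt : ∀ p, |σ p - 1| ≤ t) (m : ι → ℕ)
    (ht : t * (Fintype.card ι + ∑ p, m p : ℕ) ≤ 1) :
    |geomWeight q' m - geomWeight q m| ≤
      2 * (t * (Fintype.card ι + ∑ p, m p : ℕ)) * geomWeight q m := by
  set J := Fintype.card ι + ∑ p, m p with hJ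
  have e : geomWeight q' m = (∏ p, ρ p * σ p ^ m p) * geomWeight q m := by
    rw [geomWeight, geomWeight, ← Finset.prod_mul_distrib]
    refine Finset.prod_congr rfl fun p _ => ?_
    rw [hρ, hσ, mul_pow]; ring
  -- Without any factors the smallness hypothesis says nothing about `t`, but then there are no
  -- modes and both weights are one.
  by_cases hJ0 : J = 0
  · have hc : Fintype.card ι = 0 := by omega
    have : IsEmpty ι := Fintype.card_eq_zero_iff.mp hc
    simp [geomWeight, hJ0]
  have ht1 : t ≤ 1 := by
    have : (1 : ℝ) ≤ J := by exact_mod_cast Nat.one_le_iff_ne_zero.mpr hJ0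
    nlinarith
  have hpow : ∀ x : ℝ, ∏ p : ι, x * x ^ m p = x ^ J := by
    intro x
    rw [Finset.prod_mul_distrib, Finset.prod_const, Finset.card_univ, Finset.prod_pow_eq_pow_sum,
      hJ, pow_add]
  have hρ1 : ∀ p, 1 - t ≤ ρ p ∧ ρ p ≤ 1 + t := fun p => by
    have := abs_le.mp (hρt p); constructor <;> linarith
  have hσ1 : ∀ p, 1 - t ≤ σ p ∧ σ p ≤ 1 + t := fun p => by
    have := abs_le.mp (hσt p); constructor <;> linarith
  have ht2 : 0 ≤ 1 - t := by linarith
  have hup : ∏ p, ρ p * σ p ^ m p ≤ 1 + 2 * (t * J) := by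
    have h2 : ∏ p, ρ p * σ p ^ m p ≤ (1 + t) ^ J := by
      rw [← hpow]
      refine Finset.prod_le_prod (fun p _ => ?_) fun p _ => ?_
      · exact mul_nonneg (ht2.trans (hρ1 p).1) (pow_nonneg (ht2.trans (hσ1 p).1) _)
      · exact mul_le_mul (hρ1 p).2 (pow_le_pow_left₀ (ht2.trans (hσ1 p).1) (hσ1 p).2 _)
          (pow_nonneg (ht2.trans (hσ1 p).1) _) (by linarith)
    have h3 : (1 + t) ^ J ≤ Real.exp (t * J) := by
      rw [mul_comm, Real.exp_nat_mul]
      exact pow_le_pow_left₀ (by linarith) (by linarith [Real.add_one_le_exp t]) _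
    have h4 := Real.abs_exp_sub_one_le (x := t * J) (by rwa [abs_of_nonneg (by positivity)])
    rw [abs_of_nonneg (a := t * J) (by positivity)] at h4
    linarith [le_abs_self (Real.exp (t * J) - 1)]
  have hlow : 1 - t * J ≤ ∏ p, ρ p * σ p ^ m p := by
    have h2 : (1 - t) ^ J ≤ ∏ p, ρ p * σ p ^ m p := by
      rw [← hpow]
      refine Finset.prod_le_prod (fun p _ => mul_nonneg ht2 (pow_nonneg ht2 _)) fun p _ => ?_
      exact mul_le_mul (hρ1 p).1 (pow_le_pow_left₀ ht2 (hσ1 p).1 _) (pow_nonneg ht2 _)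
        (ht2.trans (hρ1 p).1)
    have h3 := one_add_mul_le_pow (a := -t) (by linarith) J
    have : (1 + -t) ^ J = (1 - t) ^ J := by ring
    rw [this] at h3
    linarith
  rw [e, ← sub_one_mul, abs_mul, abs_of_nonneg (geomWeight_nonneg h0 h1 m)]
  refine mul_le_mul_of_nonneg_right ?_ (geomWeight_nonneg h0 h1 m)
  rw [abs_le]
  have : 0 ≤ t * (J : ℝ) := by positivity
  constructor <;> linarith

/-! ### The thermal state -/

theorem thermalWeight_log {a b : ℝ} (ha : 0 < a) (hb : 0 < b) (k : ℕ) :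
    thermalWeight (Real.log (a / b)) k = (1 - b / a) * (b / a) ^ k := by
  have h : Real.exp (-Real.log (a / b)) = b / a := by
    rw [Real.exp_neg, Real.exp_log (div_pos ha hb), inv_div]
  rw [thermalWeight, h, ← mul_neg, Real.exp_nat_mul, h]

theorem orthonormal_ket {d : ℕ} : Orthonormal ℂ (ket : Occ d → Fock d) := orthonormal_lp_single

theorem thermalState_eq {d : ℕ} {μ : Fin d → ℝ} (hμ : ∀ i, 0 < μ i) :
    thermalState μ = ∑' m : Occ d, ((geomWeight (fun p : Pairs d => μ p.1.2 / μ p.1.1) m : ℝ) : ℂ) •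
      InnerProductSpace.rankOne ℂ (ket m) (ket m) := by
  rw [thermalState]
  refine tsum_congr fun m => ?_
  rw [geomWeight]
  simp_rw [thermalWeight_log (hμ _) (hμ _)]

/-- The series converges in operator norm, and every finite part of the tail is a positive
combination of projections of total weight at most `1 - ∑_F`; the bound passes to the limit. -/
theorem traceBound_thermal_tail {d : ℕ} {q : Pairs d → ℝ} (h0 : ∀ p, 0 ≤ q p)
    (h1 : ∀ p, q p < 1) (F : Finset (Occ d)) :
    TraceBound ((∑' m : Occ d, ((geomWeight q m : ℝ) : ℂ) •
        InnerProductSpace.rankOne ℂ (ket m) (ket m)) -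
      ∑ m ∈ F, ((geomWeight q m : ℝ) : ℂ) • InnerProductSpace.rankOne ℂ (ket m) (ket m))
      (1 - ∑ m ∈ F, geomWeight q m) := by
  set A : Occ d → Fock d →L[ℂ] Fock d := fun m => ((geomWeight q m : ℝ) : ℂ) •
    InnerProductSpace.rankOne ℂ (ket m) (ket m) with hA
  have hsw : Summable (geomWeight q) :=
    summable_of_sum_le (geomWeight_nonneg h0 h1) (sum_geomWeight_le h0 h1)
  have hs : Summable A := by
    refine Summable.of_norm_bounded hsw fun m => ?_
    rw [hA, norm_smul, InnerProductSpace.norm_rankOne, orthonormal_ket.1 m, Complex.norm_real,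
      Real.norm_of_nonneg (geomWeight_nonneg h0 h1 m)]
    simp
  have hlim := hs.hasSum.sub_const (∑ m ∈ F, A m)
  refine TraceBound.of_tendsto (l := Filter.atTop) (A := fun G => ∑ m ∈ G, A m - ∑ m ∈ F, A m)
    ?_ (Filter.Tendsto.sub_const hs.hasSum _)
  filter_upwards [Filter.eventually_ge_atTop F] with G hG
  rw [← Finset.sum_sdiff hG, add_sub_cancel_right]
  refine (TraceBound.sum fun m _ => (TraceBound.rankOne (ket m) (ket m)).smul _).mono ?_
  have := sum_geomWeight_le h0 h1 G
  rw [← Finset.sum_sdiff hG] at this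
  refine le_trans (Finset.sum_le_sum (g := fun m => geomWeight q m) fun m _ => ?_) (by linarith)
  rw [orthonormal_ket.1 m, Complex.norm_real, Real.norm_of_nonneg (geomWeight_nonneg h0 h1 m)]
  simp

/-! ### The block state -/

theorem tensorPower_diagonal_apply {d : ℕ} {lam : Fin d → ℕ} (w : Fin d → ℂ)
    (x : TensorSpace lam) (a : Box lam → Fin d) :
    tensorPower lam (Matrix.diagonal w) x a = (∏ b, w (a b)) * x a := by
  rw [tensorPower_apply, Finset.sum_eq_single a]
  · simp
  · intro c _ hc
    obtain ⟨b, hb⟩ := Function.ne_iff.mp hc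
    rw [Finset.prod_eq_zero (Finset.mem_univ b) (Matrix.diagonal_apply_ne w (Ne.symm hb)), zero_mul]
  · simp

theorem blockRestrict_diagonal_mul {d : ℕ} {lam : Fin d → ℕ} (w w' : Fin d → ℂ) (x : Block lam) :
    blockRestrict lam (Matrix.diagonal w) (blockRestrict lam (Matrix.diagonal w') x) =
      blockRestrict lam (Matrix.diagonal fun i => w i * w' i) x := by
  apply Subtype.ext
  change tensorPower lam _ (tensorPower lam _ x.1) = tensorPower lam _ x.1
  ext a
  rw [tensorPower_diagonal_apply, tensorPower_diagonal_apply, tensorPower_diagonal_apply,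
    Finset.prod_mul_distrib, mul_assoc]

theorem inner_blockRestrict_diagonal {d : ℕ} (lam : Fin d → ℕ) (w : Fin d → ℝ) (x y : Block lam) :
    inner ℂ (blockRestrict lam (Matrix.diagonal fun i => (w i : ℂ)) x) y =
      inner ℂ x (blockRestrict lam (Matrix.diagonal fun i => (w i : ℂ)) y) := by
  change inner ℂ (tensorPower lam _ x.1) y.1 = inner ℂ x.1 (tensorPower lam _ y.1)
  rw [PiLp.inner_apply, PiLp.inner_apply]
  refine Finset.sum_congr rfl fun a _ => ?_
  rw [tensorPower_diagonal_apply, tensorPower_diagonal_apply, ← Complex.ofReal_prod]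
  change _ * (starRingEnd ℂ) _ = (_ * _) * (starRingEnd ℂ) _
  rw [map_mul, Complex.conj_ofReal]
  ring

/-! ### Existence of the isometries -/

theorem eq_of_inner_eq_one {F : Type*} [NormedAddCommGroup F] [InnerProductSpace ℂ F] {x y : F}
    (hx : ‖x‖ = 1) (hy : ‖y‖ = 1) (h : inner ℂ x y = 1) : x = y := by
  have h1 := @norm_sub_sq ℂ _ _ _ _ x y
  rw [hx, hy, h] at h1
  norm_num at h1
  exact sub_eq_zero.mp h1

theorem Block.inner_smul_left {d : ℕ} {lam : Fin d → ℕ} (c : ℂ) (x y : Block lam) :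
    inner ℂ (c • x) y = (starRingEnd ℂ) c * inner ℂ x y := _root_.inner_smul_left x y c

theorem Block.inner_smul_right {d : ℕ} {lam : Fin d → ℕ} (c : ℂ) (x y : Block lam) :
    inner ℂ x (c • y) = c * inner ℂ x y := _root_.inner_smul_right x y c

/-- Without oscillators the Fock space is a line and has no spare number states for the dilation;
the block is then spanned by `|0,λ⟩`. -/
theorem exists_isometry_of_isEmpty {d : ℕ} [IsEmpty (Pairs d)] {lam : Fin d → ℕ}
    (hlam : Antitone lam) (h : youngVec lam 0 ≠ 0) :
    ∃ V : Block lam →ₗᵢ[ℂ] Fock d, V (youngKet lam 0) = ket 0 := by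
  have hspan : ∀ x : Block lam, ∃ a : ℂ, a • youngKet lam 0 = x := by
    intro x
    have hx : x ∈ Submodule.span ℂ (Set.range fun m : FitOcc lam => youngVec lam m.1) := by
      rw [span_youngVec hlam]; trivial
    have hle : Submodule.span ℂ (Set.range fun m : FitOcc lam => youngVec lam m.1) ≤
        Submodule.span ℂ {youngKet lam 0} := by
      rw [Submodule.span_le]
      rintro _ ⟨m, rfl⟩
      rw [SetLike.mem_coe, Submodule.mem_span_singleton]
      refine ⟨((‖youngVec lam 0‖ : ℝ) : ℂ), ?_⟩
      change _ = youngVec lam m.1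
      rw [Subsingleton.elim m.1 0, youngKet, smul_smul, ← Complex.ofReal_mul,
        mul_inv_cancel₀ (norm_ne_zero_iff.mpr h), Complex.ofReal_one, one_smul]
    exact Submodule.mem_span_singleton.mp (hle hx)
  have hn := norm_youngKet h
  have hin : ∀ a : ℂ, inner ℂ (youngKet lam 0) (a • youngKet lam 0) = a := by
    intro a
    rw [Block.inner_smul_right, inner_self_eq_norm_sq_to_K, hn]
    simp
  have hk : ‖(ket 0 : Fock d)‖ = 1 := orthonormal_ket.1 0
  let T : Block lam →ₗ[ℂ] Fock d :=
    (LinearMap.toSpanSingleton ℂ (Fock d) (ket 0)) ∘ₗ (innerSL ℂ (youngKet lam 0)).toLinearMap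
  have hT : ∀ a : ℂ, T (a • youngKet lam 0) = a • ket 0 := by
    intro a
    change (inner ℂ (youngKet lam 0) (a • youngKet lam 0) : ℂ) • ket 0 = _
    rw [hin]
  refine ⟨⟨T, fun x => ?_⟩, ?_⟩
  · obtain ⟨a, rfl⟩ := hspan x
    rw [hT, norm_smul, norm_smul, hn, hk]
  · change T _ = _
    rw [← one_smul ℂ (youngKet lam 0), hT, one_smul]

theorem exists_isometry_youngKet {d : ℕ} {lam : Fin d → ℕ} (hlam : Antitone lam) {M : ℕ} {B : ℝ}
    (hB : 1 ≤ B) (hfit : ∀ m : Occ d, m.total ≤ M → ∀ i, rowTotal m i ≤ lam i)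
    (hne : ∀ m : Occ d, m.total ≤ M → youngVec lam m ≠ 0)
    (hsum : ∀ m : Occ d, m.total ≤ M → ∀ F : Finset (Occ d), (∀ l ∈ F, l.total ≤ M) → m ∉ F →
      1 + ∑ l ∈ F, ‖inner ℂ (youngKet lam m) (youngKet lam l)‖ ≤ B) :
    ∃ V : Block lam →ₗᵢ[ℂ] Fock d, V (youngKet lam 0) = ket 0 ∧
      ∀ m : Occ d, m ≠ 0 → m.total ≤ M → ∀ v : Block lam,
        inner ℂ (ket m) (V v) = ((1 / √B : ℝ) : ℂ) * inner ℂ (youngKet lam m) v := by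
  classical
  have h0 : Occ.total (0 : Occ d) ≤ M := by simp [Occ.total]
  rcases isEmpty_or_nonempty (Pairs d) with hE | hE
  · obtain ⟨V, hV⟩ := exists_isometry_of_isEmpty hlam (hne 0 h0)
    exact ⟨V, hV, fun m hm => absurd (Subsingleton.elim m 0) hm⟩
  have hB0 : 0 < B := by linarith
  set F := (lowOcc d M).erase 0 with hF
  have hFM : ∀ m ∈ F, m ≠ 0 ∧ m.total ≤ M := fun m hm => by
    rw [hF, Finset.mem_erase, mem_lowOcc] at hm; exact hm
  have hw := sum_weighted_inner_le (F := F) (v := fun m : Occ d => youngKet lam m) (o := 0) hB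
    (norm_youngKet (hne 0 h0))
    (fun m hm => inner_youngKet_zero (hFM m hm).1 (hfit m (hFM m hm).2))
    (fun m hm => by
      have h1 := hsum m (hFM m hm).2 (F.erase m) (fun l hl => (hFM l (Finset.mem_of_mem_erase hl)).2)
        (Finset.notMem_erase m F)
      rw [← Finset.add_sum_erase F _ hm, inner_self_eq_norm_sq_to_K,
        norm_youngKet (hne m (hFM m hm).2)]
      simpa using h1)
  obtain ⟨V, hV⟩ := exists_isometry_of_contraction (lowOcc d M)
    (fun m => if m = 0 then youngKet lam 0 else ((1 / √B : ℝ) : ℂ) • youngKet lam m) (fun x => by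
      rw [← Finset.add_sum_erase _ _ (mem_lowOcc.mpr h0), if_pos rfl]
      refine le_trans (add_le_add le_rfl (Finset.sum_le_sum fun m hm => ?_)) (hw x)
      rw [if_neg (hFM m hm).1, Block.inner_smul_left, norm_mul, mul_pow, RCLike.norm_conj,
        Complex.norm_real, Real.norm_eq_abs, sq_abs, div_pow, Real.sq_sqrt hB0.le, one_pow, one_div])
  refine ⟨V, ?_, fun m hm hmM v => ?_⟩
  -- The image of `|0,λ⟩` is a unit vector whose overlap with `|0⟩` is one, hence it is `|0⟩`.
  · refine (eq_of_inner_eq_one (orthonormal_ket.1 0) ?_ ?_).symm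
    · rw [V.norm_map, norm_youngKet (hne 0 h0)]
    · refine (hV 0 (mem_lowOcc.mpr h0) _).trans ?_
      rw [if_pos rfl, inner_self_eq_norm_sq_to_K, norm_youngKet (hne 0 h0)]
      simp
  · refine (hV m (mem_lowOcc.mpr hmM) v).trans ?_
    rw [if_neg hm, Block.inner_smul_left, Complex.conj_ofReal]

/-! ### Comparison of the thermal state and the image of the block state -/

theorem prod_sqrt_div {d : ℕ} {w : Fin d → ℝ} (hw : ∀ i, 0 < w i) (m : Occ d) :
    (∏ p : Pairs d, (√(w p.1.2) / √(w p.1.1)) ^ m p) ^ 2 =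
      ∏ p : Pairs d, (w p.1.2 / w p.1.1) ^ m p := by
  rw [← Finset.prod_pow]
  refine Finset.prod_congr rfl fun p _ => ?_
  rw [← pow_mul, mul_comm, pow_mul, div_pow, Real.sq_sqrt (hw _).le, Real.sq_sqrt (hw _).le]

theorem channel_blockState_sub {d : ℕ} {lam : Fin d → ℕ} (hlam : Antitone lam) {w : Fin d → ℝ}
    (hw : ∀ i, 0 < w i) (hw' : ∀ i j, i < j → w j < w i) {L : Finset (Occ d)} (h0 : 0 ∈ L)
    (hfit : ∀ m ∈ L, ∀ i, rowTotal m i ≤ lam i) (hne : ∀ m ∈ L, youngVec lam m ≠ 0)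
    (V : Block lam →ₗᵢ[ℂ] Fock d) {κ : Occ d → ℝ}
    (hκ : ∀ m ∈ L, ∀ x, inner ℂ (ket m) (V x) = (κ m : ℂ) * inner ℂ (youngKet lam m) x) :
    ∃ s : Occ d → ℝ, (∀ m, geomWeight (fun p : Pairs d => w p.1.2 / w p.1.1) m ≤ s m ^ 2) ∧
      ∑ m ∈ L, (κ m * s m) ^ 2 ≤ 1 ∧
      TraceBound (channel V (blockState lam (Matrix.diagonal fun i => (w i : ℂ))) -
        ∑ m ∈ L, (((κ m * s m) ^ 2 : ℝ) : ℂ) • InnerProductSpace.rankOne ℂ (ket m) (ket m))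
      (1 - ∑ m ∈ L, (κ m * s m) ^ 2 + ∑ m ∈ L, (κ m * s m) ^ 2 * (2 * √(2 - 2 * κ m))) := by
  obtain ⟨S, hS, hSle, htr⟩ := trace_blockRestrict hlam hw hw' (hne 0 h0)
  have hP : 0 < ∏ b : Box lam, w b.1 := Finset.prod_pos fun b _ => hw _
  set T : ℝ := (∏ b : Box lam, w b.1) * S with hT
  have hTpos : 0 < T := mul_pos hP hS
  have hsT : √T ≠ 0 := (Real.sqrt_pos.mpr hTpos).ne'
  have hws : ∀ i, √(w i) ≠ 0 := fun i => (Real.sqrt_pos.mpr (hw i)).ne'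
  set R₀ := blockRestrict lam (Matrix.diagonal fun i => ((√(w i) : ℝ) : ℂ)) with hR₀
  -- The square root of the block state is again a diagonal tensor power, with entries `√(w i)`. It
  -- has the same eigenvectors `|m,λ⟩`, with eigenvalues `s m`.
  let R : Block lam → Block lam := fun x => (((√T)⁻¹ : ℝ) : ℂ) • R₀ x
  let s : Occ d → ℝ := fun m => (√T)⁻¹ * ((∏ b : Box lam, √(w b.1)) *
    ∏ p : Pairs d, (√(w p.1.2) / √(w p.1.1)) ^ m p)
  have hs2 : ∀ m, s m ^ 2 = S⁻¹ * ∏ p : Pairs d, (w p.1.2 / w p.1.1) ^ m p := by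
    intro m
    simp only [s]
    rw [mul_pow, mul_pow, inv_pow, Real.sq_sqrt hTpos.le, prod_sqrt_div hw, ← Finset.prod_pow]
    simp_rw [Real.sq_sqrt (hw _).le]
    rw [hT]
    field_simp
  refine ⟨s, fun m => ?_, ?_⟩
  · rw [hs2, geomWeight, Finset.prod_mul_distrib]
    refine mul_le_mul_of_nonneg_right ?_ (Finset.prod_nonneg fun p _ =>
      pow_nonneg (div_pos (hw _) (hw _)).le _)
    rw [Finset.prod_inv_distrib] at hSle
    rwa [le_inv_comm₀ _ hS]
    exact Finset.prod_pos fun p _ => by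
      have : w p.1.2 / w p.1.1 < 1 := (div_lt_one (hw _)).mpr (hw' _ _ p.2)
      linarith
  · have : CompleteSpace (Block lam) := FiniteDimensional.complete ℂ (Block lam)
    have hR : ∀ x y, inner ℂ (R x) y = inner ℂ x (R y) := by
      intro x y
      simp only [R]
      rw [Block.inner_smul_left, Block.inner_smul_right, Complex.conj_ofReal, hR₀,
        inner_blockRestrict_diagonal]
    have hρ : ∀ x, blockState lam (Matrix.diagonal fun i => (w i : ℂ)) x = R (R x) := by
      intro x
      have e : R (R x) = ((T⁻¹ : ℝ) : ℂ) •
          blockRestrict lam (Matrix.diagonal fun i => (w i : ℂ)) x := by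
        simp only [R]
        rw [map_smul, smul_smul, hR₀, blockRestrict_diagonal_mul, ← Complex.ofReal_mul, ← mul_inv,
          Real.mul_self_sqrt hTpos.le]
        simp_rw [← Complex.ofReal_mul, Real.mul_self_sqrt (hw _).le]
      rw [e, Complex.ofReal_inv, ← htr]
      rfl
    have htr1 : LinearMap.trace ℂ (Block lam)
        (blockState lam (Matrix.diagonal fun i => (w i : ℂ)) : Block lam →ₗ[ℂ] Block lam) = 1 := by
      change LinearMap.trace ℂ (Block lam) ((LinearMap.trace ℂ (Block lam) _)⁻¹ • _) = 1
      rw [map_smul, smul_eq_mul, inv_mul_cancel₀]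
      rw [htr]
      exact_mod_cast hTpos.ne'
    have hsv : ∀ m ∈ L, R (youngKet lam m) = (s m : ℂ) • youngKet lam m := by
      intro m hm
      simp only [R, s, youngKet]
      rw [map_smul, hR₀, blockRestrict_youngVec hws ⟨m, hfit m hm⟩, smul_smul, smul_smul, smul_smul]
      congr 1
      push_cast
      ring
    have hv : ∀ m ∈ L, ‖youngKet lam m‖ = 1 := fun m hm => norm_youngKet (hne m hm)
    have key := TraceBound.channel_sub (E := Block lam) (F := Fock d) V hR hρ htr1 (L := L)
      orthonormal_ket (v := fun m => youngKet lam m) hv (s := s) (κ := κ) hsv hκ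
    exact key

/-- Three errors are added: the thermal tail outside `L`, the difference of the diagonal weights on
`L`, and the remainder of the channel output. The weights `a` are known only from below, but their
sum is at most one. -/
theorem traceBound_thermal_sub_channel {d : ℕ} {lam : Fin d → ℕ} (hlam : Antitone lam)
    {μ w : Fin d → ℝ} (hμ : ∀ i, 0 < μ i) (hμ' : ∀ i j, i < j → μ j < μ i)
    (hw : ∀ i, 0 < w i) (hw' : ∀ i j, i < j → w j < w i) {L : Finset (Occ d)} (h0 : 0 ∈ L)
    (hfit : ∀ m ∈ L, ∀ i, rowTotal m i ≤ lam i) (hne : ∀ m ∈ L, youngVec lam m ≠ 0)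
    (V : Block lam →ₗᵢ[ℂ] Fock d) {κ : Occ d → ℝ}
    (hκ : ∀ m ∈ L, ∀ x, inner ℂ (ket m) (V x) = (κ m : ℂ) * inner ℂ (youngKet lam m) x)
    {ε t y : ℝ} (hε0 : 0 ≤ ε) (hε1 : ε ≤ 1) (hκ0 : ∀ m ∈ L, 0 ≤ κ m)
    (hκε : ∀ m ∈ L, 1 - ε ≤ κ m ^ 2) (hy : 0 ≤ y)
    (hL : 1 - t ≤ ∑ m ∈ L, geomWeight (fun p : Pairs d => μ p.1.2 / μ p.1.1) m)
    (hwy : ∀ m ∈ L, |geomWeight (fun p : Pairs d => w p.1.2 / w p.1.1) m -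
      geomWeight (fun p : Pairs d => μ p.1.2 / μ p.1.1) m| ≤
        y * geomWeight (fun p : Pairs d => μ p.1.2 / μ p.1.1) m) :
    TraceBound (thermalState μ -
      channel V (blockState lam (Matrix.diagonal fun i => (w i : ℂ)))) (3 * t + 3 * y + 7 * √ε) := by
  obtain ⟨s, hs, hsum, htb⟩ := channel_blockState_sub hlam hw hw' h0 hfit hne V hκ
  have q0 : ∀ p : Pairs d, 0 ≤ μ p.1.2 / μ p.1.1 := fun p => (div_pos (hμ _) (hμ _)).le
  have q1 : ∀ p : Pairs d, μ p.1.2 / μ p.1.1 < 1 := fun p => (div_lt_one (hμ _)).mpr (hμ' _ _ p.2)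
  have q0' : ∀ p : Pairs d, 0 ≤ w p.1.2 / w p.1.1 := fun p => (div_pos (hw _) (hw _)).le
  have q1' : ∀ p : Pairs d, w p.1.2 / w p.1.1 < 1 := fun p => (div_lt_one (hw _)).mpr (hw' _ _ p.2)
  have htail := traceBound_thermal_tail q0 q1 L
  have hg1 := sum_geomWeight_le q0 q1 L
  have hg1' := sum_geomWeight_le q0' q1' L
  have hgn' := geomWeight_nonneg q0' q1'
  rw [thermalState_eq hμ]
  set g := geomWeight (fun p : Pairs d => μ p.1.2 / μ p.1.1) with hg
  set g' := geomWeight (fun p : Pairs d => w p.1.2 / w p.1.1) with hg'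
  set a : Occ d → ℝ := fun m => (κ m * s m) ^ 2 with ha
  have hsε : ε ≤ √ε := Real.le_sqrt_of_sq_le (by nlinarith)
  have hag : ∀ m ∈ L, (1 - ε) * g' m ≤ a m := by
    intro m hm
    simp only [ha, mul_pow]
    exact mul_le_mul (hκε m hm) (hs m) (hgn' m) (sq_nonneg _)
  have hP : 1 - t - y ≤ ∑ m ∈ L, g' m := by
    have h1 : ∑ m ∈ L, (g m - y * g m) ≤ ∑ m ∈ L, g' m := Finset.sum_le_sum fun m hm => by
      have := (abs_le.mp (hwy m hm)).1; linarith
    rw [Finset.sum_sub_distrib, ← Finset.mul_sum] at h1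
    nlinarith
  have hA : 1 - t - y - ε ≤ ∑ m ∈ L, a m := by
    have h1 := Finset.sum_le_sum hag
    rw [← Finset.mul_sum] at h1
    nlinarith
  have hdiff : ∑ m ∈ L, |g m - a m| ≤ t + 2 * y + 2 * ε := by
    -- From `a ≥ (1 - ε) g'` follows `|a - g'| ≤ (a - g') + 2 ε g'`; without absolute values the sum
    -- is controlled by the total masses.
    have h1 : ∀ m ∈ L, |g m - a m| ≤ y * g m + (a m - g' m + 2 * (ε * g' m)) := by
      intro m hm
      have e1 := abs_le.mp (hwy m hm)
      have e2 := hag m hm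
      have e3 := mul_nonneg hε0 (hgn' m)
      rw [abs_le]
      constructor <;> linarith
    refine (Finset.sum_le_sum h1).trans ?_
    rw [Finset.sum_add_distrib, Finset.sum_add_distrib, Finset.sum_sub_distrib, ← Finset.mul_sum,
      ← Finset.mul_sum, ← Finset.mul_sum]
    nlinarith
  have hmid : TraceBound (∑ m ∈ L, ((g m : ℝ) : ℂ) • InnerProductSpace.rankOne ℂ (ket m) (ket m) -
      ∑ m ∈ L, ((a m : ℝ) : ℂ) • InnerProductSpace.rankOne ℂ (ket m : Fock d) (ket m))
      (t + 2 * y + 2 * ε) := by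
    rw [← Finset.sum_sub_distrib]
    simp_rw [← sub_smul, ← Complex.ofReal_sub]
    refine (TraceBound.sum fun m _ => (TraceBound.rankOne (ket m) (ket m)).smul _).mono ?_
    refine le_trans (le_of_eq ?_) hdiff
    refine Finset.sum_congr rfl fun m _ => ?_
    rw [orthonormal_ket.1 m, Complex.norm_real, Real.norm_eq_abs]
    simp
  have hκs : ∑ m ∈ L, a m * (2 * √(2 - 2 * κ m)) ≤ 4 * √ε := by
    have h1 : ∀ m ∈ L, a m * (2 * √(2 - 2 * κ m)) ≤ a m * (4 * √ε) := by
      intro m hm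
      refine mul_le_mul_of_nonneg_left ?_ (sq_nonneg _)
      have h2 : √(2 - 2 * κ m) ≤ 2 * √ε := by
        rw [Real.sqrt_le_left (by positivity), mul_pow, Real.sq_sqrt hε0]
        nlinarith [hκ0 m hm, hκε m hm]
      linarith
    refine (Finset.sum_le_sum h1).trans ?_
    rw [← Finset.sum_mul]
    nlinarith [Real.sqrt_nonneg ε]
  have hlast := htb.smul (-1)
  rw [norm_neg, norm_one, one_mul, neg_one_smul] at hlast
  -- The contributions are `t`, `t + 2y + 2ε` and `t + y + ε + 4√ε`, and `ε ≤ √ε`.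
  have h := ((htail.add hmid).add hlast).mono (t' := 3 * t + 3 * y + 7 * √ε) (by linarith)
  convert h using 1
  abel

/-! ### Asymptotics -/

theorem eventually_mul_rpow_le {b b' : ℝ} (hb : b < b') (D : ℝ) {c : ℝ} (hc : 0 < c) :
    ∀ᶠ n : ℕ in Filter.atTop, D * (n : ℝ) ^ b ≤ c * (n : ℝ) ^ b' := by
  have h := ((tendsto_rpow_neg_atTop (sub_pos.mpr hb)).comp
    (tendsto_natCast_atTop_atTop (R := ℝ))).const_mul D
  rw [mul_zero] at h
  filter_upwards [h.eventually_le_const hc, Filter.eventually_gt_atTop 0] with n hn h0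
  have hn0 : (0 : ℝ) < n := by exact_mod_cast h0
  have e : D * (n : ℝ) ^ b = (D * (n : ℝ) ^ (-(b' - b))) * (n : ℝ) ^ b' := by
    rw [mul_assoc, ← Real.rpow_add hn0]
    congr 2; ring
  rw [e]
  exact mul_le_mul_of_nonneg_right hn (by positivity)

theorem badWeight_le {d L : ℕ} {σ : ℝ} (hσ : 0 ≤ σ)
    (h : ((d ^ d) ^ 2 : ℕ) * (L * σ ^ 3) ≤ (1 : ℝ)) :
    badWeight d L σ ≤ 2 * (((d ^ d) ^ 2 : ℕ) * (L * σ ^ 3)) := by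
  set x : ℝ := ((d ^ d) ^ 2 : ℕ) * σ ^ 3 with hx
  have hx0 : 0 ≤ x := by positivity
  have e : (((d ^ d) ^ 2 : ℕ) : ℝ) * (L * σ ^ 3) = L * x := by rw [hx]; ring
  rw [e] at h ⊢
  have h3 : (1 + x) ^ L ≤ Real.exp (L * x) := by
    rw [Real.exp_nat_mul]
    exact pow_le_pow_left₀ (by linarith) (by linarith [Real.add_one_le_exp x]) _
  have h5 : 0 ≤ (L : ℝ) * x := by positivity
  have h4 := Real.abs_exp_sub_one_le (x := L * x) (by rwa [abs_of_nonneg h5])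
  rw [abs_of_nonneg h5] at h4
  rw [badWeight, ← hx]
  linarith [le_abs_self (Real.exp (L * x) - 1)]

theorem sqrt_cube_le {n : ℕ} (hn : 0 < n) {η δ M N : ℝ} (hδ : 0 < δ) (hM : M ≤ (n : ℝ) ^ η)
    (hN : n * δ / 4 ≤ N) :
    n * √(M / N) ^ 3 ≤ (4 / δ) ^ (3 / 2 : ℝ) * (n : ℝ) ^ ((3 * η - 1) / 2) := by
  have hn0 : (0 : ℝ) < n := by exact_mod_cast hn
  have hv : M / N ≤ 4 / δ * (n : ℝ) ^ (η - 1) := by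
    have e : 4 / δ * (n : ℝ) ^ (η - 1) = (n : ℝ) ^ η / (n * δ / 4) := by
      rw [Real.rpow_sub_one hn0.ne']; field_simp
    rw [e]
    exact div_le_div₀ (by positivity) hM (by positivity) hN
  have h1 : √(M / N) ^ 3 ≤ (4 / δ * (n : ℝ) ^ (η - 1)) ^ (3 / 2 : ℝ) := by
    have e : (4 / δ * (n : ℝ) ^ (η - 1)) ^ (3 / 2 : ℝ) = √(4 / δ * (n : ℝ) ^ (η - 1)) ^ 3 := by
      rw [Real.sqrt_eq_rpow, ← Real.rpow_natCast, ← Real.rpow_mul (by positivity)]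
      norm_num
    rw [e]
    exact pow_le_pow_left₀ (Real.sqrt_nonneg _) (Real.sqrt_le_sqrt hv) 3
  rw [Real.mul_rpow (by positivity) (by positivity), ← Real.rpow_mul hn0.le] at h1
  calc n * √(M / N) ^ 3 ≤ n * ((4 / δ) ^ (3 / 2 : ℝ) * (n : ℝ) ^ ((η - 1) * (3 / 2))) :=
        mul_le_mul_of_nonneg_left h1 hn0.le
    _ = (4 / δ) ^ (3 / 2 : ℝ) * ((n : ℝ) ^ ((η - 1) * (3 / 2)) * n) := by ring
    _ = _ := by
        rw [← Real.rpow_add_one hn0.ne']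
        congr 2; ring

/-- The bad weight has order `n^((3η-1)/2)`, an exponent below both `0` and `(9η-2)/12`, so
constants and powers of `δ` are absorbed into the threshold for `n`. The factor `1/2` leaves room
for the division by `1 - θ` in the overlap bound. -/
theorem eventually_badWeight_le (d : ℕ) {η δ : ℝ} (hη : η < 2 / 9) (hδ : 0 < δ) :
    ∀ᶠ n : ℕ in Filter.atTop,
      ⌊(n : ℝ) ^ η⌋₊ < ⌊n * δ / 2⌋₊ ∧ 2 * ⌊(n : ℝ) ^ η⌋₊ ≤ ⌊n * δ / 2⌋₊ ∧
        badWeight d n √((⌊(n : ℝ) ^ η⌋₊ : ℝ) / (⌊n * δ / 2⌋₊ - ⌊(n : ℝ) ^ η⌋₊)) ≤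
          1 / 2 * min 1 ((n : ℝ) ^ ((9 * η - 2) / 12) / δ ^ (1 / 3 : ℝ)) := by
  set K : ℝ := (((d ^ d) ^ 2 : ℕ) : ℝ) with hK
  set D : ℝ := K * (4 / δ) ^ (3 / 2 : ℝ) with hD
  have hδ3 : 0 < δ ^ (1 / 3 : ℝ) := by positivity
  filter_upwards [eventually_mul_rpow_le (show η < 1 by linarith) 1 (show 0 < δ / 8 by positivity),
    eventually_mul_rpow_le (show (0 : ℝ) < 1 by norm_num) 1 (show 0 < δ / 8 by positivity),
    eventually_mul_rpow_le (show (3 * η - 1) / 2 < 0 by linarith) D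
      (show (0 : ℝ) < 1 / 4 by norm_num),
    eventually_mul_rpow_le (show (3 * η - 1) / 2 < (9 * η - 2) / 12 by linarith) D
      (show 0 < 1 / 4 / δ ^ (1 / 3 : ℝ) by positivity),
    Filter.eventually_gt_atTop 0] with n h1 h2 h3 h4 hn
  have hn0 : (0 : ℝ) < n := by exact_mod_cast hn
  rw [Real.rpow_one] at h1 h2
  rw [Real.rpow_zero] at h2 h3
  have hM : (⌊(n : ℝ) ^ η⌋₊ : ℝ) ≤ (n : ℝ) ^ η := Nat.floor_le (by positivity)
  have hN : n * δ / 2 - 1 < (⌊n * δ / 2⌋₊ : ℝ) := by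
    linarith [Nat.lt_floor_add_one (n * δ / 2)]
  set M := ⌊(n : ℝ) ^ η⌋₊
  set N := ⌊n * δ / 2⌋₊
  have c1 : M < N := by
    have : (M : ℝ) < N := by nlinarith
    exact_mod_cast this
  have c2 : 2 * M ≤ N := by
    have : 2 * (M : ℝ) ≤ N := by nlinarith
    exact_mod_cast this
  refine ⟨c1, c2, ?_⟩
  have h5 := sqrt_cube_le hn hδ hM (show n * δ / 4 ≤ (N : ℝ) - M by nlinarith)
  have h6 : K * (n * √((M : ℝ) / (N - M)) ^ 3) ≤ D * (n : ℝ) ^ ((3 * η - 1) / 2) := by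
    rw [hD, mul_assoc]
    exact mul_le_mul_of_nonneg_left h5 (by positivity)
  have h7 := badWeight_le (d := d) (L := n) (Real.sqrt_nonneg ((M : ℝ) / (N - M)))
    (by rw [← hK]; linarith)
  rw [← hK] at h7
  have h8 : 1 / 4 / δ ^ (1 / 3 : ℝ) * (n : ℝ) ^ ((9 * η - 2) / 12) =
      1 / 4 * ((n : ℝ) ^ ((9 * η - 2) / 12) / δ ^ (1 / 3 : ℝ)) := by ring
  rw [h8] at h4
  have h9 : D * (n : ℝ) ^ ((3 * η - 1) / 2) ≤
      1 / 4 * min 1 ((n : ℝ) ^ ((9 * η - 2) / 12) / δ ^ (1 / 3 : ℝ)) := by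
    rcases min_choice 1 ((n : ℝ) ^ ((9 * η - 2) / 12) / δ ^ (1 / 3 : ℝ)) with h | h <;> rw [h] <;>
      linarith
  linarith

/-- From `q ≤ 1 - δ ≤ exp (-δ)` the power is at most `exp (-δ n^η / c)`, uniformly in `q`, which
beats every power of `n`. -/
theorem eventually_card_mul_pow_le (c : ℕ) {η δ s : ℝ} (hη : 0 < η) (hδ : 0 < δ) {D : ℝ}
    (hD : 0 < D) :
    ∀ᶠ n : ℕ in Filter.atTop, ∀ q : ℝ, 0 ≤ q → q ≤ 1 - δ →
      c * q ^ (⌊(n : ℝ) ^ η⌋₊ / c + 1) ≤ D * (n : ℝ) ^ s := by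
  rcases Nat.eq_zero_or_pos c with rfl | hc
  · refine Filter.Eventually.of_forall fun n q _ _ => ?_
    rw [Nat.cast_zero, zero_mul]
    positivity
  have hc0 : (0 : ℝ) < c := by exact_mod_cast hc
  have ht : Filter.Tendsto (fun n : ℕ => (n : ℝ) ^ η) Filter.atTop Filter.atTop :=
    (tendsto_rpow_atTop hη).comp tendsto_natCast_atTop_atTop
  have h := ((isLittleO_exp_neg_mul_rpow_atTop (show 0 < δ / c by positivity) (s / η)).comp_tendsto
    ht).bound (show 0 < D / c by positivity)
  filter_upwards [h] with n hn q q0 q1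
  simp only [Function.comp_apply, Real.norm_eq_abs, Real.abs_exp] at hn
  rw [abs_of_nonneg (by positivity), ← Real.rpow_mul (by positivity), mul_div_cancel₀ _ hη.ne'] at hn
  set k := ⌊(n : ℝ) ^ η⌋₊ / c + 1 with hk
  -- The `+ 1` after the integer division compensates both roundings.
  have hk1 : (n : ℝ) ^ η ≤ c * k := by
    have h1 : ⌊(n : ℝ) ^ η⌋₊ < c * k := by rw [hk]; exact Nat.lt_mul_div_succ _ hc
    have h2 : ((⌊(n : ℝ) ^ η⌋₊ + 1 : ℕ) : ℝ) ≤ ((c * k : ℕ) : ℝ) := by exact_mod_cast h1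
    push_cast at h2
    linarith [Nat.lt_floor_add_one ((n : ℝ) ^ η)]
  have hq : q ^ k ≤ Real.exp (-(δ / c) * (n : ℝ) ^ η) := by
    calc q ^ k ≤ Real.exp (-δ) ^ k :=
          pow_le_pow_left₀ q0 (q1.trans (by linarith [Real.add_one_le_exp (-δ)])) _
      _ = Real.exp (-(δ * k)) := by rw [← Real.exp_nat_mul]; ring_nf
      _ ≤ _ := by
          rw [Real.exp_le_exp, neg_mul, neg_le_neg_iff, div_mul_eq_mul_div, div_le_iff₀ hc0]
          nlinarith
  calc c * q ^ k ≤ c * (D / c * (n : ℝ) ^ s) := mul_le_mul_of_nonneg_left (hq.trans hn) hc0.le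
    _ = D * (n : ℝ) ^ s := by field_simp

/-! ### Perturbation of the eigenvalues -/

theorem abs_localEigenvalue_sub_le {d n : ℕ} (hn : 0 < n) {γ : ℝ} (μ : Fin d → ℝ)
    {u : Fin (d - 1) → ℝ} (hu : ∀ i, |u i| ≤ (n : ℝ) ^ γ) (i : Fin d) :
    |localEigenvalue n μ u i - μ i| ≤ d * (n : ℝ) ^ (γ - 1 / 2) := by
  have hn0 : (0 : ℝ) < n := by exact_mod_cast hn
  have hd : 1 ≤ d := i.pos
  have hd' : (1 : ℝ) ≤ d := by exact_mod_cast hd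
  have hs : (n : ℝ) ^ (γ - 1 / 2) = (n : ℝ) ^ γ / √n := by
    rw [Real.rpow_sub hn0, Real.sqrt_eq_rpow]
  have hsq : 0 < √(n : ℝ) := Real.sqrt_pos.mpr hn0
  have key : ∀ z : ℝ, |z| ≤ d * (n : ℝ) ^ γ → |z / √n| ≤ d * (n : ℝ) ^ (γ - 1 / 2) := by
    intro z hz
    rw [hs, abs_div, abs_of_pos hsq, ← mul_div_assoc]
    exact div_le_div_of_nonneg_right hz hsq.le
  have hp : 0 ≤ (n : ℝ) ^ γ := by positivity
  rw [localEigenvalue]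
  split_ifs with h
  · rw [add_sub_cancel_left]
    exact key _ ((hu _).trans (by nlinarith))
  · rw [sub_sub_cancel_left, abs_neg]
    -- The last eigenvalue absorbs `d - 1` shifts, hence the factor `d`.
    refine key _ ((Finset.abs_sum_le_sum_abs _ _).trans ((Finset.sum_le_sum fun j _ => hu j).trans ?_))
    rw [Finset.sum_const, Finset.card_univ, Fintype.card_fin, nsmul_eq_mul, Nat.cast_sub hd]
    push_cast
    nlinarith

theorem perturbed_ratio {a b a' b' δ h : ℝ} (hδ : 0 < δ) (hb : δ ≤ b) (hab : δ ≤ a - b)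
    (ha' : |a' - a| ≤ h) (hb' : |b' - b| ≤ h) (hh : h ≤ δ / 4) :
    ∃ ρ σ : ℝ, 1 - b' / a' = ρ * (1 - b / a) ∧ b' / a' = σ * (b / a) ∧
      |ρ - 1| ≤ 4 * (h / δ) ∧ |σ - 1| ≤ 4 * (h / δ) := by
  have h1 := abs_le.mp ha'
  have h2 := abs_le.mp hb'
  have b0 : 0 < b := by linarith
  have a0 : 0 < a := by linarith
  have a1 : 0 < a' := by linarith
  have a2 : 3 / 4 * a ≤ a' := by linarith
  have h0 : 0 ≤ h := (abs_nonneg _).trans ha'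
  have ab : 0 < a - b := by linarith
  refine ⟨(a' - b') * a / (a' * (a - b)), b' * a / (a' * b), ?_, ?_, ?_, ?_⟩
  · field_simp
  · field_simp
  · have e : (a' - b') * a / (a' * (a - b)) - 1 =
        ((a' - a) * b - (b' - b) * a) / (a' * (a - b)) := by field_simp; ring
    have e1 : |(a' - a) * b - (b' - b) * a| ≤ h * b + h * a := by
      refine (abs_sub _ _).trans (add_le_add ?_ ?_)
      · rw [abs_mul, abs_of_pos b0]; exact mul_le_mul_of_nonneg_right ha' b0.le
      · rw [abs_mul, abs_of_pos a0]; exact mul_le_mul_of_nonneg_right hb' a0.le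
    rw [e, abs_div, abs_of_pos (by positivity : 0 < a' * (a - b)), ← mul_div_assoc,
      div_le_div_iff₀ (by positivity) hδ]
    -- The numerator is at most `h (a + b) ≤ 2 h a`, so the quotient is at most `(8/3) h / δ`, below
    -- `4 h / δ`.
    have e2 : 3 / 4 * a * δ ≤ a' * (a - b) := mul_le_mul a2 hab hδ.le a1.le
    nlinarith [mul_le_mul_of_nonneg_left e2 h0, mul_le_mul_of_nonneg_right e1 hδ.le,
      mul_nonneg (mul_nonneg h0 hδ.le) ab.le]
  · have e : b' * a / (a' * b) - 1 = ((b' - b) * a - (a' - a) * b) / (a' * b) := by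
      field_simp; ring
    have e1 : |(b' - b) * a - (a' - a) * b| ≤ h * a + h * b := by
      refine (abs_sub _ _).trans (add_le_add ?_ ?_)
      · rw [abs_mul, abs_of_pos a0]; exact mul_le_mul_of_nonneg_right hb' a0.le
      · rw [abs_mul, abs_of_pos b0]; exact mul_le_mul_of_nonneg_right ha' b0.le
    rw [e, abs_div, abs_of_pos (by positivity : 0 < a' * b), ← mul_div_assoc,
      div_le_div_iff₀ (by positivity) hδ]
    have e2 : 3 / 4 * a * δ ≤ a' * b := mul_le_mul a2 hb hδ.le a1.le
    nlinarith [mul_le_mul_of_nonneg_left e2 h0, mul_le_mul_of_nonneg_right e1 hδ.le,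
      mul_nonneg (mul_nonneg h0 hδ.le) ab.le]

/-! ### Typical diagrams -/

/-- Consecutive rows differ by at least `nδ - 2 n^α`, and the fluctuation uses up at most half of
`nδ`. -/
theorem typicalDiagrams_gap {d n : ℕ} {α δ : ℝ} {μ : Fin d → ℝ} (hδ : 0 < δ)
    (hμ : ∀ i j, i < j → δ ≤ μ i - μ j) {lam : Fin d → ℕ} (hlam : lam ∈ typicalDiagrams n α μ)
    (hn : (n : ℝ) ^ α ≤ δ / 4 * n) (p : Pairs d) : ⌊n * δ / 2⌋₊ + lam p.1.2 ≤ lam p.1.1 := by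
  have h1 := (abs_le.mp (hlam.2.2 p.1.1)).1
  have h2 := (abs_le.mp (hlam.2.2 p.1.2)).2
  have h3 := mul_le_mul_of_nonneg_left (hμ _ _ p.2) (Nat.cast_nonneg (α := ℝ) n)
  have h4 : (⌊n * δ / 2⌋₊ : ℝ) ≤ n * δ / 2 := Nat.floor_le (by positivity)
  have : ((⌊n * δ / 2⌋₊ + lam p.1.2 : ℕ) : ℝ) ≤ lam p.1.1 := by
    push_cast
    nlinarith
  exact_mod_cast this

theorem typicalDiagrams_le {d n : ℕ} {α : ℝ} {μ : Fin d → ℝ} {lam : Fin d → ℕ}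
    (hlam : lam ∈ typicalDiagrams n α μ) (i : Fin d) : lam i ≤ n := by
  rw [← hlam.2.1]
  exact Finset.single_le_sum (fun j _ => Nat.zero_le (lam j)) (Finset.mem_univ i)

/-! ### Assembly of the two claims for fixed `n` and `λ`. -/

theorem inner_eq_of_map_eq {E F : Type*} [NormedAddCommGroup E]
    [InnerProductSpace ℂ E] [NormedAddCommGroup F] [InnerProductSpace ℂ F] (V : E →ₗᵢ[ℂ] F) {x : E}
    {u : F} (h : V x = u) (y : E) : inner ℂ u (V y) = inner ℂ x y := by
  rw [← h, V.inner_map_map]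

theorem sqrt_rpow_div {x y : ℝ} (hx : 0 ≤ x) (hy : 0 ≤ y) (a b : ℝ) :
    √(x ^ a / y ^ b) = x ^ (a / 2) / y ^ (b / 2) := by
  rw [Real.sqrt_div (by positivity), Real.sqrt_eq_rpow, Real.sqrt_eq_rpow, ← Real.rpow_mul hx,
    ← Real.rpow_mul hy, mul_one_div, mul_one_div]

theorem exists_isBlockIsometry {d n : ℕ} {η δ : ℝ} {lam : Fin d → ℕ} (hlam : Antitone lam) {N : ℕ}
    (hδ : 0 < δ) (hMN : ⌊(n : ℝ) ^ η⌋₊ < N) (hMN' : 2 * ⌊(n : ℝ) ^ η⌋₊ ≤ N)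
    (hN : ∀ p : Pairs d, N + lam p.1.2 ≤ lam p.1.1) (hL : ∀ i, lam i ≤ n)
    (hθ : badWeight d n √((⌊(n : ℝ) ^ η⌋₊ : ℝ) / (N - ⌊(n : ℝ) ^ η⌋₊)) ≤
      1 / 2 * min 1 ((n : ℝ) ^ ((9 * η - 2) / 12) / δ ^ (1 / 3 : ℝ))) :
    ∃ V : Block lam →ₗᵢ[ℂ] Fock d, IsBlockIsometry n η δ 1 lam V := by
  set M := ⌊(n : ℝ) ^ η⌋₊ with hM
  set θ := badWeight d n √((M : ℝ) / (N - M)) with hθdef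
  set ε := (n : ℝ) ^ ((9 * η - 2) / 12) / δ ^ (1 / 3 : ℝ) with hε
  have hθ1 : θ ≤ 1 / 2 := hθ.trans (by linarith [min_le_left 1 ε])
  have hθε : θ ≤ ε / 2 := hθ.trans (by linarith [min_le_right 1 ε])
  have hε0 : 0 ≤ ε := by positivity
  have hfit : ∀ m : Occ d, m.total ≤ M → ∀ i, rowTotal m i ≤ lam i :=
    fun m hm => rowTotal_le_of_total_le hMN hN hm
  have hne : ∀ m : Occ d, m.total ≤ M → youngVec lam m ≠ 0 := fun m hm =>
    youngVec_ne_zero (hfit m hm) (gram_self_pos hMN hMN' hN hL (by linarith) hm)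
  obtain ⟨V, hV0, hV⟩ := exists_isometry_youngKet hlam (B := 1 + ε) (by linarith) hfit hne
    (fun m hm F hF hmF => by
      have h := sum_norm_inner_youngKet_le hMN hMN' hN hL (by linarith) hm hF hmF
      -- From `θ ≤ 1/2` and `θ ≤ ε/2`.
      have h2 : θ / (1 - θ) ≤ ε := by
        rw [div_le_iff₀ (by linarith)]
        nlinarith
      linarith)
  refine ⟨V, hV0, fun m hm0 hm v => ?_⟩
  rw [one_mul]
  exact hV m hm0 (Nat.le_floor hm) v

/-- The comparison uses only `|m| ≤ n^η'` with some `η' ≤ η`. The perturbation estimate needs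
`n^(γ-1/2+η')` to be small relative to `δ`, which can fail for `η` itself when `γ` is close to
`1/2`; the tail beyond `n^η'` is still negligible. -/
theorem traceNorm_thermal_sub_channel_le {d n : ℕ} {η η' γ δ : ℝ} {lam : Fin d → ℕ}
    (hlam : Antitone lam) {N : ℕ} (hn : 0 < n) (hδ : 0 < δ) (hη' : 0 ≤ η') (hηη' : η' ≤ η)
    (hMN : ⌊(n : ℝ) ^ η⌋₊ < N) (hMN' : 2 * ⌊(n : ℝ) ^ η⌋₊ ≤ N)
    (hN : ∀ p : Pairs d, N + lam p.1.2 ≤ lam p.1.1) (hL : ∀ i, lam i ≤ n)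
    (hθ : badWeight d n √((⌊(n : ℝ) ^ η⌋₊ : ℝ) / (N - ⌊(n : ℝ) ^ η⌋₊)) < 1)
    (hε1 : (n : ℝ) ^ ((9 * η - 2) / 12) / δ ^ (1 / 3 : ℝ) ≤ 1)
    (htail : ∀ q : ℝ, 0 ≤ q → q ≤ 1 - δ → Fintype.card (Pairs d) *
      q ^ (⌊(n : ℝ) ^ η'⌋₊ / Fintype.card (Pairs d) + 1) ≤
        (n : ℝ) ^ ((9 * η - 2) / 24) / δ ^ (1 / 6 : ℝ))
    (hpert : d * (n : ℝ) ^ (γ - 1 / 2) ≤ δ / 4)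
    (hpert' : 4 * d * (Fintype.card (Pairs d) + 1) * (n : ℝ) ^ (γ - 1 / 2 + η') ≤ δ)
    {μ : Fin d → ℝ} (hμ' : ∀ i j, i < j → δ ≤ μ i - μ j) (hμ : ∀ i, δ ≤ μ i)
    (hμ1 : ∑ i, μ i = 1) {V : Block lam →ₗᵢ[ℂ] Fock d} (hV : IsBlockIsometry n η δ 1 lam V)
    {u : Fin (d - 1) → ℝ} (hu : ∀ i, |u i| ≤ (n : ℝ) ^ γ) :
    traceNorm (thermalState μ - channel V (blockState lam (localState n μ u))) ≤
      ENNReal.ofReal ((10 + 24 * d * (Fintype.card (Pairs d) + 1)) *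
        ((n : ℝ) ^ (-(1 / 2) + γ + η) / δ + (n : ℝ) ^ ((9 * η - 2) / 24) / δ ^ (1 / 6 : ℝ))) := by
  set c := Fintype.card (Pairs d) with hc
  set ε := (n : ℝ) ^ ((9 * η - 2) / 12) / δ ^ (1 / 3 : ℝ) with hε
  have hn1 : (1 : ℝ) ≤ n := by exact_mod_cast hn
  have hn0 : (0 : ℝ) < n := by linarith
  have hsε : √ε = (n : ℝ) ^ ((9 * η - 2) / 24) / δ ^ (1 / 6 : ℝ) := by
    rw [hε, sqrt_rpow_div hn0.le hδ.le]
    congr 2 <;> ring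
  have hε0 : 0 ≤ ε := by positivity
  have hμ0 : ∀ i, 0 < μ i := fun i => hδ.trans_le (hμ i)
  have hμle : ∀ i, μ i ≤ 1 := fun i => by
    rw [← hμ1]
    exact Finset.single_le_sum (fun j _ => (hμ0 j).le) (Finset.mem_univ i)
  set h : ℝ := d * (n : ℝ) ^ (γ - 1 / 2) with hh
  set w := localEigenvalue n μ u with hw
  have hwμ : ∀ i, |w i - μ i| ≤ h := abs_localEigenvalue_sub_le hn μ hu
  have hw0 : ∀ i, 0 < w i := fun i => by
    have := (abs_le.mp (hwμ i)).1
    linarith [hμ i]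
  have hww : ∀ i j, i < j → w j < w i := fun i j hij => by
    have h1 := (abs_le.mp (hwμ i)).1
    have h2 := (abs_le.mp (hwμ j)).2
    linarith [hμ' i j hij]
  have hμμ : ∀ i j, i < j → μ j < μ i := fun i j hij => by linarith [hμ' i j hij]
  set M := ⌊(n : ℝ) ^ η'⌋₊ with hM
  have hMM : M ≤ ⌊(n : ℝ) ^ η⌋₊ :=
    Nat.floor_le_floor (Real.rpow_le_rpow_of_exponent_le hn1 hηη')
  have hLM : ∀ m ∈ lowOcc d M, m.total ≤ ⌊(n : ℝ) ^ η⌋₊ := fun m hm =>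
    (mem_lowOcc.mp hm).trans hMM
  have hfit : ∀ m ∈ lowOcc d M, ∀ i, rowTotal m i ≤ lam i :=
    fun m hm => rowTotal_le_of_total_le hMN hN (hLM m hm)
  have hne : ∀ m ∈ lowOcc d M, youngVec lam m ≠ 0 := fun m hm =>
    youngVec_ne_zero (hfit m hm) (gram_self_pos hMN hMN' hN hL hθ (hLM m hm))
  have h0 : (0 : Occ d) ∈ lowOcc d M := mem_lowOcc.mpr (by simp [Occ.total])
  have q0 : ∀ p : Pairs d, 0 ≤ μ p.1.2 / μ p.1.1 := fun p => (div_pos (hμ0 _) (hμ0 _)).le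
  have q1 : ∀ p : Pairs d, μ p.1.2 / μ p.1.1 < 1 :=
    fun p => (div_lt_one (hμ0 _)).mpr (hμμ _ _ p.2)
  -- Since `μ_j ≤ 1`, `μ_k ≤ μ_j - δ ≤ (1 - δ) μ_j`.
  have q2 : ∀ p : Pairs d, μ p.1.2 / μ p.1.1 ≤ 1 - δ := fun p => by
    rw [div_le_iff₀ (hμ0 _)]
    nlinarith [hμ' _ _ p.2, hμle p.1.1]
  let κ : Occ d → ℝ := fun m => if m = 0 then 1 else 1 / √(1 + ε)
  have hκ : ∀ m ∈ lowOcc d M, ∀ x,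
      inner ℂ (ket m) (V x) = (κ m : ℂ) * inner ℂ (youngKet lam m) x := by
    intro m hm x
    by_cases hm0 : m = 0
    · subst hm0
      have e := inner_eq_of_map_eq V hV.1 x
      simpa [κ] using e
    · have e := hV.2 m hm0 ((Nat.le_floor_iff (by positivity)).mp (hLM m hm)) x
      rw [one_mul] at e
      simp only [κ, if_neg hm0]
      exact e
  have hκ0 : ∀ m ∈ lowOcc d M, 0 ≤ κ m := fun m _ => by
    simp only [κ]; split_ifs <;> positivity
  have hκε : ∀ m ∈ lowOcc d M, 1 - ε ≤ κ m ^ 2 := fun m _ => by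
    simp only [κ]
    split_ifs
    · linarith
    · rw [div_pow, one_pow, Real.sq_sqrt (by positivity), le_div_iff₀ (by positivity)]
      nlinarith
  choose! ρ σ hρ hσ hρt hσt using fun p : Pairs d =>
    perturbed_ratio hδ (hμ p.1.2) (hμ' _ _ p.2) (hwμ p.1.1) (hwμ p.1.2) hpert
  -- `Y` bounds the relative change `4h/δ` of one factor times the number of factors, which is at
  -- most `(c + 1) n^η'`.
  set Y : ℝ := 4 * d * (c + 1) * (n : ℝ) ^ (γ - 1 / 2 + η') / δ with hY
  have hY1 : Y ≤ 1 := (div_le_one hδ).mpr hpert'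
  have hh0 : 0 ≤ h := by positivity
  have hJ : ∀ m ∈ lowOcc d M, 4 * (h / δ) * (c + ∑ p, m p : ℕ) ≤ Y := by
    intro m hm
    have h1 : ((∑ p, m p : ℕ) : ℝ) ≤ (n : ℝ) ^ η' :=
      (Nat.cast_le.mpr (mem_lowOcc.mp hm)).trans (Nat.floor_le (by positivity))
    have h2 : (1 : ℝ) ≤ (n : ℝ) ^ η' := Real.one_le_rpow hn1 hη'
    have h3 : ((c + ∑ p, m p : ℕ) : ℝ) ≤ (c + 1) * (n : ℝ) ^ η' := by
      push_cast at h1 ⊢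
      nlinarith [Nat.cast_nonneg (α := ℝ) c]
    refine (mul_le_mul_of_nonneg_left h3 (by positivity)).trans (le_of_eq ?_)
    rw [hY, hh, Real.rpow_add hn0]
    ring
  have hwy : ∀ m ∈ lowOcc d M, |geomWeight (fun p : Pairs d => w p.1.2 / w p.1.1) m -
      geomWeight (fun p : Pairs d => μ p.1.2 / μ p.1.1) m| ≤
        2 * Y * geomWeight (fun p : Pairs d => μ p.1.2 / μ p.1.1) m := by
    intro m hm
    refine (abs_geomWeight_sub_le q0 q1 (t := 4 * (h / δ)) (by positivity) hρ hσ hρt hσt m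
      ((hJ m hm).trans hY1)).trans ?_
    exact mul_le_mul_of_nonneg_right (by linarith [hJ m hm]) (geomWeight_nonneg q0 q1 m)
  have ht : 1 - √ε ≤ ∑ m ∈ lowOcc d M, geomWeight (fun p : Pairs d => μ p.1.2 / μ p.1.1) m := by
    refine le_trans ?_ (le_sum_geomWeight_lowOcc q0 q1 M)
    rw [hsε]
    refine sub_le_sub_left ?_ 1
    rcases isEmpty_or_nonempty (Pairs d) with hE | ⟨⟨p₀⟩⟩
    · rw [Finset.univ_eq_empty, Finset.sum_empty]
      positivity
    -- The tail hypothesis concerns a single ratio, so every mode is compared with the one of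
    -- largest ratio.
    · obtain ⟨p₁, _, hp₁⟩ := Finset.exists_max_image Finset.univ
        (fun p : Pairs d => μ p.1.2 / μ p.1.1) ⟨p₀, Finset.mem_univ _⟩
      refine le_trans (Finset.sum_le_card_nsmul _ _
        ((μ p₁.1.2 / μ p₁.1.1) ^ (M / c + 1)) fun p hp =>
          pow_le_pow_left₀ (q0 p) (hp₁ p hp) _) ?_
      rw [Finset.card_univ, nsmul_eq_mul]
      exact htail _ (q0 p₁) (q2 p₁)
  have key := traceBound_thermal_sub_channel hlam hμ0 hμμ hw0 hww h0 hfit hne V hκ hε0 hε1 hκ0 hκε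
    (t := √ε) (y := 2 * Y) (by positivity) ht hwy
  refine (TraceBound.traceNorm_le key).trans (ENNReal.ofReal_le_ofReal ?_)
  rw [← hsε]
  have hYle : Y ≤ 4 * d * (c + 1) * ((n : ℝ) ^ (-(1 / 2) + γ + η) / δ) := by
    rw [hY, mul_div_assoc]
    refine mul_le_mul_of_nonneg_left (div_le_div_of_nonneg_right
      (Real.rpow_le_rpow_of_exponent_le hn1 (by linarith)) hδ.le) (by positivity)
  have hx : 0 ≤ (n : ℝ) ^ (-(1 / 2) + γ + η) / δ := by positivity
  have hdc : (0 : ℝ) ≤ d * (c + 1) := by positivity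
  -- The total is `3√ε + 6Y + 7√ε`, whence the constants `10` and `24 d (c + 1)`.
  nlinarith [mul_nonneg hdc (Real.sqrt_nonneg ε)]

end QLAN

end

/-! ### Choice of the constants and of the threshold `n₀`. -/

theorem lemma6 (d : ℕ) (η : ℝ) (hη0 : 0 < η) (hη : η < 2 / 9) :
    ∃ c : ℝ, 0 < c ∧ ∀ α γ : ℝ, 1 / 2 < α → α < 1 → 0 < γ → γ < 1 / 2 →
      ∃ C : ℝ, ∀ δ : ℝ, 0 < δ → ∃ n₀ : ℕ, ∀ n : ℕ, n₀ ≤ n →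
        ∀ μ : Fin d → ℝ, (∀ i j, i < j → δ ≤ μ i - μ j) → (∀ i, δ ≤ μ i) → ∑ i, μ i = 1 →
          ∀ lam ∈ QLAN.typicalDiagrams n α μ,
            (∃ V : QLAN.Block lam →ₗᵢ[ℂ] QLAN.Fock d, QLAN.IsBlockIsometry n η δ c lam V) ∧
            ∀ V : QLAN.Block lam →ₗᵢ[ℂ] QLAN.Fock d, QLAN.IsBlockIsometry n η δ c lam V →
              ∀ u : Fin (d - 1) → ℝ, (∀ i, |u i| ≤ (n : ℝ) ^ γ) →
                QLAN.traceNorm (QLAN.thermalState μ -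
                    QLAN.channel V (QLAN.blockState lam (QLAN.localState n μ u))) ≤
                  ENNReal.ofReal (C * ((n : ℝ) ^ (-(1 / 2) + γ + η) / δ +
                    (n : ℝ) ^ ((9 * η - 2) / 24) / δ ^ (1 / 6 : ℝ))) := by
  refine ⟨1, one_pos, fun α γ _ hα _ hγ => ⟨10 + 24 * d * (Fintype.card (QLAN.Pairs d) + 1),
    fun δ hδ => ?_⟩⟩
  set c := Fintype.card (QLAN.Pairs d) with hc
  -- Half of the room `1/2 - γ` is left, so that `n^(γ-1/2+η')` tends to zero for every `γ < 1/2`.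
  obtain ⟨η', hη'0, hη'1, hη'2⟩ : ∃ η' : ℝ, 0 < η' ∧ η' ≤ η ∧ γ - 1 / 2 + η' < 0 :=
    ⟨min η ((1 / 2 - γ) / 2), lt_min hη0 (by linarith), min_le_left _ _, by
      linarith [min_le_right η ((1 / 2 - γ) / 2)]⟩
  have hδ6 : 0 < 1 / δ ^ (1 / 6 : ℝ) := by positivity
  have hδ3 : 0 < δ ^ (1 / 3 : ℝ) := by positivity
  obtain ⟨n₀, hn₀⟩ := Filter.eventually_atTop.mp
    ((QLAN.eventually_badWeight_le d hη hδ).and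
    ((QLAN.eventually_mul_rpow_le hα 1 (show 0 < δ / 4 by positivity)).and
    ((QLAN.eventually_mul_rpow_le (show (9 * η - 2) / 12 < 0 by linarith) 1 hδ3).and
    ((QLAN.eventually_card_mul_pow_le c (s := (9 * η - 2) / 24) hη'0 hδ hδ6).and
    ((QLAN.eventually_mul_rpow_le (show γ - 1 / 2 < 0 by linarith) d
      (show 0 < δ / 4 by positivity)).and
    ((QLAN.eventually_mul_rpow_le hη'2 (4 * d * (c + 1)) hδ).and
    (Filter.eventually_gt_atTop 0)))))))
  refine ⟨n₀, fun n hn μ hμ' hμ hμ1 lam hlam => ?_⟩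
  obtain ⟨⟨hMN, hMN', hθ⟩, h1, h2, h3, h4, h5, hn0⟩ := hn₀ n hn
  simp only [Real.rpow_one, Real.rpow_zero, one_mul, mul_one] at h1 h2 h4 h5
  have hN := QLAN.typicalDiagrams_gap hδ hμ' hlam h1
  have hL := QLAN.typicalDiagrams_le hlam
  refine ⟨QLAN.exists_isBlockIsometry hlam.1 hδ hMN hMN' hN hL hθ, fun V hV u hu => ?_⟩
  refine QLAN.traceNorm_thermal_sub_channel_le hlam.1 hn0 hδ hη'0.le hη'1 hMN hMN' hN hL
    (hθ.trans_lt ?_) ((div_le_one hδ3).mpr h2) (fun q q0 q1 => (h3 q q0 q1).trans (le_of_eq ?_))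
    h4 h5 hμ' hμ hμ1 hV hu
  · linarith [min_le_left 1 ((n : ℝ) ^ ((9 * η - 2) / 12) / δ ^ (1 / 3 : ℝ))]
  · ring
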